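/- **Setting.** For $f:\{0,1\}^m\to\{0,1\}^n$ let $O_f$ be the unitary $|x\rangle|y\rangle\mapsto|x\rangle|y\oplus f(x)\rangle$. A *$q$-query quantum algorithm* $\mathcal A$ is given by quantum circuits $U_1,\dots,U_{q+1}$ made of two-qubit gates. Run with an oracle $f$, it prepares $U_{q+1}O_fU_q\cdots O_fU_1|0\rangle$, where $O_f$ acts on fixed query registers, and then measures output registers holding $\vec x\in X^k$ and $z\in Z=\{0,1\}^l$, where $X=\{0,1\}^m$ and $Y=\{0,1\}^n$. Its running time is $q$ plus the total number of its gates. A *black-box quantum algorithm* $\mathsf{Sim}^{H,G,\mathcal A}$ is one fixed program, independent of $H$, $G$, $\mathcal A$, $m$, $n$, $k$ and $q$. It receives $(n,m,k,q)$ as input. It can draw uniform random numbers, apply elementary gates to its own qubits and to the query and output registers of $\mathcal A$, query $O_H$ and $O_G$, and apply the circuits $U_i$ as black boxes to the registers of $\mathcal A$. Its running time is the number of its steps plus the running times of the circuits $U_i$ that it calls. At the end it measures its output $(\vec x,\vec y,z)\in X^k\times Y^k\times Z$. Write $\vec x\equiv\vec x'$ if the two lists agree up to a permutation. For $\vec x_{\sf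 o}\in X^k$ without duplicate entries and $\vec y_{\sf o}\in Y^k$, let $H_{\vec x_{\sf o},\vec y_{\sf o}}$ be the function with value $(\vec y_{\sf o})_i$ at $(\vec x_{\sf o})_i$ for every $i$ and equal to $H$ elsewhere. For a relation $R\subseteq X^k\times Y^k\times Z$ and an oracle $H$, let $V^H(\vec x,\vec y,z)=1$ if and only if $(\vec x,\vec y,z)\in R$ and $H(x_i)=y_i$ for all $i$. **Theorem (Coherent Measure-and-Reprogram).** There are a black-box quantum algorithm $\mathsf{Sim}^{H,G,\mathcal A}$ and a polynomial $p$ such that for all $m,n\ge 0$, $k\ge1$, $q\ge 0$ and every $q$-query quantum algorithm $\mathcal A$ the following holds. 1. In every run, $\mathsf{Sim}$ makes exactly $k$ quantum queries to $G$, and its running time is at most $p(n,m,k,T)$, where $T$ is the running time of $\mathcal A$. 2. For all functions $H,G:\{0,1\}^m\to\{0,1\}^n$, every relation $R$ with its predicate $V$, every $\vec x_{\sf o}\in X^k$ without duplicate entries, and $\vec y_{\sf o}=G(\vec x_{\sf o})$ (entrywise), writing $H'=H_{\vec x_{\sf o},\vec y_{\sf o}}$, $$\Pr\left[\mathsf{Sim}^{H,G,\mathcal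 A}\to(\vec x,\vec y,z),\ \vec x\equiv\vec x_{\sf o},\ V^{H'}(\vec x,\vec y,z)=1\right]\ \ge\ \frac{1}{2^{2k}\binom{q+k}{k}^2}\,\Pr\left[\mathcal A^{H'}\to(\vec x,z),\ \vec x\equiv\vec x_{\sf o},\ V^{H'}(\vec x,H'(\vec x),z)=1\right].$$ -/

import Mathlib

open scoped ENNReal

noncomputable section

namespace QOracle

/-- Bit strings of length `m`. -/
abbrev Bits (m : ℕ) : Type := Fin m → Bool

/-- The reprogrammed oracle: the value `y i` at the point `x i`, and `H` elsewhere
(meant for `x` without duplicate entries). -/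
def reprogram {m n k : ℕ} (H : Bits m → Bits n) (x : Fin k → Bits m) (y : Fin k → Bits n) :
    Bits m → Bits n := by
  classical
  exact fun u => if h : ∃ i, x i = u then y h.choose else H u

/-- Equality of two lists of inputs up to a permutation. -/
def EquivPerm {α : Type} {k : ℕ} (x x' : Fin k → α) : Prop :=
  ∃ π : Equiv.Perm (Fin k), x = x' ∘ π

/-- The verification predicate of a relation `R` with respect to an oracle `H`: it accepts
`(x, y, z)` iff `(x, y, z) ∈ R` and `y i = H (x i)` for every `i`. -/
def Accepts {m n k : ℕ} {Z : Type}
    (R : (Fin k → Bits m) → (Fin k → Bits n) → Z → Prop) (H : Bits m → Bits n)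
    (x : Fin k → Bits m) (y : Fin k → Bits n) (z : Z) : Prop :=
  R x y z ∧ ∀ i, H (x i) = y i

section Memory

/-! ### Quantum memories

A memory consists of registers, named by the elements of a type `ρ`; every register is a sequence
of qubits, so a qubit is a pair (register, position). The supply of qubits is unlimited, but a
computation that starts from the all-zero string only ever produces finite superpositions of
computational basis states. -/

variable {ρ : Type} [DecidableEq ρ]

/-- Computational basis states: the contents of all qubits. -/
abbrev Basis (ρ : Type) : Type := ρ × ℕ → Bool

/-- Pure states: finite superpositions of computational basis states. -/
abbrev QState (ρ : Type) : Type := Basis ρ →₀ ℂ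

/-- The initial state: all qubits are zero. -/
def initState (ρ : Type) : QState ρ := Finsupp.single (fun _ => false) 1

/-- The first `l` bits of register `r`. -/
def readReg (l : ℕ) (r : ρ) (s : Basis ρ) : Bits l := fun j => s (r, j)

/-- The probability that a measurement of `ψ` in the computational basis gives an outcome with
property `P` (the squared norm of the projection of `ψ`). -/
def measProb (ψ : QState ρ) (P : Basis ρ → Prop) : ℝ≥0∞ := by
  classical
  exact ∑ s ∈ ψ.support with P s, ‖ψ s‖ₑ ^ 2

/-- The linear map that sends the basis state `s` to the basis state `g s`. -/
def basisMap (g : Basis ρ → Basis ρ) : QState ρ →ₗ[ℂ] QState ρ := Finsupp.lmapDomain ℂ ℂ g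

/-- The oracle unitary `|x⟩|y⟩ ↦ |x⟩|y ⊕ f x⟩`, where `x` is the content of register `rin` and `y`
the content of register `rout` (no operation if the two registers coincide). -/
def oracle {m n : ℕ} (f : Bits m → Bits n) (rin rout : ρ) : QState ρ →ₗ[ℂ] QState ρ :=
  if rin = rout then LinearMap.id
  else basisMap fun s p =>
    if h : p.1 = rout ∧ p.2 < n then xor (s p) (f (readReg m rin s) ⟨p.2, h.2⟩) else s p

/-- A two-qubit gate: an arbitrary unitary on two different qubits (this includes the one-qubit
gates). -/
structure Gate (ρ : Type) where
  fst : ρ × ℕ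
  snd : ρ × ℕ
  ne : fst ≠ snd
  mat : Matrix.unitaryGroup (Bool × Bool) ℂ

/-- The action of a gate on states. -/
def Gate.apply (g : Gate ρ) : QState ρ →ₗ[ℂ] QState ρ :=
  Finsupp.linearCombination ℂ fun s : Basis ρ =>
    ∑ b : Bool × Bool,
      Finsupp.single (Function.update (Function.update s g.fst b.1) g.snd b.2)
        ((g.mat : Matrix (Bool × Bool) (Bool × Bool) ℂ) b (s g.fst, s g.snd))

/-- A list of gates, applied from left to right. -/
def applyGates (L : List (Gate ρ)) (ψ : QState ρ) : QState ρ :=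
  L.foldl (fun φ g => g.apply φ) ψ

/-- The same gate inside a larger memory. -/
def Gate.lift {ρ' : Type} (e : ρ ↪ ρ') (g : Gate ρ) : Gate ρ' where
  fst := (e g.fst.1, g.fst.2)
  snd := (e g.snd.1, g.snd.2)
  ne := fun h => g.ne (Prod.ext (e.injective (Prod.mk.inj h).1) (Prod.mk.inj h).2)
  mat := g.mat

end Memory

/-! ### Quantum query algorithms -/

/-- The registers of a query algorithm: query input, query output, the `i`-th entry of the output
list of inputs, the auxiliary output `z`, and the workspace. -/
inductive AReg where
  | qin
  | qout
  | out (i : ℕ)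
  | aux
  | work
  deriving DecidableEq

/-- A `q`-query quantum algorithm: circuits `U 0, …, U q`, where an oracle query is made after each
of `U 0, …, U (q - 1)`. Nothing is measured before the end. -/
structure QueryAlg (q : ℕ) where
  U : Fin (q + 1) → List (Gate AReg)

namespace QueryAlg

variable {q : ℕ}

/-- The `i`-th circuit (empty for `i > q`). -/
def circuit (A : QueryAlg q) (i : ℕ) : List (Gate AReg) :=
  if h : i < q + 1 then A.U ⟨i, h⟩ else []

/-- The state right after the `i`-th query to `f`. -/
def state {m n : ℕ} (A : QueryAlg q) (f : Bits m → Bits n) : ℕ → QState AReg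
  | 0 => initState AReg
  | i + 1 => oracle f AReg.qin AReg.qout (applyGates (A.circuit i) (A.state f i))

/-- The final state: `q` queries and the last circuit. -/
def finalState {m n : ℕ} (A : QueryAlg q) (f : Bits m → Bits n) : QState AReg :=
  applyGates (A.circuit q) (A.state f q)

/-- The running time: the number of queries plus the number of elementary gates. -/
def time (A : QueryAlg q) : ℕ := q + ∑ i, (A.U i).length

/-- The probability that the algorithm, run with oracle `f`, outputs `(x, z)` such that `P x z`.
Here `x` is a list of `k` strings of length `m`, and `z` a string of length `l`. -/
def outputProb {m n : ℕ} (A : QueryAlg q) (f : Bits m → Bits n) (k l : ℕ)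
    (P : (Fin k → Bits m) → Bits l → Prop) : ℝ≥0∞ :=
  measProb (A.finalState f) fun s =>
    P (fun i => readReg m (AReg.out i) s) (readReg l AReg.aux s)

end QueryAlg

/-! ### Black-box quantum algorithms with access to two oracles and to a query algorithm

A black-box algorithm is a fixed program for a classical controller with finitely many
natural-number variables, which can draw random numbers and which issues operations on a quantum
memory. The memory contains that of the query algorithm `A`. The operations are elementary gates,
queries to the two oracles `H` and `G`, and the application of the `i`-th circuit of `A` as a black
box to the memory of `A`. The workspace of `A` is otherwise out of reach. -/

/-- The registers of a black-box algorithm: those of the query algorithm, and its own ones. -/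
inductive SReg where
  | ofA (r : AReg)
  | own (a i : ℕ)
  deriving DecidableEq

/-- The registers of the query algorithm inside the memory of the black-box algorithm. -/
def SReg.ofAEmb : AReg ↪ SReg := ⟨SReg.ofA, fun _ _ h => by injection h⟩

/-- Quantum operations, with registers named by `ρ` and numbers given by elements of `ν`: NOT, CNOT,
Toffoli, Hadamard and π/8 gates, queries to `H` and `G` with an input and an output register,
and the application of a circuit of the query algorithm. -/
inductive Op (ρ ν : Type) where
  | not (t : ρ × ν)
  | cnot (c t : ρ × ν)
  | toffoli (c d t : ρ × ν)
  | hadamard (t : ρ × ν)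
  | phase (t : ρ × ν)
  | queryH (rin rout : ρ)
  | queryG (rin rout : ρ)
  | callA (i : ν)

/-- Renaming of the registers and of the numbers of an operation. -/
def Op.map {ρ ν ρ' ν' : Type} (f : ρ → ρ') (g : ν → ν') : Op ρ ν → Op ρ' ν'
  | .not t => .not (t.map f g)
  | .cnot c t => .cnot (c.map f g) (t.map f g)
  | .toffoli c d t => .toffoli (c.map f g) (d.map f g) (t.map f g)
  | .hadamard t => .hadamard (t.map f g)
  | .phase t => .phase (t.map f g)
  | .queryH a b => .queryH (f a) (f b)
  | .queryG a b => .queryG (f a) (f b)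
  | .callA i => .callA (g i)

/-- The action of an operation on the memory (a gate whose target is also one of its controls is no
operation). -/
def Op.apply {m n q : ℕ} (H G : Bits m → Bits n) (A : QueryAlg q) (ψ : QState SReg) :
    Op SReg ℕ → QState SReg
  | .not t => basisMap (fun s => Function.update s t (!s t)) ψ
  | .cnot c t =>
      if c = t then ψ else basisMap (fun s => Function.update s t (xor (s t) (s c))) ψ
  | .toffoli c d t =>
      if c = t ∨ d = t then ψ
      else basisMap (fun s => Function.update s t (xor (s t) (s c && s d))) ψ
  | .hadamard t =>
      Finsupp.linearCombination ℂ (fun s : Basis SReg =>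
        Finsupp.single (Function.update s t false) ((Real.sqrt 2 : ℂ)⁻¹) +
        Finsupp.single (Function.update s t true)
          (if s t then -(Real.sqrt 2 : ℂ)⁻¹ else (Real.sqrt 2 : ℂ)⁻¹)) ψ
  | .phase t =>
      Finsupp.linearCombination ℂ (fun s : Basis SReg =>
        Finsupp.single s (if s t then Complex.exp (Real.pi / 4 * Complex.I) else 1)) ψ
  | .queryH a b => oracle H a b ψ
  | .queryG a b => oracle G a b ψ
  | .callA i => applyGates ((A.circuit i).map (Gate.lift SReg.ofAEmb)) ψ

/-- Is the operation a query to `G`? -/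
def Op.isQueryG {ρ ν : Type} : Op ρ ν → Bool
  | .queryG _ _ => true
  | _ => false

/-- The running time of the black-box call made by an operation, if it is one. -/
def Op.callTime {q : ℕ} (A : QueryAlg q) : Op SReg ℕ → ℕ
  | .callA i => (A.circuit i).length
  | _ => 0

/-- The contents of the classical variables. -/
abbrev Env : Type := ℕ → ℕ

/-- Classical expressions. -/
inductive Expr where
  | const (c : ℕ)
  | var (v : ℕ)
  | add (a b : Expr)
  | sub (a b : Expr)

/-- The value of an expression (subtraction is truncated at zero). -/
def Expr.eval (env : Env) : Expr → ℕ
  | .const c => c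
  | .var v => env v
  | .add a b => a.eval env + b.eval env
  | .sub a b => a.eval env - b.eval env

/-- Expressions for the registers that a program can address. -/
inductive RegExpr where
  | qin
  | qout
  | out (i : Expr)
  | aux
  | own (a i : Expr)

/-- The register denoted by an expression. -/
def RegExpr.eval (env : Env) : RegExpr → SReg
  | .qin => .ofA .qin
  | .qout => .ofA .qout
  | .out i => .ofA (.out (i.eval env))
  | .aux => .ofA .aux
  | .own a i => .own (a.eval env) (i.eval env)

/-- Programs. `rand v e` puts into the variable `v` a uniformly random element of `{0, …, e}`;
`loop v e p` runs `p` with `v = 0, …, e - 1`; `ite a b p p'` runs `p` if `a ≤ b` and `p'`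
otherwise; `issue o` issues a quantum operation. -/
inductive Prog where
  | skip
  | seq (p p' : Prog)
  | assign (v : ℕ) (e : Expr)
  | rand (v : ℕ) (e : Expr)
  | loop (v : ℕ) (e : Expr) (p : Prog)
  | ite (a b : Expr) (p p' : Prog)
  | issue (o : Op RegExpr Expr)

/-- The status of the controller: its variables, the operations issued so far (in the order in
which they are applied), and the number of steps made so far. -/
structure Ctrl where
  env : Env
  ops : List (Op SReg ℕ)
  steps : ℕ

/-- `c` further steps. -/
def Ctrl.tick (c : ℕ) (σ : Ctrl) : Ctrl := { σ with steps := σ.steps + c }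

/-- Assignment to a variable. -/
def Ctrl.set (v a : ℕ) (σ : Ctrl) : Ctrl := { σ with env := Function.update σ.env v a }

/-- `loopExec body v N` runs `body` for `v = 0, …, N - 1`, one step being charged per round. -/
def loopExec (body : Ctrl → PMF Ctrl) (v : ℕ) : ℕ → Ctrl → PMF Ctrl
  | 0, σ => PMF.pure σ
  | N + 1, σ => (loopExec body v N σ).bind fun τ => body ((τ.set v N).tick 1)

/-- The execution of a program. Every instruction costs one step; drawing a random number costs in
addition the number of binary digits of the bound. -/
def Prog.exec : Prog → Ctrl → PMF Ctrl
  | .skip, σ => PMF.pure σ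
  | .seq p p', σ => (p.exec σ).bind p'.exec
  | .assign v e, σ => PMF.pure ((σ.set v (e.eval σ.env)).tick 1)
  | .rand v e, σ =>
      (PMF.uniformOfFintype (Fin (e.eval σ.env + 1))).bind fun a =>
        PMF.pure ((σ.set v a).tick (1 + Nat.size (e.eval σ.env)))
  | .loop v e p, σ => loopExec p.exec v (e.eval σ.env) (σ.tick 1)
  | .ite a b p p', σ =>
      if a.eval σ.env ≤ b.eval σ.env then p.exec (σ.tick 1) else p'.exec (σ.tick 1)
  | .issue o, σ =>
      PMF.pure { env := σ.env
                 ops := σ.ops ++ [o.map (RegExpr.eval σ.env) (Expr.eval σ.env)]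
                 steps := σ.steps + 1 }

/-- The distribution of the final status of the controller on input `(n, m, k, q)`, which is put
into the variables `0, 1, 2, 3`; all other variables are zero. -/
def Prog.run (S : Prog) (n m k q : ℕ) : PMF Ctrl :=
  S.exec
    { env := fun v => match v with
        | 0 => n
        | 1 => m
        | 2 => k
        | 3 => q
        | _ => 0
      ops := []
      steps := 0 }

/-- The number of queries to `G` made in a run. -/
def Ctrl.numQueriesG (σ : Ctrl) : ℕ := σ.ops.countP Op.isQueryG

/-- The running time of a run: the steps of the controller (every gate and every query is one of
them), plus the running times of the black-box calls. -/
def Ctrl.time {q : ℕ} (A : QueryAlg q) (σ : Ctrl) : ℕ :=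
  σ.steps + (σ.ops.map (Op.callTime A)).sum

/-- The final quantum state of a run, started from the all-zero memory. -/
def Ctrl.finalState {m n q : ℕ} (H G : Bits m → Bits n) (A : QueryAlg q) (σ : Ctrl) :
    QState SReg :=
  σ.ops.foldl (Op.apply H G A) (initState SReg)

/-- The probability, over the random numbers and the final measurement, that the black-box
algorithm outputs `(x, y, z)` such that `P x y z`. It outputs `x` and `z` in the output registers
of `A`, and the entry `y i` in its own register `(0, i)`. -/
def Prog.outputProb {m n q : ℕ} (S : Prog) (H G : Bits m → Bits n) (A : QueryAlg q) (k l : ℕ)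
    (P : (Fin k → Bits m) → (Fin k → Bits n) → Bits l → Prop) : ℝ≥0∞ :=
  ∑' σ : Ctrl, S.run n m k q σ *
    measProb (σ.finalState H G A) fun s =>
      P (fun i => readReg m (SReg.ofA (AReg.out i)) s) (fun i => readReg n (SReg.own 0 i) s)
        (readReg l (SReg.ofA AReg.aux) s)

end QOracle

end

open QOracle

/-!
Write `T` for the set of the points `xo i`, and `H'` for `H` reprogrammed to `G` on `T`.

The simulator runs the query algorithm and keeps a record of at most `k` points, sorted and
together with the masks `G x ⊕ H x`. It answers every query with `H` reprogrammed to `G` on the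
recorded points. There are `q + k` positions at which a point can be recorded: the inputs of the
`q` queries, and the `k` entries of the output list at the end. The simulator chooses `k` of these
positions uniformly at random, and for each of them a random bit, which decides whether the point
is recorded before or after the query is answered. (For an output entry no bit is needed.) Every
choice has at least the probability `1 / (2 ^ k * (q + k).choose k)`, and every recorded point
costs one query to `G`. Recording is done coherently, without a measurement, and since the record
is sorted, its contents are a function of the multiset of recorded points. The order in which they
were recorded leaves no trace, and contributions that differ in this order add up.

For a fixed choice, consider the part of the superposition with the record `T`. The projection of
the final state of the algorithm with oracle `H'` to success is a sum of these parts, with signs,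
over all choices. Indeed, a query to `H'` is a query answered according to a record `M ⊆ T`, plus a
correction in case the input is a point of `T` that is missing in `M`: the answer for the record
with this point minus the answer for the record without it (`contrib_query`). And every point of
`T` that is still missing at the end is exactly one of the output entries, which are a permutation
of the `xo i` (`contribOut_step`). By the Cauchy–Schwarz inequality, the squared norm of the sum is
at most the number of choices times the sum of the squared norms of its terms, so that the average
of these squared norms, which bounds the success probability of the simulator from below, is at
least the squared norm of the sum divided by the square of the number of choices.

This is carried out one position at a time. The linear map `contrib T B c` sends a superposition of
records lacking `c` points to its contribution to the final state, where `B` is the rest of the run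
with oracle `H'`; `contribOut` does the same in the output phase. The quantity `lowerBound`, the
squared norm of the contribution divided by the square of the number of remaining choices, does not
exceed the expectation of its value after the next position (`lowerBound_simQuery`,
`lowerBound_simOutput`, with the inequality `weight_split`). At the beginning it is the claimed
bound, and at the end it is at most the success probability (`lowerBound_output`).

Most of the work in the memory of the simulator is reversible classical computation, for which
`Prog.Maps` states the effect of a program on the basis states; the record is then abstracted to a
multiset, `enc` being the encoding of multisets in the memory.
-/

namespace QOracle

noncomputable section

/-! ### The simulator -/

/-- The register holding the `j`-th recorded point. -/
abbrev RegExpr.slot (j : Expr) : RegExpr := .own (.const 1) j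

/-- The register holding the mask `G x ⊕ H x` of the `j`-th recorded point `x`. -/
abbrev RegExpr.mask (j : Expr) : RegExpr := .own (.const 2) j

/-- The register for the intermediate results of a comparison. -/
abbrev RegExpr.flags : RegExpr := .own (.const 3) (.const 0)

/-- The qubit for the result of a comparison. -/
abbrev flagQubit : RegExpr × Expr := (.own (.const 4) (.const 0), .const 0)

/-- XOR the first `e` bits of register `a` into register `b`. -/
def copyReg (a b : RegExpr) (e : Expr) : Prog :=
  .loop 9 e (.issue (.cnot (a, .var 9) (b, .var 9)))

/-- XOR the first `e` bits of register `a` into register `b`, controlled by the qubit `t`. -/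
def ctrlCopyReg (t : RegExpr × Expr) (a b : RegExpr) (e : Expr) : Prog :=
  .loop 9 e (.issue (.toffoli t (a, .var 9) (b, .var 9)))

/-- Exchange the first `e` bits of the registers `a` and `b`, controlled by the qubit `t`. -/
def ctrlSwapReg (t : RegExpr × Expr) (a b : RegExpr) (e : Expr) : Prog :=
  .seq (copyReg b a e) (.seq (ctrlCopyReg t a b e) (copyReg b a e))

/-- One digit of a comparison: XOR into flag `i + 1` the majority of flag `i`, of bit `i` of `a`,
and of the negation of bit `i` of `b`. The other qubits are restored. -/
def compareDigit (a b : RegExpr) (i : Expr) : Prog :=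
  .seq (.issue (.cnot (a, i) (b, i))) <|
  .seq (.issue (.cnot (a, i) (.flags, i))) <|
  .seq (.issue (.toffoli (b, i) (.flags, i) (.flags, .add i (.const 1)))) <|
  .seq (.issue (.cnot (a, i) (.flags, i))) <|
  .seq (.issue (.cnot (a, i) (b, i))) <|
  .issue (.cnot (.flags, i) (.flags, .add i (.const 1)))

/-- Flip the qubit `t` if the number (of `m` binary digits) in register `a` exceeds the one in
register `b`. The second loop takes the digits in descending order and clears the flags. -/
def compareReg (a b : RegExpr) (t : RegExpr × Expr) : Prog :=
  .seq (.loop 9 (.var 1) (compareDigit a b (.var 9))) <|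
  .seq (.issue (.cnot (.flags, .var 1) t)) <|
  .loop 9 (.var 1) (compareDigit a b (.sub (.sub (.var 1) (.const 1)) (.var 9)))

/-- Flip the flag qubit if the registers `a` and `b` agree, that is, unless one of the two numbers
exceeds the other. -/
def equalReg (a b : RegExpr) : Prog :=
  .seq (.issue (.not flagQubit)) <|
  .seq (compareReg a b flagQubit) (compareReg b a flagQubit)

/-- A query to `H`, reprogrammed to `G` at the recorded points: the answer of `H` is corrected by
the mask of every recorded point that agrees with the input. The entries that are not in use have
the mask zero, so that the loop can run over all `k` entries. -/
def reprogQuery (rin rout : RegExpr) : Prog :=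
  .seq (.issue (.queryH rin rout)) <|
  .loop 8 (.var 2) <|
    .seq (equalReg rin (.slot (.var 8))) <|
    .seq (ctrlCopyReg flagQubit (.mask (.var 8)) rout (.var 0)) <|
    equalReg rin (.slot (.var 8))

/-- One exchange of an insertion sort: exchange the entries `j` and `j + 1` of the record if the
entry `j` exceeds the content of register `r`. The entry `j + 1` then exceeds this content if and
only if the exchange was made, so the second comparison clears the flag. -/
def bubbleStep (r : RegExpr) (j : Expr) : Prog :=
  .seq (compareReg (.slot j) r flagQubit) <|
  .seq (ctrlSwapReg flagQubit (.slot j) (.slot (.add j (.const 1))) (.var 1)) <|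
  .seq (ctrlSwapReg flagQubit (.mask j) (.mask (.add j (.const 1))) (.var 0)) <|
  compareReg (.slot (.add j (.const 1))) r flagQubit

/-- Move the last entry of the record to its place in the order (the variable `6` is the number of
the other entries). The number of rounds is written as the minimum of the variables `2` and `6`, so
that it is visibly bounded by the input. -/
def bubbleSort (r : RegExpr) : Prog :=
  .loop 8 (.sub (.var 2) (.sub (.var 2) (.var 6)))
    (bubbleStep r (.sub (.sub (.var 6) (.const 1)) (.var 8)))

/-- Insert the content of register `r` into the sorted record, with one query to `G` (and one to
`H`) for the mask. -/
def insertPoint (r : RegExpr) : Prog :=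
  .seq (copyReg r (.slot (.var 6)) (.var 1)) <|
  .seq (.issue (.queryG (.slot (.var 6)) (.mask (.var 6)))) <|
  .seq (.issue (.queryH (.slot (.var 6)) (.mask (.var 6)))) <|
  bubbleSort r

/-- Count one more recorded point. -/
def countPoint : Prog := .assign 6 (.add (.var 6) (.const 1))

/-- The circuit `i` (variable `4`) of the simulated algorithm and the query that follows it. Its
input is recorded with probability `c / (q + k - i)`, where `c` is the number of points still to be
recorded and `q + k - i` is the number of remaining positions. Overall, this chooses a uniformly
random set of `k` positions. A random bit decides whether the point is recorded before or after the
query. -/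
def simQuery : Prog :=
  .seq (.issue (.callA (.var 4))) <|
  .seq (.rand 5 (.sub (.sub (.add (.var 3) (.var 2)) (.const 1)) (.var 4))) <|
  .ite (.add (.var 5) (.const 1)) (.sub (.var 2) (.var 6))
    (.seq (.rand 7 (.const 1)) <|
      .ite (.const 1) (.var 7)
        (.seq (insertPoint .qin) (.seq countPoint (reprogQuery .qin .qout)))
        (.seq (reprogQuery .qin .qout) (.seq (insertPoint .qin) countPoint)))
    (reprogQuery .qin .qout)

/-- One entry of the output list of the simulated algorithm, which is recorded or not, with the same
rule for the random choice. -/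
def simOutput : Prog :=
  .seq (.rand 5 (.sub (.sub (.var 2) (.const 1)) (.var 4))) <|
  .ite (.add (.var 5) (.const 1)) (.sub (.var 2) (.var 6))
    (.seq (insertPoint (.out (.var 4))) countPoint)
    .skip

/-- The simulator: run the algorithm with some of its queries recorded, record some entries of its
output list, and answer these entries according to the record. Variable `4` counts the positions,
`5` and `7` hold the random numbers, `6` is the number of recorded points, and `8` and `9` are the
counters of the inner loops. -/
def simulator : Prog :=
  .seq (.loop 4 (.var 3) simQuery) <|
  .seq (.issue (.callA (.var 3))) <|
  .seq (.loop 4 (.var 2) simOutput) <|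
  .loop 4 (.var 2) (reprogQuery (.out (.var 4)) (.own (.const 0) (.var 4)))

/-! ### Running time and frame conditions -/

/-- All variables that are written have index at least `b`. -/
def Prog.Frame (b : ℕ) : Prog → Prop
  | .skip => True
  | .seq p p' => p.Frame b ∧ p'.Frame b
  | .assign v _ => b ≤ v
  | .rand v _ => b ≤ v
  | .loop v _ p => b ≤ v ∧ p.Frame b
  | .ite _ _ p p' => p.Frame b ∧ p'.Frame b
  | .issue _ => True

/-- The program contains no query to `G`. -/
def Prog.NoG : Prog → Prop
  | .seq p p' => p.NoG ∧ p'.NoG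
  | .loop _ _ p => p.NoG
  | .ite _ _ p p' => p.NoG ∧ p'.NoG
  | .issue o => o.isQueryG = false
  | _ => True

/-- The number of rounds of every loop and the bound of every random number are at most `B`,
provided that the variables `0, 1, 2, 3` have their values in `env₀`. -/
def Prog.Bounded (env₀ : Env) (B : ℕ) : Prog → Prop
  | .skip => True
  | .seq p p' => p.Bounded env₀ B ∧ p'.Bounded env₀ B
  | .assign _ _ => True
  | .rand _ e => ∀ env : Env, (∀ v < 4, env v = env₀ v) → e.eval env ≤ B
  | .loop _ e p => (∀ env : Env, (∀ v < 4, env v = env₀ v) → e.eval env ≤ B) ∧ p.Bounded env₀ B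
  | .ite _ _ p p' => p.Bounded env₀ B ∧ p'.Bounded env₀ B
  | .issue _ => True

/-- A bound for the number of steps, as a polynomial in a common bound for the numbers of rounds of
all loops. -/
def Prog.cost : Prog → Polynomial ℕ
  | .skip => 0
  | .seq p p' => p.cost + p'.cost
  | .assign _ _ => 1
  | .rand _ _ => 1 + Polynomial.X
  | .loop _ _ p => 1 + Polynomial.X * (1 + p.cost)
  | .ite _ _ p p' => 1 + p.cost + p'.cost
  | .issue _ => 1

theorem loopExec_induction {body : Ctrl → PMF Ctrl} {v : ℕ} (Q : ℕ → Ctrl → Prop) {N : ℕ}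
    {σ : Ctrl}
    (h0 : Q 0 σ)
    (hstep : ∀ i < N, ∀ τ, Q i τ → ∀ τ' ∈ (body ((τ.set v i).tick 1)).support, Q (i + 1) τ') :
    ∀ τ ∈ (loopExec body v N σ).support, Q N τ := by
  induction N with
  | zero =>
    intro τ hτ
    simp only [loopExec, PMF.support_pure, Set.mem_singleton_iff] at hτ
    exact hτ ▸ h0
  | succ N ih =>
    intro τ' hτ'
    simp only [loopExec, PMF.mem_support_bind_iff] at hτ'
    obtain ⟨τ, hτ, hτ'⟩ := hτ'
    exact hstep N (by omega) τ (ih (fun i hi => hstep i (by omega)) τ hτ) τ' hτ'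

theorem mem_support_rand {v : ℕ} {e : Expr} {σ τ : Ctrl}
    (h : τ ∈ ((Prog.rand v e).exec σ).support) :
    ∃ a ≤ e.eval σ.env, τ = (σ.set v a).tick (1 + Nat.size (e.eval σ.env)) := by
  simp only [Prog.exec, PMF.mem_support_bind_iff, PMF.support_pure, Set.mem_singleton_iff] at h
  obtain ⟨a, -, rfl⟩ := h
  exact ⟨a, Nat.le_of_lt_succ a.2, rfl⟩

theorem Prog.Frame.env_eq {b : ℕ} : ∀ {p : Prog}, p.Frame b → ∀ {σ τ : Ctrl},
    τ ∈ (p.exec σ).support → ∀ v < b, τ.env v = σ.env v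
  | .skip, _, σ, τ, hτ, v, hv => by
    simp only [Prog.exec, PMF.support_pure, Set.mem_singleton_iff] at hτ
    rw [hτ]
  | .seq p p', h, σ, τ, hτ, v, hv => by
    simp only [Prog.exec, PMF.mem_support_bind_iff] at hτ
    obtain ⟨τ₁, h1, h2⟩ := hτ
    rw [h.2.env_eq h2 v hv, h.1.env_eq h1 v hv]
  | .assign u e, h, σ, τ, hτ, v, hv => by
    simp only [Prog.exec, PMF.support_pure, Set.mem_singleton_iff] at hτ
    have : b ≤ u := h
    rw [hτ]
    exact Function.update_of_ne (by omega) _ _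
  | .rand u e, h, σ, τ, hτ, v, hv => by
    obtain ⟨a, -, rfl⟩ := mem_support_rand hτ
    have : b ≤ u := h
    exact Function.update_of_ne (by omega) _ _
  | .loop u e p, h, σ, τ, hτ, v, hv => by
    simp only [Prog.exec] at hτ
    refine loopExec_induction (σ := σ.tick 1) (fun _ τ => τ.env v = σ.env v) rfl ?_ τ hτ
    intro i _ τ hτ τ' hτ'
    have : b ≤ u := h.1
    rw [h.2.env_eq hτ' v hv, ← hτ]
    exact Function.update_of_ne (by omega) _ _
  | .ite a c p p', h, σ, τ, hτ, v, hv => by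
    simp only [Prog.exec] at hτ
    split_ifs at hτ
    · exact h.1.env_eq hτ v hv
    · exact h.2.env_eq hτ v hv
  | .issue o, _, σ, τ, hτ, v, hv => by
    simp only [Prog.exec, PMF.support_pure, Set.mem_singleton_iff] at hτ
    rw [hτ]

theorem Prog.NoG.numQueriesG_eq : ∀ {p : Prog}, p.NoG → ∀ {σ τ : Ctrl},
    τ ∈ (p.exec σ).support → τ.numQueriesG = σ.numQueriesG
  | .skip, _, σ, τ, hτ => by
    simp only [Prog.exec, PMF.support_pure, Set.mem_singleton_iff] at hτ
    rw [hτ]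
  | .seq p p', h, σ, τ, hτ => by
    simp only [Prog.exec, PMF.mem_support_bind_iff] at hτ
    obtain ⟨τ₁, h1, h2⟩ := hτ
    rw [h.2.numQueriesG_eq h2, h.1.numQueriesG_eq h1]
  | .assign u e, h, σ, τ, hτ => by
    simp only [Prog.exec, PMF.support_pure, Set.mem_singleton_iff] at hτ
    rw [hτ]; rfl
  | .rand u e, h, σ, τ, hτ => by
    obtain ⟨a, -, rfl⟩ := mem_support_rand hτ
    rfl
  | .loop u e p, h, σ, τ, hτ => by
    simp only [Prog.exec] at hτ
    refine loopExec_induction (σ := σ.tick 1) (fun _ τ => τ.numQueriesG = σ.numQueriesG) rfl ?_ τ hτ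
    intro i _ τ hτ τ' hτ'
    have hp : p.NoG := h
    rw [hp.numQueriesG_eq hτ', ← hτ]; rfl
  | .ite a c p p', h, σ, τ, hτ => by
    simp only [Prog.exec] at hτ
    split_ifs at hτ
    · exact h.1.numQueriesG_eq (σ := σ.tick 1) hτ
    · exact h.2.numQueriesG_eq (σ := σ.tick 1) hτ
  | .issue o, h, σ, τ, hτ => by
    simp only [Prog.exec, PMF.support_pure, Set.mem_singleton_iff] at hτ
    have : (o.map (RegExpr.eval σ.env) (Expr.eval σ.env)).isQueryG = false := by
      rw [← (show o.isQueryG = false from h)]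
      cases o <;> rfl
    simp [hτ, Ctrl.numQueriesG, this]

/-- The bounds of a program carry over to the number of its steps, each of which issues at most one
operation. -/
theorem Prog.Bounded.steps_le {env₀ : Env} {B : ℕ} : ∀ {p : Prog}, p.Bounded env₀ B → p.Frame 4 →
    ∀ {σ τ : Ctrl}, (∀ v < 4, σ.env v = env₀ v) → τ ∈ (p.exec σ).support →
      τ.steps ≤ σ.steps + p.cost.eval B ∧ τ.ops.length + σ.steps ≤ σ.ops.length + τ.steps
  | .skip, _, _, σ, τ, _, hτ => by
    simp only [Prog.exec, PMF.support_pure, Set.mem_singleton_iff] at hτ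
    simp [hτ]
  | .seq p p', h, hf, σ, τ, hσ, hτ => by
    simp only [Prog.exec, PMF.mem_support_bind_iff] at hτ
    obtain ⟨τ₁, h1, h2⟩ := hτ
    have e1 := h.1.steps_le hf.1 hσ h1
    have e2 := h.2.steps_le hf.2 (fun v hv => (hf.1.env_eq h1 v hv).trans (hσ v hv)) h2
    simp only [Prog.cost, Polynomial.eval_add]
    omega
  | .assign u e, h, _, σ, τ, _, hτ => by
    simp only [Prog.exec, PMF.support_pure, Set.mem_singleton_iff] at hτ
    simp [hτ, Prog.cost, Ctrl.set, Ctrl.tick]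
  | .rand u e, h, _, σ, τ, hσ, hτ => by
    obtain ⟨a, -, rfl⟩ := mem_support_rand hτ
    have h1 : e.eval σ.env ≤ B := h _ hσ
    have h2 : Nat.size (e.eval σ.env) ≤ e.eval σ.env := Nat.size_le.2 Nat.lt_two_pow_self
    simp only [Ctrl.set, Ctrl.tick, Prog.cost, Polynomial.eval_add, Polynomial.eval_one,
      Polynomial.eval_X]
    omega
  | .loop u e p, h, hf, σ, τ, hσ, hτ => by
    simp only [Prog.exec] at hτ
    have key := loopExec_induction (σ := σ.tick 1) (fun i τ => (∀ v < 4, τ.env v = env₀ v) ∧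
      τ.steps ≤ σ.steps + 1 + i * (1 + p.cost.eval B) ∧
      τ.ops.length + σ.steps ≤ σ.ops.length + τ.steps)
      ⟨hσ, by simp [Ctrl.tick], by simp only [Ctrl.tick]; omega⟩ ?_ τ hτ
    · have h1 : e.eval σ.env * (1 + p.cost.eval B) ≤ B * (1 + p.cost.eval B) :=
        Nat.mul_le_mul_right _ (h.1 _ hσ)
      simp only [Prog.cost, Polynomial.eval_add, Polynomial.eval_one, Polynomial.eval_X,
        Polynomial.eval_mul]
      omega
    · rintro i - τ ⟨h1, h2, h3⟩ τ' hτ'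
      have hu : 4 ≤ u := hf.1
      have h0 : ∀ v < 4, ((τ.set u i).tick 1).env v = env₀ v := fun v hv => by
        rw [← h1 v hv]; exact Function.update_of_ne (by omega) _ _
      have e1 := h.2.steps_le hf.2 h0 hτ'
      simp only [Ctrl.set, Ctrl.tick] at e1
      refine ⟨fun v hv => (hf.2.env_eq hτ' v hv).trans (h0 v hv), ?_, by omega⟩
      rw [Nat.succ_mul]
      omega
  | .ite a c p p', h, hf, σ, τ, hσ, hτ => by
    simp only [Prog.exec] at hτ
    simp only [Prog.cost, Polynomial.eval_add, Polynomial.eval_one]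
    split_ifs at hτ
    · have := h.1.steps_le hf.1 (σ := σ.tick 1) hσ hτ
      simp only [Ctrl.tick] at this
      omega
    · have := h.2.steps_le hf.2 (σ := σ.tick 1) hσ hτ
      simp only [Ctrl.tick] at this
      omega
  | .issue o, _, _, σ, τ, _, hτ => by
    simp only [Prog.exec, PMF.support_pure, Set.mem_singleton_iff] at hτ
    simp [hτ, Prog.cost]
    omega

theorem QueryAlg.length_circuit_le {q : ℕ} (A : QueryAlg q) (i : ℕ) :
    (A.circuit i).length ≤ A.time := by
  unfold QueryAlg.circuit QueryAlg.time
  split_ifs with h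
  · exact (Finset.single_le_sum (f := fun i => (A.U i).length) (fun _ _ => Nat.zero_le _)
      (Finset.mem_univ (⟨i, h⟩ : Fin (q + 1)))).trans (Nat.le_add_left _ _)
  · simp

theorem Ctrl.time_le {q : ℕ} (A : QueryAlg q) (σ : Ctrl) :
    σ.time A ≤ σ.steps + σ.ops.length * A.time := by
  refine Nat.add_le_add_left ?_ _
  have := List.sum_le_card_nsmul (σ.ops.map (Op.callTime A)) A.time (by
    intro x hx
    obtain ⟨o, -, rfl⟩ := List.mem_map.1 hx
    cases o <;> simp [Op.callTime, A.length_circuit_le])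
  simpa using this

/-- The variables of the simulator at the start of a run. -/
def inputEnv (n m k q : ℕ) : Env := fun v => match v with
  | 0 => n
  | 1 => m
  | 2 => k
  | 3 => q
  | _ => 0

theorem simulator_frame : simulator.Frame 4 := by
  simp [simulator, simQuery, simOutput, reprogQuery, equalReg, compareReg, compareDigit, countPoint,
    insertPoint, bubbleSort, bubbleStep, ctrlSwapReg, ctrlCopyReg, copyReg, Prog.Frame]

theorem simulator_bounded (n m k q : ℕ) :
    simulator.Bounded (inputEnv n m k q) (n + m + k + q + 1) := by
  have h0 : inputEnv n m k q 0 = n := rfl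
  have h1 : inputEnv n m k q 1 = m := rfl
  have h2 : inputEnv n m k q 2 = k := rfl
  have h3 : inputEnv n m k q 3 = q := rfl
  simp only [simulator, simQuery, simOutput, reprogQuery, equalReg, compareReg, compareDigit,
    countPoint, insertPoint, bubbleSort, bubbleStep, ctrlSwapReg, ctrlCopyReg, copyReg,
    Prog.Bounded, Expr.eval, and_true, true_and]
  refine ⟨⟨?_, ?_⟩, ?_⟩ <;> (repeat' constructor) <;> intro env h <;>
    (have g0 := h 0 (by omega)
     have g1 := h 1 (by omega)
     have g2 := h 2 (by omega)
     have g3 := h 3 (by omega)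
     omega)

/-- The running time is polynomial. -/
theorem simulator_time_le {n m k q : ℕ} (A : QueryAlg q) {σ : Ctrl}
    (hσ : σ ∈ (simulator.run n m k q).support) :
    σ.time A ≤ simulator.cost.eval (n + m + k + A.time + 1) * (1 + A.time) := by
  have h := (simulator_bounded n m k q).steps_le simulator_frame (fun _ _ => rfl) hσ
  simp only [zero_add, List.length_nil] at h
  have hmono : ∀ P : Polynomial ℕ, Monotone fun x => P.eval x := fun P x y hxy => by
    simp only [Polynomial.eval_eq_sum, Polynomial.sum]
    gcongr
  have hq : q ≤ A.time := Nat.le_add_right _ _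
  have h1 : σ.steps ≤ simulator.cost.eval (n + m + k + A.time + 1) :=
    h.1.trans (hmono _ (by omega))
  have h2 : σ.ops.length ≤ simulator.cost.eval (n + m + k + A.time + 1) := by omega
  refine (σ.time_le A).trans ?_
  rw [mul_add, mul_one]
  exact Nat.add_le_add h1 (Nat.mul_le_mul_right _ h2)

end

noncomputable section

/-! ### Reversible classical computations -/

/-- The action of an oracle on computational basis states. -/
def oracleFn {ρ : Type} [DecidableEq ρ] {m n : ℕ} (f : Bits m → Bits n) (rin rout : ρ)
    (s : Basis ρ) : Basis ρ :=
  if rin = rout then s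
  else fun p =>
    if h : p.1 = rout ∧ p.2 < n then xor (s p) (f (readReg m rin s) ⟨p.2, h.2⟩) else s p

theorem oracle_eq_basisMap {ρ : Type} [DecidableEq ρ] {m n : ℕ} (f : Bits m → Bits n)
    (rin rout : ρ) : oracle f rin rout = basisMap (oracleFn f rin rout) := by
  unfold oracle oracleFn
  split_ifs
  · exact (Finsupp.lmapDomain_id ℂ ℂ).symm
  · rfl

theorem basisMap_single {ρ : Type} (g : Basis ρ → Basis ρ) (s : Basis ρ) (z : ℂ) :
    basisMap g (Finsupp.single s z) = Finsupp.single (g s) z :=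
  Finsupp.mapDomain_single

/-- The operations that permute the computational basis states. -/
def Op.Classical : Op SReg ℕ → Prop
  | .hadamard _ => False
  | .phase _ => False
  | .callA _ => False
  | _ => True

variable {m n : ℕ} (H G : Bits m → Bits n)

/-- The action of a classical operation on computational basis states (the identity, as a default,
for the other operations). -/
def Op.fn : Op SReg ℕ → Basis SReg → Basis SReg
  | .not t, s => Function.update s t (!s t)
  | .cnot c t, s => if c = t then s else Function.update s t (xor (s t) (s c))
  | .toffoli c d t, s =>
      if c = t ∨ d = t then s else Function.update s t (xor (s t) (s c && s d))
  | .queryH a b, s => oracleFn H a b s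
  | .queryG a b, s => oracleFn G a b s
  | _, s => s

theorem Op.apply_eq_basisMap {q : ℕ} (A : QueryAlg q) {o : Op SReg ℕ} (ho : o.Classical)
    (ψ : QState SReg) : o.apply H G A ψ = basisMap (o.fn H G) ψ := by
  have hid : ψ = basisMap (fun s => s) ψ := by
    rw [basisMap, Finsupp.lmapDomain_apply]; exact Finsupp.mapDomain_id.symm
  cases o with
  | not t => rfl
  | cnot c t =>
    simp only [Op.apply]
    split_ifs with h
    · refine hid.trans (congrArg (basisMap · ψ) (funext fun s => ?_))
      simp only [Op.fn, h, if_true]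
    · refine congrArg (basisMap · ψ) (funext fun s => ?_)
      simp only [Op.fn, h, if_false]
  | toffoli c d t =>
    simp only [Op.apply]
    split_ifs with h
    · refine hid.trans (congrArg (basisMap · ψ) (funext fun s => ?_))
      simp only [Op.fn, h, if_true]
    · refine congrArg (basisMap · ψ) (funext fun s => ?_)
      simp only [Op.fn, h, if_false]
  | hadamard t => exact ho.elim
  | phase t => exact ho.elim
  | queryH a b => simp only [Op.apply, oracle_eq_basisMap]; rfl
  | queryG a b => simp only [Op.apply, oracle_eq_basisMap]; rfl
  | callA i => exact ho.elim

/-- The action of a list of classical operations on computational basis states. -/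
def opsFn (L : List (Op SReg ℕ)) (s : Basis SReg) : Basis SReg :=
  L.foldl (fun s o => o.fn H G s) s

theorem foldl_apply_eq_basisMap {q : ℕ} (A : QueryAlg q) (L : List (Op SReg ℕ))
    (hL : ∀ o ∈ L, o.Classical) (ψ : QState SReg) :
    L.foldl (Op.apply H G A) ψ = basisMap (opsFn H G L) ψ := by
  induction L generalizing ψ with
  | nil => exact Finsupp.mapDomain_id.symm
  | cons o L ih =>
    rw [List.foldl_cons, ih (fun o' h => hL o' (List.mem_cons_of_mem _ h)),
      Op.apply_eq_basisMap H G A (hL o List.mem_cons_self)]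
    exact (Finsupp.mapDomain_comp).symm

/-- Started with the variables `env`, the program `p` issues classical operations only, which map
the basis state `s` to `s'`, and it does not change the variables below `b`. -/
def Prog.Maps (b : ℕ) (p : Prog) (env : Env) (s s' : Basis SReg) : Prop :=
  ∀ σ : Ctrl, σ.env = env → ∀ τ ∈ (p.exec σ).support, (∀ v < b, τ.env v = env v) ∧
    ∃ L, (∀ o ∈ L, o.Classical) ∧ τ.ops = σ.ops ++ L ∧ opsFn H G L s = s'

namespace Prog.Maps

variable {H G} {b c : ℕ} {p p' : Prog} {env : Env} {s s' s'' : Basis SReg}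

theorem mono (h : p.Maps H G c env s s') (hbc : b ≤ c) : p.Maps H G b env s s' :=
  fun σ hσ τ hτ => ⟨fun v hv => (h σ hσ τ hτ).1 v (by omega), (h σ hσ τ hτ).2⟩

theorem seq (h : p.Maps H G b env s s')
    (h' : ∀ env' : Env, (∀ v < b, env' v = env v) → p'.Maps H G b env' s' s'') :
    (Prog.seq p p').Maps H G b env s s'' := by
  intro σ hσ τ hτ
  simp only [Prog.exec, PMF.mem_support_bind_iff] at hτ
  obtain ⟨τ₁, h1, h2⟩ := hτ
  obtain ⟨e1, L1, c1, o1, r1⟩ := h σ hσ τ₁ h1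
  obtain ⟨e2, L2, c2, o2, r2⟩ := h' τ₁.env e1 τ₁ rfl τ h2
  refine ⟨fun v hv => (e2 v hv).trans (e1 v hv), L1 ++ L2, ?_, ?_, ?_⟩
  · intro o ho
    exact (List.mem_append.1 ho).elim (c1 o) (c2 o)
  · rw [o2, o1, List.append_assoc]
  · rw [← r2, ← r1, opsFn, List.foldl_append]; rfl

theorem issue {o : Op RegExpr Expr} {o' : Op SReg ℕ}
    (h : o.map (RegExpr.eval env) (Expr.eval env) = o') (ho : o'.Classical)
    (hs : o'.fn H G s = s') : (Prog.issue o).Maps H G b env s s' := by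
  rintro σ rfl τ hτ
  simp only [Prog.exec, PMF.support_pure, Set.mem_singleton_iff] at hτ
  rw [hτ]
  refine ⟨fun _ _ => rfl, [o'], ?_, by rw [h], hs⟩
  simpa using ho

theorem issue_seq {o : Op RegExpr Expr} {o' : Op SReg ℕ}
    (h : o.map (RegExpr.eval env) (Expr.eval env) = o') (ho : o'.Classical)
    (hs : p.Maps H G b env (o'.fn H G s) s') :
    (Prog.seq (Prog.issue o) p).Maps H G b env s s' := by
  rintro σ rfl τ hτ
  simp only [Prog.exec, PMF.pure_bind] at hτ
  obtain ⟨e, L, c, o1, r⟩ :=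
    hs ⟨σ.env, σ.ops ++ [o.map (RegExpr.eval σ.env) (Expr.eval σ.env)], σ.steps + 1⟩ rfl τ hτ
  refine ⟨e, o' :: L, ?_, ?_, ?_⟩
  · simpa using ⟨ho, c⟩
  · rw [o1, h, List.append_assoc]; rfl
  · rw [← r]; rfl

theorem loop {v N : ℕ} {e : Expr} (hv : b ≤ v) (S : ℕ → Basis SReg) (he : e.eval env = N)
    (h0 : s = S 0) (hN : S N = s')
    (hstep : ∀ i < N, ∀ env' : Env, (∀ u < b, env' u = env u) → env' v = i →
      p.Maps H G b env' (S i) (S (i + 1))) :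
    (Prog.loop v e p).Maps H G b env s s' := by
  rintro σ rfl τ hτ
  simp only [Prog.exec, he] at hτ
  have key := loopExec_induction (σ := σ.tick 1) (fun i τ => (∀ u < b, τ.env u = σ.env u) ∧
    ∃ L, (∀ o ∈ L, o.Classical) ∧ τ.ops = σ.ops ++ L ∧ opsFn H G L s = S i)
    ⟨fun _ _ => rfl, [], by simp, by simp [Ctrl.tick], h0⟩ ?_ τ hτ
  · rwa [hN] at key
  · rintro i hi τ ⟨e1, L1, c1, o1, r1⟩ τ' hτ'
    have e0 : ∀ u < b, ((τ.set v i).tick 1).env u = σ.env u := fun u hu => by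
      rw [← e1 u hu]; exact Function.update_of_ne (by omega) _ _
    obtain ⟨e2, L2, c2, o2, r2⟩ := hstep i hi _ e0 (Function.update_self ..) _ rfl τ' hτ'
    refine ⟨fun u hu => (e2 u hu).trans (e0 u hu), L1 ++ L2, ?_, ?_, ?_⟩
    · intro o ho
      exact (List.mem_append.1 ho).elim (c1 o) (c2 o)
    · rw [o2, ← List.append_assoc, ← o1]; rfl
    · rw [← r2, ← r1, opsFn, List.foldl_append]; rfl

end Prog.Maps

/-- On a superposition, a program acts through its action on the basis states. The operations issued
in a run do not depend on the quantum memory, so those found for one basis state (here `S` has to be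
non-empty) serve for all of them. -/
theorem finalState_of_maps {q b : ℕ} {A : QueryAlg q} {ι : Type*} {p : Prog} {σ τ : Ctrl}
    {enc enc' : ι → Basis SReg} {Ψ : ι →₀ ℂ} {S : Set ι} (hS : S.Nonempty)
    (hΨ : ∀ a ∈ Ψ.support, a ∈ S)
    (h : ∀ a ∈ S, p.Maps H G b σ.env (enc a) (enc' a)) (hτ : τ ∈ (p.exec σ).support)
    (hσ : σ.finalState H G A = Finsupp.mapDomain enc Ψ) :
    τ.finalState H G A = Finsupp.mapDomain enc' Ψ := by
  obtain ⟨a₀, ha₀⟩ := hS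
  obtain ⟨-, L, hL, hops, -⟩ := h a₀ ha₀ σ rfl τ hτ
  unfold Ctrl.finalState at hσ ⊢
  rw [hops, List.foldl_append, hσ, foldl_apply_eq_basisMap H G A L hL]
  refine (Finsupp.mapDomain_comp).symm.trans (Finsupp.mapDomain_congr ?_)
  intro a ha
  obtain ⟨-, L', -, hops', hr⟩ := h a (hΨ a ha) σ rfl τ hτ
  rw [hops, List.append_cancel_left_eq] at hops'
  rw [← hr, ← hops']; rfl

/-! ### Elementary gadgets -/

/-- XOR of the first `N` values of `f` into the register `C`. -/
def xorReg (s : Basis SReg) (C : SReg) (N : ℕ) (f : ℕ → Bool) : Basis SReg :=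
  fun p => if p.1 = C ∧ p.2 < N then xor (s p) (f p.2) else s p

theorem xorReg_succ (s : Basis SReg) (C : SReg) (i : ℕ) (f : ℕ → Bool) :
    Function.update (xorReg s C i f) (C, i) (xor (xorReg s C i f (C, i)) (f i)) =
      xorReg s C (i + 1) f := by
  funext ⟨r, j⟩
  by_cases hr : r = C
  · by_cases hj : j = i
    · subst hr hj; simp [xorReg]
    · have : j < i + 1 ↔ j < i := by omega
      simp [xorReg, hr, hj, this]
  · simp [xorReg, hr]

theorem xorReg_zero (s : Basis SReg) (C : SReg) (f : ℕ → Bool) : xorReg s C 0 f = s := by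
  funext p; simp [xorReg]

section Gadgets

variable {H G} {env : Env} {s : Basis SReg}

theorem maps_copyReg {a c : RegExpr} {e : Expr} {A C : SReg} {N : ℕ}
    (ha : ∀ env' : Env, (∀ v < 9, env' v = env v) → a.eval env' = A)
    (hc : ∀ env' : Env, (∀ v < 9, env' v = env v) → c.eval env' = C)
    (he : e.eval env = N) (hAC : A ≠ C) :
    (copyReg a c e).Maps H G 9 env s (xorReg s C N fun j => s (A, j)) := by
  refine Prog.Maps.loop le_rfl (fun i => xorReg s C i fun j => s (A, j)) he
    (xorReg_zero ..).symm rfl ?_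
  intro i _ env' hag hv
  refine Prog.Maps.issue (o' := .cnot (A, i) (C, i)) ?_ trivial ?_
  · simp [Op.map, ha env' hag, hc env' hag, Expr.eval, hv]
  · simp only [Op.fn, Prod.mk.injEq, hAC, false_and, if_false]
    rw [← xorReg_succ]
    simp [xorReg, hAC]

theorem maps_ctrlCopyReg {t : RegExpr × Expr} {a c : RegExpr} {e : Expr} {T : SReg × ℕ}
    {A C : SReg} {N : ℕ}
    (ht : ∀ env' : Env, (∀ v < 9, env' v = env v) →
      t.map (RegExpr.eval env') (Expr.eval env') = T)
    (ha : ∀ env' : Env, (∀ v < 9, env' v = env v) → a.eval env' = A)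
    (hc : ∀ env' : Env, (∀ v < 9, env' v = env v) → c.eval env' = C)
    (he : e.eval env = N) (hAC : A ≠ C) (hTC : T.1 ≠ C) :
    (ctrlCopyReg t a c e).Maps H G 9 env s (xorReg s C N fun j => s T && s (A, j)) := by
  refine Prog.Maps.loop le_rfl (fun i => xorReg s C i fun j => s T && s (A, j)) he
    (xorReg_zero ..).symm rfl ?_
  intro i _ env' hag hv
  refine Prog.Maps.issue (o' := .toffoli T (A, i) (C, i)) ?_ trivial ?_
  · simp [Op.map, ht env' hag, ha env' hag, hc env' hag, Expr.eval, hv]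
  · have hT : T ≠ (C, i) := fun h => hTC (by rw [h])
    simp only [Op.fn, Prod.mk.injEq, hAC, hT, false_and, or_self, if_false]
    rw [← xorReg_succ]
    simp [xorReg, hAC, hTC]

/-- Exchange of the first `N` bits of two registers. -/
def swapReg (s : Basis SReg) (A C : SReg) (N : ℕ) : Basis SReg :=
  fun p => if p.1 = A ∧ p.2 < N then s (C, p.2) else if p.1 = C ∧ p.2 < N then s (A, p.2) else s p

/-- An exchange as three XORs, of which only the middle one needs a control. -/
theorem maps_ctrlSwapReg {t : RegExpr × Expr} {a c : RegExpr} {e : Expr} {T : SReg × ℕ}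
    {A C : SReg} {N : ℕ}
    (ht : ∀ env' : Env, (∀ v < 9, env' v = env v) →
      t.map (RegExpr.eval env') (Expr.eval env') = T)
    (ha : ∀ env' : Env, (∀ v < 9, env' v = env v) → a.eval env' = A)
    (hc : ∀ env' : Env, (∀ v < 9, env' v = env v) → c.eval env' = C)
    (he : ∀ env' : Env, (∀ v < 9, env' v = env v) → e.eval env' = N)
    (hAC : A ≠ C) (hTA : T.1 ≠ A) (hTC : T.1 ≠ C) :
    (ctrlSwapReg t a c e).Maps H G 9 env s (if s T then swapReg s A C N else s) := by
  have tr : ∀ {env' : Env}, (∀ v < 9, env' v = env v) → ∀ {env'' : Env},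
      (∀ v < 9, env'' v = env' v) → ∀ v < 9, env'' v = env v :=
    fun h1 _ h2 v hv => (h2 v hv).trans (h1 v hv)
  refine Prog.Maps.seq (maps_copyReg hc ha (he env fun _ _ => rfl) hAC.symm) fun env' h' => ?_
  refine Prog.Maps.seq (maps_ctrlCopyReg (fun _ h => ht _ (tr h' h)) (fun _ h => ha _ (tr h' h))
    (fun _ h => hc _ (tr h' h)) (he _ h') hAC hTC) fun env'' h'' => ?_
  have := maps_copyReg (H := H) (G := G) (env := env'')
    (s := xorReg (xorReg s A N fun j => s (C, j)) C N
      (fun j => xorReg s A N (fun j => s (C, j)) T && xorReg s A N (fun j => s (C, j)) (A, j)))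
    (fun _ h => hc _ (tr (tr h' h'') h)) (fun _ h => ha _ (tr (tr h' h'') h))
    (he _ (tr h' h'')) hAC.symm
  convert this using 1
  funext ⟨r, j⟩
  have hCA := hAC.symm
  rw [ite_apply]
  by_cases hj : j < N
  · by_cases hrA : r = A
    · subst hrA
      cases hT : s T <;> cases hr : s (r, j) <;> cases hc : s (C, j) <;>
        simp [xorReg, swapReg, hAC, hCA, hTA, hj, hT, hr, hc]
    · by_cases hrC : r = C
      · subst hrC
        cases hT : s T <;> cases hr : s (r, j) <;> cases hc : s (A, j) <;>
          simp [xorReg, swapReg, hCA, hTA, hj, hT, hr, hc]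
      · simp [xorReg, swapReg, hrA, hrC]
  · simp [xorReg, swapReg, hj]

/-! ### Comparison of registers -/

/-- One digit of a comparison of two numbers: `f` is the result for the lower digits. -/
def digitGt (f a b : Bool) : Bool := xor f (xor a b && xor a f)

/-- `gtBits a b i` tells whether the number formed by the lowest `i` bits of `a` exceeds the one
formed by the lowest `i` bits of `b`. -/
def gtBits (a b : ℕ → Bool) : ℕ → Bool
  | 0 => false
  | i + 1 => digitGt (gtBits a b i) (a i) (b i)

/-- The number with the binary digits `a 0, …, a (i - 1)`. -/
def digitsVal (a : ℕ → Bool) (i : ℕ) : ℕ := ∑ j ∈ Finset.range i, if a j then 2 ^ j else 0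

theorem digitsVal_lt (a : ℕ → Bool) (i : ℕ) : digitsVal a i < 2 ^ i := by
  induction i with
  | zero => simp [digitsVal]
  | succ i ih =>
    rw [digitsVal, Finset.sum_range_succ, ← digitsVal, pow_succ]
    split_ifs <;> omega

theorem gtBits_eq (a b : ℕ → Bool) (i : ℕ) :
    gtBits a b i = decide (digitsVal b i < digitsVal a i) := by
  induction i with
  | zero => simp [gtBits, digitsVal]
  | succ i ih =>
    have ha := digitsVal_lt a i
    have hb := digitsVal_lt b i
    have hs : ∀ c : ℕ → Bool, digitsVal c (i + 1) = digitsVal c i + if c i then 2 ^ i else 0 :=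
      fun c => Finset.sum_range_succ _ _
    rw [gtBits, ih, hs, hs]
    cases a i <;> cases b i <;> simp [digitGt] <;> omega

/-- The register of intermediate results. -/
abbrev flagReg : SReg := .own 3 0

theorem maps_compareDigit {a b : RegExpr} {e : Expr} {A B : SReg} {i c : ℕ}
    (ha : a.eval env = A) (hb : b.eval env = B) (he : e.eval env = i)
    (hAB : A ≠ B) (hA : A ≠ flagReg) (hB : B ≠ flagReg) :
    (compareDigit a b e).Maps H G c env s (Function.update s (flagReg, i + 1)
      (xor (s (flagReg, i + 1)) (digitGt (s (flagReg, i)) (s (A, i)) (s (B, i))))) := by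
  have hf : RegExpr.flags.eval env = flagReg := rfl
  have h1 : ∀ r j : ℕ, (flagReg, j) ≠ (A, r) := fun _ _ h => hA (congrArg Prod.fst h).symm
  have h2 : ∀ r j : ℕ, (flagReg, j) ≠ (B, r) := fun _ _ h => hB (congrArg Prod.fst h).symm
  have h1' := fun r j => (h1 r j).symm
  have h2' := fun r j => (h2 r j).symm
  have h3 : ∀ r j : ℕ, (A, j) ≠ (B, r) := fun _ _ h => hAB (congrArg Prod.fst h)
  have h3' := fun r j => (h3 r j).symm
  refine Prog.Maps.issue_seq (o' := .cnot (A, i) (B, i)) (by simp [Op.map, ha, hb, he]) trivial ?_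
  refine Prog.Maps.issue_seq (o' := .cnot (A, i) (flagReg, i)) (by simp [Op.map, ha, hf, he])
    trivial ?_
  refine Prog.Maps.issue_seq (o' := .toffoli (B, i) (flagReg, i) (flagReg, i + 1))
    (by simp [Op.map, hb, hf, he, Expr.eval]) trivial ?_
  refine Prog.Maps.issue_seq (o' := .cnot (A, i) (flagReg, i)) (by simp [Op.map, ha, hf, he])
    trivial ?_
  refine Prog.Maps.issue_seq (o' := .cnot (A, i) (B, i)) (by simp [Op.map, ha, hb, he]) trivial ?_
  refine Prog.Maps.issue (o' := .cnot (flagReg, i) (flagReg, i + 1))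
    (by simp [Op.map, hf, he, Expr.eval]) trivial ?_
  have hne : (flagReg, i) ≠ (flagReg, i + 1) := by simp
  have hne' := hne.symm
  simp only [Op.fn, h3, h1', h2', hne, or_self, if_false]
  funext p
  by_cases p1 : p = (flagReg, i + 1)
  · subst p1
    simp [Function.update_of_ne, h2, h1', h2', h3, hne, digitGt]
    cases s (flagReg, i + 1) <;> cases s (flagReg, i) <;> cases s (A, i) <;> cases s (B, i) <;> rfl
  by_cases p2 : p = (flagReg, i)
  · subst p2
    simp [Function.update_of_ne, h2, h1', h2', h3, hne]
  by_cases p3 : p = (B, i)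
  · subst p3
    simp [Function.update_of_ne, h2, h1', h2', h3, hne]
  simp [Function.update_of_ne, p1, p2, p3]

/-- While the digits are compared, flag `i` holds the result for the lowest `i` digits; all flags
are zero before and after. -/
theorem maps_compareReg {a b : RegExpr} {t : RegExpr × Expr} {A B : SReg} {T : SReg × ℕ}
    (ha : ∀ env' : Env, (∀ v < 9, env' v = env v) → a.eval env' = A)
    (hb : ∀ env' : Env, (∀ v < 9, env' v = env v) → b.eval env' = B)
    (ht : ∀ env' : Env, (∀ v < 9, env' v = env v) →
      t.map (RegExpr.eval env') (Expr.eval env') = T)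
    (hm : env 1 = m) (hAB : A ≠ B) (hA : A ≠ flagReg) (hB : B ≠ flagReg)
    (hTA : T.1 ≠ A) (hTB : T.1 ≠ B) (hTF : T.1 ≠ flagReg) (hs : ∀ j, s (flagReg, j) = false) :
    (compareReg a b t).Maps H G 9 env s (Function.update s T
      (xor (s T) (gtBits (fun j => s (A, j)) (fun j => s (B, j)) m))) := by
  have tr : ∀ {env' : Env}, (∀ v < 9, env' v = env v) → ∀ {env'' : Env},
      (∀ v < 9, env'' v = env' v) → ∀ v < 9, env'' v = env v :=
    fun h1 _ h2 v hv => (h2 v hv).trans (h1 v hv)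
  set g := gtBits (fun j => s (A, j)) (fun j => s (B, j)) with hg
  -- the memory `u` with the results for up to `i` digits in the flags
  let S : Basis SReg → ℕ → Basis SReg := fun u i p =>
    if p.1 = flagReg ∧ p.2 ≤ i then g p.2 else u p
  have hS0 : ∀ u : Basis SReg, u (flagReg, 0) = false → S u 0 = u := by
    intro u hu
    funext ⟨r, j⟩
    by_cases hr : r = flagReg
    · by_cases hj : j = 0
      · subst hr hj; simp [S, hu, hg, gtBits]
      · simp [S, hj]
    · simp [S, hr]
  -- both directions of the ripple toggle flag `i + 1` by the same value
  have hup : ∀ (u : Basis SReg) (i : ℕ), (∀ j, u (A, j) = s (A, j)) → (∀ j, u (B, j) = s (B, j)) →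
      u (flagReg, i + 1) = false →
      Function.update (S u i) (flagReg, i + 1) (xor (S u i (flagReg, i + 1))
        (digitGt (S u i (flagReg, i)) (S u i (A, i)) (S u i (B, i)))) = S u (i + 1) ∧
      Function.update (S u (i + 1)) (flagReg, i + 1) (xor (S u (i + 1) (flagReg, i + 1))
        (digitGt (S u (i + 1) (flagReg, i)) (S u (i + 1) (A, i)) (S u (i + 1) (B, i)))) =
          S u i := by
    intro u i h1 h2 h3
    have hgi : digitGt (g i) (s (A, i)) (s (B, i)) = g (i + 1) := rfl
    constructor <;>
    · funext ⟨r, j⟩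
      by_cases hr : r = flagReg
      · by_cases hj : j = i + 1
        · subst hr hj; simp [S, hA, hB, h1, h2, h3, hgi]
        · have : j ≤ i + 1 ↔ j ≤ i := by omega
          simp [S, hr, hj, this]
      · simp [S, hr]
  refine Prog.Maps.seq (s' := S s m) ?_ fun env₁ e₁ => ?_
  · refine Prog.Maps.loop le_rfl (S s) (by simp [Expr.eval, hm]) (hS0 s (hs 0)).symm rfl ?_
    intro i _ env' hag hv
    refine ((hup s i (fun _ => rfl) (fun _ => rfl) (hs _)).1 ▸
      maps_compareDigit (ha _ hag) (hb _ hag) (by simp [Expr.eval, hv]) hAB hA hB)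
  refine Prog.Maps.issue_seq (o' := .cnot (flagReg, m) T) ?_ trivial ?_
  · simp only [Op.map, ht _ e₁]
    congr 1
    simp [Prod.map, RegExpr.eval, Expr.eval, e₁ 1 (by omega), hm]
  have hT : (flagReg, m) ≠ T := fun h => hTF (by rw [← h])
  have hTne : ∀ r, r ≠ T.1 → ∀ j, (r, j) ≠ T := fun r hr j h => hr (by rw [← h])
  set u := Function.update s T (xor (s T) (g m)) with hu
  have hmid : (Op.cnot (flagReg, m) T).fn H G (S s m) = S u m := by
    simp only [Op.fn, hT, if_false]
    funext p
    by_cases hp : p = T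
    · subst hp; simp [S, hTF, hu]
    · by_cases hr : p.1 = flagReg <;> by_cases hj : p.2 ≤ m <;> simp [S, hr, hp, hu, hj]
  rw [hmid]
  have huF : ∀ j, u (flagReg, j) = false := fun j => by
    rw [hu, Function.update_of_ne (hTne _ hTF.symm j), hs]
  refine Prog.Maps.loop (N := m) le_rfl (fun i => S u (m - i))
    (by simp [Expr.eval, hm, e₁ 1 (by omega)]) rfl ?_ ?_
  · simpa using hS0 u (huF 0)
  intro i hi env' hag hv
  obtain ⟨j, hj⟩ : ∃ j, m - i = j + 1 := ⟨m - i - 1, by omega⟩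
  have hj' : m - (i + 1) = j := by omega
  simp only [hj, hj']
  refine ((hup u j ?_ ?_ (huF _)).2 ▸ maps_compareDigit (ha _ (tr e₁ hag)) (hb _ (tr e₁ hag))
      ?_ hAB hA hB)
  · exact fun j => Function.update_of_ne (hTne _ hTA.symm j) _ _
  · exact fun j => Function.update_of_ne (hTne _ hTB.symm j) _ _
  · simp only [Expr.eval, hv, hag 1 (by omega), e₁ 1 (by omega), hm]; omega

end Gadgets

end

noncomputable section

/-! ### Records of points -/

/-- The bits of a register that holds the string `x`, or is empty. -/
def bitOf {N : ℕ} (x : Option (Bits N)) (j : ℕ) : Bool :=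
  match x with
  | none => false
  | some x => if h : j < N then x ⟨j, h⟩ else false

/-- A bit string as a number, with the lowest digit first. -/
def num {m : ℕ} (x : Bits m) : ℕ := digitsVal (bitOf (some x)) m

theorem digitsVal_succ (a : ℕ → Bool) (i : ℕ) :
    digitsVal a (i + 1) = digitsVal a i + if a i then 2 ^ i else 0 :=
  Finset.sum_range_succ _ _

theorem digitsVal_congr {a b : ℕ → Bool} {i : ℕ} (h : ∀ j < i, a j = b j) :
    digitsVal a i = digitsVal b i :=
  Finset.sum_congr rfl fun j hj => by rw [h j (Finset.mem_range.1 hj)]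

theorem digitsVal_inj {a b : ℕ → Bool} {i : ℕ} (h : digitsVal a i = digitsVal b i) :
    ∀ j < i, a j = b j := by
  induction i with
  | zero => simp
  | succ i ih =>
    rw [digitsVal_succ, digitsVal_succ] at h
    have ha := digitsVal_lt a i
    have hb := digitsVal_lt b i
    have hi : a i = b i := by
      cases h1 : a i <;> cases h2 : b i <;> simp [h1, h2] at h ⊢ <;> omega
    rw [hi] at h
    intro j hj
    rcases Nat.lt_succ_iff_lt_or_eq.1 hj with hj | rfl
    · exact ih (by omega) j hj
    · exact hi

theorem num_injective {m : ℕ} : Function.Injective (num (m := m)) := by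
  intro x y h
  funext j
  have := digitsVal_inj h j j.2
  simpa [bitOf] using this

/-- The order of the recorded points. -/
def ptLe {m : ℕ} (x y : Bits m) : Prop := num x ≤ num y

instance {m : ℕ} : DecidableRel (ptLe (m := m)) := fun x y => Nat.decLe (num x) (num y)
instance {m : ℕ} : IsTrans (Bits m) ptLe := ⟨fun _ _ _ h h' => Nat.le_trans h h'⟩
instance {m : ℕ} : Std.Antisymm (ptLe (m := m)) := ⟨fun _ _ h h' => num_injective (h.antisymm h')⟩
instance {m : ℕ} : Std.Total (ptLe (m := m)) := ⟨fun x y => Nat.le_total (num x) (num y)⟩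

/-- The function `l` with the value `x` inserted at position `p`. -/
def insertAt {α : Type*} (l : ℕ → Option α) (p : ℕ) (x : α) : ℕ → Option α :=
  fun i => if i < p then l i else if i = p then some x else l (i - 1)

/-- The `i`-th entry of a multiset of points, in increasing order. The contents of the record are a
function of the multiset: the order in which the points were recorded leaves no trace. -/
def entry {m : ℕ} (M : Multiset (Bits m)) (i : ℕ) : Option (Bits m) := (M.sort ptLe)[i]?

theorem entry_eq_none {m : ℕ} {M : Multiset (Bits m)} {i : ℕ} (h : M.card ≤ i) :
    entry M i = none := by
  simpa [entry] using h

theorem exists_entry_eq_some {m : ℕ} {M : Multiset (Bits m)} {i : ℕ} (h : i < M.card) :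
    ∃ v, entry M i = some v := by
  have : i < (M.sort ptLe).length := by simpa using h
  exact ⟨_, List.getElem?_eq_getElem this⟩

/-- A new point goes behind the entries that do not exceed it. -/
theorem entry_cons {m : ℕ} (M : Multiset (Bits m)) (x : Bits m) :
    ∃ p ≤ M.card, (∀ i < p, ∀ v, entry M i = some v → num v ≤ num x) ∧
      (∀ i, p ≤ i → ∀ v, entry M i = some v → num x < num v) ∧
      insertAt (entry M) p x = entry (x ::ₘ M) := by
  have key : ∀ l : List (Bits m), l.Pairwise ptLe → ∃ l₁ l₂, l = l₁ ++ l₂ ∧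
      (∀ a ∈ l₁, num a ≤ num x) ∧ ∀ a ∈ l₂, num x < num a := by
    intro l hl
    induction l with
    | nil => exact ⟨[], [], rfl, by simp, by simp⟩
    | cons a l ih =>
      rw [List.pairwise_cons] at hl
      by_cases ha : num a ≤ num x
      · obtain ⟨l₁, l₂, rfl, h1, h2⟩ := ih hl.2
        exact ⟨a :: l₁, l₂, rfl, by simpa using ⟨ha, h1⟩, h2⟩
      · refine ⟨[], a :: l, rfl, by simp, ?_⟩
        intro b hb
        rcases List.mem_cons.1 hb with rfl | hb
        · omega
        · have : num a ≤ num b := hl.1 b hb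
          omega
  obtain ⟨l₁, l₂, hl, h1, h2⟩ := key (M.sort ptLe) (Multiset.pairwise_sort M ptLe)
  have hs : l₁ ++ x :: l₂ = (x ::ₘ M).sort ptLe := by
    refine List.Perm.eq_of_pairwise' (r := ptLe) ?_ (Multiset.pairwise_sort _ _) ?_
    · have hp := Multiset.pairwise_sort M ptLe
      rw [hl, List.pairwise_append] at hp
      rw [List.pairwise_append, List.pairwise_cons]
      refine ⟨hp.1, ⟨fun b hb => (h2 b hb).le, hp.2.1⟩, fun a ha b hb => ?_⟩
      rcases List.mem_cons.1 hb with rfl | hb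
      · exact h1 a ha
      · exact hp.2.2 a ha b hb
    · rw [← Multiset.coe_eq_coe, Multiset.sort_eq, ← Multiset.coe_add, ← Multiset.cons_coe,
        Multiset.add_cons, Multiset.coe_add, ← hl, Multiset.sort_eq]
  have hlen : (l₁ ++ l₂).length = M.card := by rw [← hl, Multiset.length_sort]
  refine ⟨l₁.length, by rw [← hlen]; simp, ?_, ?_, ?_⟩
  · intro i hi v hv
    rw [entry, hl, List.getElem?_append_left hi] at hv
    exact h1 v (List.mem_of_getElem? hv)
  · intro i hi v hv
    rw [entry, hl, List.getElem?_append_right hi] at hv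
    exact h2 v (List.mem_of_getElem? hv)
  · funext i
    simp only [insertAt, entry, ← hs, hl]
    split_ifs with h h'
    · rw [List.getElem?_append_left h, List.getElem?_append_left h]
    · subst h'; simp
    · rw [List.getElem?_append_right (by omega), List.getElem?_append_right (by omega),
        List.getElem?_cons, if_neg (by omega)]
      congr 1; omega

/-- The memory of the simulator: the memory `s` of the query algorithm, the output `y`, the points
`a` and the masks `d`. -/
def conf (y a d : ℕ → ℕ → Bool) (s : Basis AReg) : Basis SReg := fun p =>
  match p.1 with
  | .ofA r => s (r, p.2)
  | .own 0 i => y i p.2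
  | .own 1 i => a i p.2
  | .own 2 i => d i p.2
  | .own _ _ => false

section

variable {m n : ℕ} (H G : Bits m → Bits n)

/-- The mask of a recorded point. -/
def maskOf (x : Bits m) : Bits n := fun j => xor (G x j) (H x j)

/-- The memory of the simulator with the record `c`. -/
def recConf (y : ℕ → ℕ → Bool) (c : ℕ → Option (Bits m)) (s : Basis AReg) : Basis SReg :=
  conf y (fun i => bitOf (c i)) (fun i => bitOf ((c i).map (maskOf H G))) s

/-- The function computed by a query, given the record `M`: it is `G` at the recorded points and
`H` elsewhere. (Points that are recorded an even number of times count as not recorded; this is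
what the circuit does, and such records do not contribute to success.) -/
def reproFn (M : Multiset (Bits m)) (x : Bits m) : Bits n :=
  if Odd (M.count x) then G x else H x

variable {H G} {env : Env} {s u : Basis SReg}

theorem oracleFn_eq_xorReg {N : ℕ} (f : Bits m → Bits N) {R C : SReg} (hRC : R ≠ C) :
    oracleFn f R C u = xorReg u C N (bitOf (some (f (readReg m R u)))) := by
  funext p
  simp only [oracleFn, hRC, if_false, xorReg]
  split_ifs with h
  · simp [bitOf, h.2]
  · rfl

/-- The qubit that `flagQubit` denotes. -/
abbrev resQubit : SReg × ℕ := (.own 4 0, 0)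

theorem maps_equalReg {a b : RegExpr} {A B : SReg}
    (ha : ∀ env' : Env, (∀ v < 9, env' v = env v) → a.eval env' = A)
    (hb : ∀ env' : Env, (∀ v < 9, env' v = env v) → b.eval env' = B)
    (hm : env 1 = m) (hAB : A ≠ B) (hA : ∀ i, A ≠ .own 3 i) (hB : ∀ i, B ≠ .own 3 i)
    (hA' : ∀ i, A ≠ .own 4 i) (hB' : ∀ i, B ≠ .own 4 i) (hs : ∀ j, s (flagReg, j) = false) :
    (equalReg a b).Maps H G 9 env s (Function.update s resQubit
      (xor (s resQubit) (decide (∀ j < m, s (A, j) = s (B, j))))) := by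
  have tr : ∀ {env' : Env}, (∀ v < 9, env' v = env v) → ∀ {env'' : Env},
      (∀ v < 9, env'' v = env' v) → ∀ v < 9, env'' v = env v :=
    fun h1 _ h2 v hv => (h2 v hv).trans (h1 v hv)
  have ht : ∀ env' : Env, flagQubit.map (RegExpr.eval env') (Expr.eval env') = resQubit :=
    fun _ => rfl
  have hTA : ∀ j, (A, j) ≠ resQubit := fun j h => hA' 0 (congrArg Prod.fst h)
  have hTB : ∀ j, (B, j) ≠ resQubit := fun j h => hB' 0 (congrArg Prod.fst h)
  have hTF : ∀ j, (flagReg, j) ≠ resQubit := fun j => by simp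
  refine Prog.Maps.issue_seq (o' := .not resQubit) rfl trivial ?_
  simp only [Op.fn]
  refine Prog.Maps.seq (maps_compareReg ha hb (fun _ _ => ht _) hm hAB (hA 0) (hB 0) (hA' 0).symm
    (hB' 0).symm (by simp) (fun j => by rw [Function.update_of_ne (hTF j), hs]))
    fun env₁ e₁ => ?_
  have := maps_compareReg (H := H) (G := G) (env := env₁) (s := Function.update
      (Function.update s resQubit (!s resQubit)) resQubit
      (xor (Function.update s resQubit (!s resQubit) resQubit)
        (gtBits (fun j => Function.update s resQubit (!s resQubit) (A, j))
          (fun j => Function.update s resQubit (!s resQubit) (B, j)) m)))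
    (fun _ h => hb _ (tr e₁ h)) (fun _ h => ha _ (tr e₁ h)) (fun _ _ => ht _)
    ((e₁ 1 (by omega)).trans hm) hAB.symm (hB 0) (hA 0) (hB' 0).symm (hA' 0).symm (by simp)
    (fun j => by rw [Function.update_of_ne (hTF j), Function.update_of_ne (hTF j), hs])
  convert this using 1
  simp only [Function.update_idem, Function.update_self, Function.update_of_ne (hTA _),
    Function.update_of_ne (hTB _), gtBits_eq]
  congr 1
  clear this
  by_cases h : ∀ j < m, s (A, j) = s (B, j)
  · rw [digitsVal_congr h, decide_eq_true h]
    simp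
  · have hne : digitsVal (fun j => s (A, j)) m ≠ digitsVal (fun j => s (B, j)) m :=
      fun h' => h (digitsVal_inj h')
    rw [decide_eq_false h]
    rcases lt_or_gt_of_ne hne with h1 | h1 <;>
      rw [decide_eq_true h1, decide_eq_false (lt_asymm h1)] <;> simp

theorem count_take_succ {α : Type*} [DecidableEq α] (l : List α) (i : ℕ) (x : α) :
    (l.take (i + 1)).count x = (l.take i).count x + if l[i]? = some x then 1 else 0 := by
  rw [List.take_add_one, List.count_append]
  congr 1
  cases h : l[i]? with
  | none => simp
  | some v => by_cases hv : v = x <;> simp [hv]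

/-- A query answers according to the record, whatever the registers are, as long as they are not
used for the record or for comparisons. -/
theorem maps_reprogQuery {rin rout : RegExpr} {R C : SReg} {k : ℕ} {M : Multiset (Bits m)}
    (hrin : ∀ env' : Env, (∀ v < 8, env' v = env v) → rin.eval env' = R)
    (hrout : ∀ env' : Env, (∀ v < 8, env' v = env v) → rout.eval env' = C)
    (hn : env 0 = n) (hm : env 1 = m) (hk : env 2 = k) (hM : M.card ≤ k)
    (hRC : R ≠ C) (hR : ∀ a i, R ≠ .own (a + 1) i) (hC : ∀ a i, C ≠ .own (a + 1) i)
    (hslot : ∀ i j, u (.own 1 i, j) = bitOf (entry M i) j)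
    (hmask : ∀ i j, u (.own 2 i, j) = bitOf ((entry M i).map (maskOf H G)) j)
    (hflag : ∀ j, u (flagReg, j) = false) (hres : u resQubit = false) :
    (reprogQuery rin rout).Maps H G 8 env u (oracleFn (reproFn H G M) R C u) := by
  have tr : ∀ {env' : Env}, (∀ v < 8, env' v = env v) → ∀ {env'' : Env},
      (∀ v < 9, env'' v = env' v) → ∀ v < 8, env'' v = env v :=
    fun h1 _ h2 v hv => (h2 v (by omega)).trans (h1 v hv)
  set l := M.sort ptLe with hl
  set x := readReg m R u with hx
  -- the memory when the corrections for the first `i` entries are made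
  let S : ℕ → Basis SReg := fun i =>
    xorReg u C n (bitOf (some (reproFn H G (l.take i : List (Bits m)) x)))
  have hSC : ∀ i r, r ≠ C → ∀ j, S i (r, j) = u (r, j) := fun i r hr j => by
    simp [S, xorReg, hr]
  refine Prog.Maps.issue_seq (o' := .queryH R C) ?_ trivial ?_
  · simp [Op.map, hrin env fun _ _ => rfl, hrout env fun _ _ => rfl]
  refine Prog.Maps.loop (N := k) le_rfl S (by simp [Expr.eval, hk]) ?_ ?_ ?_
  · simp [Op.fn, oracleFn_eq_xorReg, hRC, S, reproFn, ← hx]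
  · have hlk : l.length ≤ k := by simpa [hl] using hM
    have htake : (l.take k : Multiset (Bits m)) = M := by
      rw [List.take_of_length_le hlk, hl, Multiset.sort_eq]
    simp only [S, htake, oracleFn_eq_xorReg _ hRC, ← hx]
  intro i _ env₁ e₁ hv
  have hsl : ∀ env' : Env, (∀ v < 9, env' v = env₁ v) →
      (RegExpr.slot (.var 8)).eval env' = .own 1 i := fun env' h => by
    simp [RegExpr.eval, Expr.eval, h 8 (by omega), hv]
  have hma : ∀ env' : Env, (∀ v < 9, env' v = env₁ v) →
      (RegExpr.mask (.var 8)).eval env' = .own 2 i := fun env' h => by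
    simp [RegExpr.eval, Expr.eval, h 8 (by omega), hv]
  have hres' : ∀ j, (R, j) ≠ resQubit := fun j h => hR 3 0 (congrArg Prod.fst h)
  have hm₁ : env₁ 1 = m := (e₁ 1 (by omega)).trans hm
  refine Prog.Maps.mono (c := 9) ?_ (by omega)
  set e : Bool := decide (∀ j < m, u (R, j) = u (.own 1 i, j)) with he
  set f : ℕ → Bool := fun j => e && u (.own 2 i, j) with hf
  refine Prog.Maps.seq (maps_equalReg (fun _ h => hrin _ (tr e₁ h)) hsl hm₁ (hR 0 i) (hR 2)
    (by simp) (hR 3) (by simp) (fun j => by rw [hSC _ _ (hC 2 0).symm, hflag]))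
    fun env₂ e₂ => ?_
  have tr₂ : ∀ {env' : Env}, (∀ v < 9, env' v = env₂ v) → ∀ v < 9, env' v = env₁ v :=
    fun h v hv => (h v hv).trans (e₂ v hv)
  have hS1 : xor (S i resQubit) (decide (∀ j < m, S i (R, j) = S i (.own 1 i, j))) = e := by
    simp only [hSC i _ hRC, hSC i _ (hC 0 i).symm, hSC i _ (hC 3 0).symm, hres, he, Bool.false_xor]
  rw [hS1]
  refine Prog.Maps.seq (maps_ctrlCopyReg (T := resQubit) (fun _ _ => rfl) (fun _ h => hma _ (tr₂ h))
    (fun _ h => hrout _ (tr e₁ (tr₂ h))) (N := n)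
    (by simp only [Expr.eval]; rw [e₂ 0 (by omega), e₁ 0 (by omega), hn]) (hC 1 i).symm
    (hC 3 0).symm)
    fun env₃ e₃ => ?_
  have hf' : (fun j => Function.update (S i) resQubit e resQubit &&
      Function.update (S i) resQubit e (.own 2 i, j)) = f := by
    funext j
    have : (SReg.own 2 i, j) ≠ resQubit := by simp
    simp only [Function.update_of_ne this, hSC i _ (hC 1 i).symm, Function.update_self, hf]
  have tr₃ : ∀ {env' : Env}, (∀ v < 9, env' v = env₃ v) → ∀ v < 9, env' v = env₁ v :=
    fun h v hv => (h v hv).trans ((e₃ v hv).trans (e₂ v hv))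
  rw [hf']
  set w := xorReg (Function.update (S i) resQubit e) C n f with hw
  have hwC : ∀ r, r ≠ C → ∀ j, (r, j) ≠ resQubit → w (r, j) = u (r, j) := fun r hr j hj => by
    rw [hw]
    simp only [xorReg, hr, false_and, if_false]
    rw [Function.update_of_ne hj, hSC i r hr]
  have hwres : w resQubit = e := by
    simp [hw, xorReg, (hC 3 0).symm]
  have key := maps_equalReg (H := H) (G := G) (env := env₃) (s := w)
    (fun _ h => hrin _ (tr e₁ (tr₃ h))) (fun _ h => hsl _ (tr₃ h))
    ((tr₃ (fun _ _ => rfl) 1 (by omega)).trans hm₁) (hR 0 i) (hR 2)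
    (by simp) (hR 3) (by simp) (fun j => by rw [hwC _ (hC 2 0).symm _ (by simp), hflag])
  convert key using 1
  have hdec : decide (∀ j < m, w (R, j) = w (.own 1 i, j)) = e := by
    rw [he]
    congr 1
    refine propext (forall₂_congr fun j _ => ?_)
    rw [hwC _ hRC _ (hres' j), hwC _ (hC 0 i).symm _ (by simp)]
  rw [hdec, hwres, Bool.xor_self]
  funext p
  by_cases hp : p = resQubit
  · subst hp
    rw [Function.update_self, hSC _ _ (hC 3 0).symm, hres]
  rw [Function.update_of_ne hp, hw]
  simp only [S, xorReg]
  split_ifs with hpC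
  swap
  · rw [Function.update_of_ne hp, xorReg, if_neg hpC]
  rw [Function.update_of_ne hp, xorReg, if_pos hpC, Bool.xor_assoc]
  congr 1
  -- the entry `i` changes the parity of the multiplicity if it equals the input, and then its mask
  -- replaces the one value by the other
  have hx' : ∀ j (hj : j < m), u (R, j) = x ⟨j, hj⟩ := fun j hj => rfl
  simp only [hf, hmask, reproFn, Multiset.coe_count, count_take_succ, he, hslot]
  change _ = xor _ (_ && bitOf ((l[i]?).map _) _)
  have hent : entry M i = l[i]? := rfl
  rw [hent]
  cases hli : l[i]? with
  | none => simp [bitOf]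
  | some v =>
    have hiff : (∀ j < m, u (R, j) = bitOf (some v) j) ↔ v = x := by
      constructor
      · intro h
        funext j
        have := h j j.2
        rw [hx' j j.2] at this
        simpa [bitOf] using this.symm
      · rintro rfl j hj
        simp [bitOf, hj, hx' j hj]
    simp only [hiff, Option.some.injEq, Option.map_some]
    by_cases hvx : v = x
    · subst hvx
      by_cases hodd : Odd (List.count x (List.take i l))
      · have : ¬ Odd (List.count x (List.take i l) + 1) := by
          rw [Nat.not_odd_iff_even]; exact hodd.add_one
        simp [hodd, this, bitOf, hpC.2, maskOf]
      · have : Odd (List.count x (List.take i l) + 1) := (Nat.not_odd_iff_even.1 hodd).add_one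
        simp only [hodd, this, bitOf, hpC.2, maskOf, if_true, if_false, dif_pos, decide_true,
          Bool.true_and]
        cases G x ⟨p.2, hpC.2⟩ <;> cases H x ⟨p.2, hpC.2⟩ <;> rfl
    · simp [hvx]

end

end

noncomputable section

/-! ### Insertion into the sorted record -/

variable {m n : ℕ} {H G : Bits m → Bits n} {env : Env} {s : Basis AReg}

theorem bitOf_of_le {N : ℕ} (x : Option (Bits N)) {j : ℕ} (h : N ≤ j) : bitOf x j = false := by
  cases x with
  | none => rfl
  | some x => simp [bitOf, Nat.not_lt.2 h]

/-- Exchange of the values at `j` and at `j + 1`. -/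
def swapNext {α : Type*} (c : ℕ → α) (j : ℕ) : ℕ → α :=
  fun i => if i = j then c (j + 1) else if i = j + 1 then c j else c i

theorem swapReg_points (y d : ℕ → ℕ → Bool) (c : ℕ → Option (Bits m)) (b : Bool) (j : ℕ) :
    swapReg (Function.update (conf y (fun i => bitOf (c i)) d s) resQubit b)
        (.own 1 j) (.own 1 (j + 1)) m =
      Function.update (conf y (fun i => bitOf (swapNext c j i)) d s) resQubit b := by
  have h1 : ∀ i l, (SReg.own 1 i, l) ≠ resQubit := by simp
  funext p
  by_cases hp : p = resQubit
  · subst hp; simp [swapReg]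
  simp only [swapReg, Function.update_of_ne hp, Function.update_of_ne (h1 _ _)]
  obtain ⟨r, l⟩ := p
  by_cases hj : r = .own 1 j
  · subst hj
    by_cases hl : l < m
    · simp [conf, swapNext, hl]
    · simp [conf, hl, bitOf_of_le _ (not_lt.1 hl)]
  by_cases hj' : r = .own 1 (j + 1)
  · subst hj'
    by_cases hl : l < m
    · simp [conf, swapNext, hl]
    · simp [conf, hl, bitOf_of_le _ (not_lt.1 hl)]
  simp only [hj, hj', false_and, if_false]
  match r with
  | .ofA _ => rfl
  | .own 0 _ => rfl
  | .own 1 i =>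
    have h2 : i ≠ j := fun h => hj (by rw [h])
    have h3 : i ≠ j + 1 := fun h => hj' (by rw [h])
    simp [conf, swapNext, h2, h3]
  | .own 2 _ => rfl
  | .own (_ + 3) _ => rfl

theorem swapReg_masks (y a : ℕ → ℕ → Bool) (c : ℕ → Option (Bits n)) (b : Bool) (j : ℕ) :
    swapReg (Function.update (conf y a (fun i => bitOf (c i)) s) resQubit b)
        (.own 2 j) (.own 2 (j + 1)) n =
      Function.update (conf y a (fun i => bitOf (swapNext c j i)) s) resQubit b := by
  have h1 : ∀ i l, (SReg.own 2 i, l) ≠ resQubit := by simp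
  funext p
  by_cases hp : p = resQubit
  · subst hp; simp [swapReg]
  simp only [swapReg, Function.update_of_ne hp, Function.update_of_ne (h1 _ _)]
  obtain ⟨r, l⟩ := p
  by_cases hj : r = .own 2 j
  · subst hj
    by_cases hl : l < n
    · simp [conf, swapNext, hl]
    · simp [conf, hl, bitOf_of_le _ (not_lt.1 hl)]
  by_cases hj' : r = .own 2 (j + 1)
  · subst hj'
    by_cases hl : l < n
    · simp [conf, swapNext, hl]
    · simp [conf, hl, bitOf_of_le _ (not_lt.1 hl)]
  simp only [hj, hj', false_and, if_false]
  match r with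
  | .ofA _ => rfl
  | .own 0 _ => rfl
  | .own 1 _ => rfl
  | .own 2 i =>
    have h2 : i ≠ j := fun h => hj (by rw [h])
    have h3 : i ≠ j + 1 := fun h => hj' (by rw [h])
    simp [conf, swapNext, h2, h3]
  | .own (_ + 3) _ => rfl

theorem num_readReg (R : AReg) : digitsVal (fun j => s (R, j)) m = num (readReg m R s) :=
  digitsVal_congr fun j hj => by simp [bitOf, hj, readReg]

/-- The bit `b` tells whether the exchange is made. By the last hypothesis, the entry `j + 1`
compares in the same way afterwards, so that the flag is cleared. -/
theorem maps_bubbleStep {y : ℕ → ℕ → Bool} {c : ℕ → Option (Bits m)} {r : RegExpr} {e : Expr}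
    {R : AReg} {j : ℕ} {v w : Bits m} {b : Bool}
    (hr : ∀ env' : Env, (∀ v < 9, env' v = env v) → r.eval env' = .ofA R)
    (he : ∀ env' : Env, (∀ v < 9, env' v = env v) → e.eval env' = j)
    (hn : env 0 = n) (hm : env 1 = m)
    (hv : c j = some v) (hb : b = decide (num (readReg m R s) < num v))
    (hw : (if b then swapNext c j else c) (j + 1) = some w)
    (hb' : b = decide (num (readReg m R s) < num w)) :
    (bubbleStep r e).Maps H G 9 env (recConf H G y c s)
      (recConf H G y (if b then swapNext c j else c) s) := by
  have tr : ∀ {env' : Env}, (∀ v < 9, env' v = env v) → ∀ {env'' : Env},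
      (∀ v < 9, env'' v = env' v) → ∀ v < 9, env'' v = env v :=
    fun h1 _ h2 v hv => (h2 v hv).trans (h1 v hv)
  have hcmp : ∀ c : ℕ → Option (Bits m), ∀ (i : ℕ) (v : Bits m) (b : Bool), c i = some v →
      gtBits (fun l => Function.update (recConf H G y c s) resQubit b (.own 1 i, l))
        (fun l => Function.update (recConf H G y c s) resQubit b (.ofA R, l)) m =
        decide (num (readReg m R s) < num v) := by
    intro c i v b hv
    rw [gtBits_eq, ← num_readReg]
    have h1 : ∀ l, (SReg.own 1 i, l) ≠ resQubit := by simp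
    have h2 : ∀ l, (SReg.ofA R, l) ≠ resQubit := by simp
    simp only [Function.update_of_ne (h1 _), Function.update_of_ne (h2 _), recConf, conf, hv]
    rfl
  have hself : ∀ c : ℕ → Option (Bits m),
      Function.update (recConf H G y c s) resQubit false = recConf H G y c s :=
    fun c => Function.update_eq_self_iff.2 rfl
  have hflag : ∀ (c : ℕ → Option (Bits m)) (b : Bool) (l : ℕ),
      Function.update (recConf H G y c s) resQubit b (flagReg, l) = false :=
    fun c b l => by rw [Function.update_of_ne (by simp)]; rfl
  have hslot : ∀ env' : Env, (∀ v < 9, env' v = env v) →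
      (RegExpr.slot e).eval env' = .own 1 j := fun env' h => by
    simp [RegExpr.eval, Expr.eval, he env' h]
  have hslot' : ∀ env' : Env, (∀ v < 9, env' v = env v) →
      (RegExpr.slot (.add e (.const 1))).eval env' = .own 1 (j + 1) := fun env' h => by
    simp [RegExpr.eval, Expr.eval, he env' h]
  have hmask : ∀ env' : Env, (∀ v < 9, env' v = env v) →
      (RegExpr.mask e).eval env' = .own 2 j := fun env' h => by
    simp [RegExpr.eval, Expr.eval, he env' h]
  have hmask' : ∀ env' : Env, (∀ v < 9, env' v = env v) →
      (RegExpr.mask (.add e (.const 1))).eval env' = .own 2 (j + 1) := fun env' h => by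
    simp [RegExpr.eval, Expr.eval, he env' h]
  set c' := if b then swapNext c j else c with hc'
  have e1 := maps_compareReg (H := H) (G := G) (s := recConf H G y c s) (t := flagQubit)
    (T := resQubit) hslot hr (fun _ _ => rfl) hm
    (by simp) (by simp) (by simp) (by simp) (by simp) (by simp) (fun _ => rfl)
  have h0 := hcmp c j v false hv
  rw [hself] at h0
  rw [h0, ← hb, show recConf H G y c s resQubit = false from rfl, Bool.false_xor] at e1
  refine Prog.Maps.seq e1 fun env₁ f₁ => ?_
  have e2 := maps_ctrlSwapReg (H := H) (G := G) (env := env₁) (e := .var 1) (t := flagQubit)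
    (T := resQubit) (N := m) (s := Function.update (recConf H G y c s) resQubit b)
    (fun _ _ => rfl) (fun _ h => hslot _ (tr f₁ h)) (fun _ h => hslot' _ (tr f₁ h))
    (fun _ h => (tr f₁ h 1 (by omega)).trans hm) (by simp) (by simp) (by simp)
  refine Prog.Maps.seq e2 fun env₂ f₂ => ?_
  have e3 := maps_ctrlSwapReg (H := H) (G := G) (env := env₂) (e := .var 0) (t := flagQubit)
    (T := resQubit) (N := n) (s := if Function.update (recConf H G y c s) resQubit b resQubit then
      swapReg (Function.update (recConf H G y c s) resQubit b) (.own 1 j) (.own 1 (j + 1)) m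
      else Function.update (recConf H G y c s) resQubit b)
    (fun _ _ => rfl) (fun _ h => hmask _ (tr (tr f₁ f₂) h)) (fun _ h => hmask' _ (tr (tr f₁ f₂) h))
    (fun _ h => (tr (tr f₁ f₂) h 0 (by omega)).trans hn) (by simp) (by simp) (by simp)
  refine Prog.Maps.seq (s' := Function.update (recConf H G y c' s) resQubit b) ?_ fun env₃ f₃ => ?_
  · convert e3 using 1
    cases b
    · simp [c']
    · have k1 := swapReg_points (s := s) y (fun i => bitOf ((c i).map (maskOf H G))) c true j
      have k2 := swapReg_masks (s := s) y (fun i => bitOf (swapNext c j i))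
        (fun i => (c i).map (maskOf H G)) true j
      have k3 : swapNext (fun i => (c i).map (maskOf H G)) j =
          fun i => (c' i).map (maskOf H G) := by
        funext i
        simp only [hc', if_true, swapNext]
        split_ifs <;> rfl
      have k4 : swapNext c j = c' := by simp [hc']
      rw [k3, k4] at k2
      rw [k4] at k1
      rw [Function.update_self, if_pos rfl]
      unfold recConf
      rw [k1, Function.update_self, if_pos rfl, k2]
  have e4 := maps_compareReg (H := H) (G := G) (env := env₃) (t := flagQubit)
    (s := Function.update (recConf H G y c' s) resQubit b)
    (T := resQubit) (fun _ h => hslot' _ (tr (tr (tr f₁ f₂) f₃) h))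
    (fun _ h => hr _ (tr (tr (tr f₁ f₂) f₃) h)) (fun _ _ => rfl)
    ((tr (tr f₁ f₂) f₃ 1 (by omega)).trans hm)
    (by simp) (by simp) (by simp) (by simp) (by simp) (by simp) (hflag c' b)
  rw [hcmp c' (j + 1) w b hw, ← hb', Function.update_self, Bool.xor_self,
    Function.update_idem, hself] at e4
  exact e4

theorem insertAt_of_lt {α : Type*} {l : ℕ → Option α} {p i : ℕ} {x : α} (h : i < p) :
    insertAt l p x i = l i := if_pos h

theorem insertAt_self {α : Type*} {l : ℕ → Option α} {p : ℕ} {x : α} :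
    insertAt l p x p = some x := by simp [insertAt]

theorem swapNext_insertAt {α : Type*} (l : ℕ → Option α) (p : ℕ) (x : α) :
    swapNext (insertAt l (p + 1) x) p = insertAt l p x := by
  funext i
  simp only [swapNext, insertAt]
  split_ifs <;> first | rfl | omega | skip
  congr 1; omega

/-- After `i` rounds the new point has moved from the position `M.card` down to `M.card - i`, or it
has already reached its place `p`. -/
theorem maps_bubbleSort {y : ℕ → ℕ → Bool} {r : RegExpr} {R : AReg} {k : ℕ}
    {M : Multiset (Bits m)}
    (hr : ∀ env' : Env, (∀ v < 8, env' v = env v) → r.eval env' = .ofA R)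
    (hn : env 0 = n) (hm : env 1 = m) (hk : env 2 = k) (hM : env 6 = M.card) (hMk : M.card ≤ k) :
    (bubbleSort r).Maps H G 8 env
      (recConf H G y (insertAt (entry M) M.card (readReg m R s)) s)
      (recConf H G y (entry (readReg m R s ::ₘ M)) s) := by
  set x := readReg m R s with hx
  obtain ⟨p, hp, hlow, hhigh, hins⟩ := entry_cons M x
  refine Prog.Maps.loop (N := M.card) le_rfl
    (fun i => recConf H G y (insertAt (entry M) (max p (M.card - i)) x) s)
    (by simp only [Expr.eval, hk, hM]; omega) (by simp [hp]) (by simp [hins]) ?_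
  intro i hi env₁ f₁ hv
  refine Prog.Maps.mono (c := 9) ?_ (by omega)
  have hr' : ∀ env' : Env, (∀ v < 9, env' v = env₁ v) → r.eval env' = .ofA R := fun env' h =>
    hr env' fun v hv => (h v (by omega)).trans (f₁ v hv)
  obtain ⟨j, hj⟩ : ∃ j, M.card - i = j + 1 := ⟨M.card - i - 1, by omega⟩
  have hj' : M.card - (i + 1) = j := by omega
  have he : ∀ env' : Env, (∀ v < 9, env' v = env₁ v) →
      Expr.eval env' (.sub (.sub (.var 6) (.const 1)) (.var 8)) = j := fun env' h => by
    simp only [Expr.eval, h 6 (by omega), h 8 (by omega), hv, f₁ 6 (by omega), hM]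
    omega
  simp only [hj, hj']
  obtain ⟨v, hv⟩ := exists_entry_eq_some (M := M) (i := j) (by omega)
  have hn₁ := (f₁ 0 (by omega)).trans hn
  have hm₁ := (f₁ 1 (by omega)).trans hm
  rcases le_or_gt p j with hpj | hpj
  · rw [max_eq_right (by omega), max_eq_right hpj]
    have hlt := hhigh j hpj v hv
    have := maps_bubbleStep (H := H) (G := G) (s := s) (y := y) (w := v) (b := true)
      (c := insertAt (entry M) (j + 1) x) hr' he hn₁ hm₁
      (by rw [insertAt_of_lt (by omega), hv]) (by simp [← hx, hlt])
      (by simp [swapNext_insertAt, insertAt, hv]) (by simp [← hx, hlt])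
    simpa only [if_true, swapNext_insertAt] using this
  · rw [max_eq_left (by omega), max_eq_left hpj.le]
    have hle := hlow j hpj v hv
    obtain ⟨w, hw, hwx⟩ : ∃ w, insertAt (entry M) p x (j + 1) = some w ∧ num w ≤ num x := by
      rcases Nat.lt_or_ge (j + 1) p with h | h
      · obtain ⟨w, hw⟩ := exists_entry_eq_some (M := M) (i := j + 1) (by omega)
        exact ⟨w, by rw [insertAt_of_lt h, hw], hlow _ h w hw⟩
      · obtain rfl : p = j + 1 := by omega
        exact ⟨x, insertAt_self, le_rfl⟩
    exact maps_bubbleStep (H := H) (G := G) (s := s) (y := y) (v := v) (w := w) (b := false)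
      (c := insertAt (entry M) p x) hr' he hn₁ hm₁
      (by rw [insertAt_of_lt hpj, hv]) (by simp [← hx, hle]) (by simpa using hw)
      (by simp [← hx, hwx])

/-- Recording of a point takes the record of `M` to the record of the multiset with this point
added. -/
theorem maps_insertPoint {y : ℕ → ℕ → Bool} {r : RegExpr} {R : AReg} {k : ℕ}
    {M : Multiset (Bits m)}
    (hr : ∀ env' : Env, (∀ v < 8, env' v = env v) → r.eval env' = .ofA R)
    (hn : env 0 = n) (hm : env 1 = m) (hk : env 2 = k) (hM : env 6 = M.card) (hMk : M.card ≤ k) :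
    (insertPoint r).Maps H G 8 env (recConf H G y (entry M) s)
      (recConf H G y (entry (readReg m R s ::ₘ M)) s) := by
  set x := readReg m R s with hx
  set N := M.card with hN
  set a : ℕ → ℕ → Bool := fun i => bitOf (insertAt (entry M) N x i) with ha
  -- the masks, with the content `z` in the entry `N`
  let d : Option (Bits n) → ℕ → ℕ → Bool := fun z i =>
    if i = N then bitOf z else bitOf ((entry M i).map (maskOf H G))
  have e1 := maps_copyReg (H := H) (G := G) (env := env) (s := recConf H G y (entry M) s) (a := r)
    (c := .slot (.var 6)) (e := .var 1) (A := .ofA R) (C := .own 1 N) (N := m)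
    (fun env' h => hr env' fun v hv => h v (by omega))
    (fun env' h => by simp [RegExpr.eval, Expr.eval, h 6 (by omega), hM]) hm (by simp)
  have h1 : xorReg (recConf H G y (entry M) s) (.own 1 N) m
      (fun j => recConf H G y (entry M) s (.ofA R, j)) = conf y a (d none) s := by
    funext ⟨q, j⟩
    match q with
    | .ofA _ => simp [xorReg, recConf, conf]
    | .own 0 _ => simp [xorReg, recConf, conf]
    | .own 1 i =>
      rcases lt_trichotomy i N with h | rfl | h
      · simp [xorReg, recConf, conf, ha, insertAt, h, h.ne]
      · by_cases hj : j < m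
        · simp [xorReg, recConf, conf, ha, insertAt, entry_eq_none hN.ge, hj, bitOf, hx, readReg]
        · simp [xorReg, recConf, conf, ha, insertAt, entry_eq_none hN.ge, hj, bitOf]
      · simp [xorReg, recConf, conf, ha, insertAt, h.ne', h.not_gt,
          entry_eq_none (hN.ge.trans h.le), entry_eq_none (show M.card ≤ i - 1 by omega)]
    | .own 2 i =>
      by_cases hi : i = N
      · subst hi; simp [xorReg, recConf, conf, d, entry_eq_none hN.ge]
      · simp [xorReg, recConf, conf, d, hi]
    | .own (_ + 3) _ => simp [xorReg, recConf, conf]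
  have hread : ∀ z, readReg m (SReg.own 1 N) (conf y a (d z) s) = x := by
    intro z
    funext j
    simp [readReg, conf, ha, insertAt_self, bitOf]
  have hq : ∀ (f : Bits m → Bits n) (z : Option (Bits n)),
      oracleFn f (.own 1 N) (.own 2 N) (conf y a (d z) s) =
        conf y a (d (some fun j => xor (bitOf z j) (f x j))) s := by
    intro f z
    rw [oracleFn_eq_xorReg f (by simp), hread]
    funext ⟨q, j⟩
    match q with
    | .ofA _ => simp [xorReg, conf]
    | .own 0 _ => simp [xorReg, conf]
    | .own 1 i => simp [xorReg, conf]
    | .own 2 i =>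
      by_cases hi : i = N
      · by_cases hj : j < n
        · simp [xorReg, conf, d, hi, hj, bitOf]
        · simp [xorReg, conf, d, hi, hj, bitOf_of_le _ (not_lt.1 hj)]
      · simp [xorReg, conf, d, hi]
    | .own (_ + 3) _ => simp [xorReg, conf]
  rw [h1] at e1
  refine Prog.Maps.seq (e1.mono (by omega)) fun env₁ f₁ => ?_
  have hs1 : (RegExpr.slot (.var 6)).eval env₁ = .own 1 N := by
    simp [RegExpr.eval, Expr.eval, f₁ 6 (by omega), hM]
  have hs2 : (RegExpr.mask (.var 6)).eval env₁ = .own 2 N := by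
    simp [RegExpr.eval, Expr.eval, f₁ 6 (by omega), hM]
  refine Prog.Maps.issue_seq (o' := .queryG (.own 1 N) (.own 2 N)) (by simp [Op.map, hs1, hs2])
    trivial ?_
  refine Prog.Maps.issue_seq (o' := .queryH (.own 1 N) (.own 2 N)) (by simp [Op.map, hs1, hs2])
    trivial ?_
  simp only [Op.fn, hq]
  have hfin : conf y a (d (some fun j => xor (bitOf (some fun j : Fin n =>
      xor (bitOf (none : Option (Bits n)) j) (G x j)) j) (H x j))) s =
      recConf H G y (insertAt (entry M) N x) s := by
    unfold recConf
    congr 1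
    funext i
    rcases lt_trichotomy i N with h | rfl | h
    · simp [d, insertAt, h, h.ne]
    · simp [d, insertAt_self, bitOf]
      rfl
    · simp [d, insertAt, h.ne', h.not_gt,
          entry_eq_none (hN.ge.trans h.le), entry_eq_none (show M.card ≤ i - 1 by omega)]
  rw [hfin]
  exact maps_bubbleSort (fun env' h => hr env' fun v hv => (h v hv).trans (f₁ v hv))
    ((f₁ 0 (by omega)).trans hn) ((f₁ 1 (by omega)).trans hm) ((f₁ 2 (by omega)).trans hk)
    ((f₁ 6 (by omega)).trans hM) hMk

end

noncomputable section

/-! ### Superpositions of records -/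

theorem linearMap_ext_single {ι V : Type*} [AddCommMonoid V] [Module ℂ V] {f g : (ι →₀ ℂ) →ₗ[ℂ] V}
    (h : ∀ a, f (Finsupp.single a 1) = g (Finsupp.single a 1)) : f = g := by
  ext a
  exact h a

/-- A list of gates as a linear map. -/
def gatesLin {ρ : Type} [DecidableEq ρ] : List (Gate ρ) → QState ρ →ₗ[ℂ] QState ρ
  | [] => LinearMap.id
  | g :: L => gatesLin L ∘ₗ g.apply

theorem applyGates_eq {ρ : Type} [DecidableEq ρ] (L : List (Gate ρ)) (ψ : QState ρ) :
    applyGates L ψ = gatesLin L ψ := by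
  induction L generalizing ψ with
  | nil => rfl
  | cons g L ih => exact ih _

variable {m n : ℕ}

/-- Joint states of a record of points and of the memory of the query algorithm. Superpositions of
records are kept in this form, apart from the memory of the simulator that encodes them. -/
abbrev RState (m : ℕ) : Type := (Multiset (Bits m) × Basis AReg) →₀ ℂ

/-- The action of a linear map on the memory of the query algorithm. -/
def onMemory (U : QState AReg →ₗ[ℂ] QState AReg) : RState m →ₗ[ℂ] RState m :=
  Finsupp.linearCombination ℂ fun a =>
    Finsupp.lmapDomain ℂ ℂ (Prod.mk a.1) (U (Finsupp.single a.2 1))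

theorem onMemory_single (U : QState AReg →ₗ[ℂ] QState AReg) (a : Multiset (Bits m) × Basis AReg) :
    onMemory U (Finsupp.single a 1) =
      Finsupp.lmapDomain ℂ ℂ (Prod.mk a.1) (U (Finsupp.single a.2 1)) := by
  simp [onMemory]

section

variable (H G : Bits m → Bits n)

/-- The memory of the simulator for a given record and memory of the query algorithm. -/
def enc (a : Multiset (Bits m) × Basis AReg) : Basis SReg :=
  recConf H G (fun _ _ => false) (entry a.1) a.2

/-- A query, answered according to the record. -/
def queryPair (a : Multiset (Bits m) × Basis AReg) : Multiset (Bits m) × Basis AReg :=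
  (a.1, oracleFn (reproFn H G a.1) AReg.qin AReg.qout a.2)

end

/-- Recording of the content of register `R`. -/
def insertPair (R : AReg) (a : Multiset (Bits m) × Basis AReg) :
    Multiset (Bits m) × Basis AReg :=
  (readReg m R a.2 ::ₘ a.1, a.2)

theorem recConf_update {H G : Bits m → Bits n} (y : ℕ → ℕ → Bool) (c : ℕ → Option (Bits m))
    (s : Basis AReg) (p : AReg × ℕ) (b : Bool) :
    recConf H G y c (Function.update s p b) =
      Function.update (recConf H G y c s) (SReg.ofAEmb p.1, p.2) b := by
  funext ⟨r, j⟩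
  match r with
  | .ofA r =>
    by_cases h : (r, j) = p
    · subst h
      rw [show (SReg.ofA r, j) = (SReg.ofAEmb (r, j).1, (r, j).2) from rfl, Function.update_self]
      exact Function.update_self _ _ _
    · have h' : (SReg.ofA r, j) ≠ (SReg.ofAEmb p.1, p.2) := by
        rintro ⟨⟩; exact h rfl
      rw [Function.update_of_ne h']
      simp [recConf, conf, h]
  | .own 0 _ => rfl
  | .own 1 _ => rfl
  | .own 2 _ => rfl
  | .own (_ + 3) _ => rfl

theorem gate_lift_recConf {H G : Bits m → Bits n} (y : ℕ → ℕ → Bool) (c : ℕ → Option (Bits m))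
    (g : Gate AReg) (ψ : QState AReg) :
    (g.lift SReg.ofAEmb).apply (Finsupp.lmapDomain ℂ ℂ (recConf H G y c) ψ) =
      Finsupp.lmapDomain ℂ ℂ (recConf H G y c) (g.apply ψ) := by
  suffices h : (g.lift SReg.ofAEmb).apply ∘ₗ Finsupp.lmapDomain ℂ ℂ (recConf H G y c) =
      Finsupp.lmapDomain ℂ ℂ (recConf H G y c) ∘ₗ g.apply from LinearMap.congr_fun h ψ
  refine linearMap_ext_single fun s => ?_
  simp only [LinearMap.comp_apply, Finsupp.lmapDomain_apply, Finsupp.mapDomain_single, Gate.apply,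
    Finsupp.linearCombination_single, one_smul]
  rw [← Finsupp.lmapDomain_apply ℂ ℂ, map_sum]
  refine Finset.sum_congr rfl fun b _ => ?_
  rw [Finsupp.lmapDomain_apply, Finsupp.mapDomain_single, recConf_update, recConf_update]
  rfl

/-- The circuits of the query algorithm act on its own memory only, whatever the record is. -/
theorem gates_lift_enc (H G : Bits m → Bits n) (L : List (Gate AReg)) (Ψ : RState m) :
    applyGates (L.map (Gate.lift SReg.ofAEmb)) (Finsupp.mapDomain (enc H G) Ψ) =
      Finsupp.mapDomain (enc H G) (onMemory (gatesLin L) Ψ) := by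
  rw [applyGates_eq]
  have h1 : ∀ (c : ℕ → Option (Bits m)) (ψ : QState AReg),
      gatesLin (L.map (Gate.lift SReg.ofAEmb))
        (Finsupp.lmapDomain ℂ ℂ (recConf H G (fun _ _ => false) c) ψ) =
      Finsupp.lmapDomain ℂ ℂ (recConf H G (fun _ _ => false) c) (gatesLin L ψ) := by
    intro c
    induction L with
    | nil => exact fun ψ => rfl
    | cons g L ih =>
      intro ψ
      simp only [List.map_cons, gatesLin, LinearMap.comp_apply, gate_lift_recConf, ih]
  suffices h : gatesLin (L.map (Gate.lift SReg.ofAEmb)) ∘ₗ Finsupp.lmapDomain ℂ ℂ (enc H G) =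
      Finsupp.lmapDomain ℂ ℂ (enc H G) ∘ₗ onMemory (gatesLin L) from LinearMap.congr_fun h Ψ
  refine linearMap_ext_single fun a => ?_
  have h2 := h1 (entry a.1) (Finsupp.single a.2 1)
  simp only [Finsupp.lmapDomain_apply, Finsupp.mapDomain_single] at h2
  simp only [LinearMap.comp_apply, Finsupp.lmapDomain_apply, Finsupp.mapDomain_single,
    onMemory_single]
  rw [show enc H G a = recConf H G (fun _ _ => false) (entry a.1) a.2 from rfl, h2,
    ← Finsupp.mapDomain_comp]
  rfl

/-- All records in the superposition consist of `r` points. -/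
def HasCard (r : ℕ) (Ψ : RState m) : Prop := ∀ a ∈ Ψ.support, a.1.card = r

theorem HasCard.mapDomain {r r' : ℕ} {Ψ : RState m} (h : HasCard r Ψ)
    {g : Multiset (Bits m) × Basis AReg → Multiset (Bits m) × Basis AReg}
    (hg : ∀ a, a.1.card = r → (g a).1.card = r') : HasCard r' (Finsupp.mapDomain g Ψ) := by
  classical
  intro a ha
  obtain ⟨b, hb, rfl⟩ := Finset.mem_image.1 (Finsupp.mapDomain_support ha)
  exact hg b (h b hb)

theorem HasCard.onMemory {r : ℕ} {Ψ : RState m} (h : HasCard r Ψ)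
    (U : QState AReg →ₗ[ℂ] QState AReg) : HasCard r (onMemory U Ψ) := by
  classical
  intro a ha
  rw [QOracle.onMemory, Finsupp.linearCombination_apply] at ha
  obtain ⟨b, hb, ha⟩ := Finset.mem_biUnion.1 (Finsupp.support_sum ha)
  have := Finsupp.support_smul ha
  obtain ⟨s, -, rfl⟩ := Finset.mem_image.1 (Finsupp.mapDomain_support this)
  exact h b hb

/-! ### The contribution to the final state -/

theorem oracleFn_congr {ρ : Type} [DecidableEq ρ] {f g : Bits m → Bits n} {R C : ρ} {s : Basis ρ}
    (h : f (readReg m R s) = g (readReg m R s)) : oracleFn f R C s = oracleFn g R C s := by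
  simp only [oracleFn, h]

theorem readReg_oracleFn {f : Bits m → Bits n} {s : Basis AReg} :
    readReg m AReg.qin (oracleFn f AReg.qin AReg.qout s) = readReg m AReg.qin s := by
  funext j
  simp [readReg, oracleFn]

section

variable (T : Finset (Bits m))

/-- The sum, over the records `M ⊆ T` that lack `c` elements of `T`, of the images under `B` of the
memory of the query algorithm. For `B` the rest of a run with the oracle that is reprogrammed on all
of `T`, this is the contribution of the superposition to the final state of that run. -/
def contrib (B : QState AReg →ₗ[ℂ] QState AReg) (c : ℕ) : RState m →ₗ[ℂ] QState AReg :=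
  Finsupp.linearCombination ℂ fun a =>
    if a.1 ≤ T.val ∧ a.1.card + c = T.card then B (Finsupp.single a.2 1) else 0

theorem contrib_single (B : QState AReg →ₗ[ℂ] QState AReg) (c : ℕ)
    (a : Multiset (Bits m) × Basis AReg) : contrib T B c (Finsupp.single a 1) =
      if a.1 ≤ T.val ∧ a.1.card + c = T.card then B (Finsupp.single a.2 1) else 0 := by
  simp [contrib]

theorem contrib_comp (B U : QState AReg →ₗ[ℂ] QState AReg) (c : ℕ) (Ψ : RState m) :
    contrib T (B ∘ₗ U) c Ψ = contrib T B c (onMemory U Ψ) := by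
  suffices h : contrib T (B ∘ₗ U) c = contrib T B c ∘ₗ onMemory U from LinearMap.congr_fun h Ψ
  refine linearMap_ext_single fun a => ?_
  have key : ∀ ψ : QState AReg, contrib T B c (Finsupp.lmapDomain ℂ ℂ (Prod.mk a.1) ψ) =
      if a.1 ≤ T.val ∧ a.1.card + c = T.card then B ψ else 0 := by
    intro ψ
    suffices h : contrib T B c ∘ₗ Finsupp.lmapDomain ℂ ℂ (Prod.mk a.1) =
        if a.1 ≤ T.val ∧ a.1.card + c = T.card then B else 0 by
      have := LinearMap.congr_fun h ψ
      rw [LinearMap.comp_apply] at this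
      rw [this]
      split_ifs <;> rfl
    refine linearMap_ext_single fun s => ?_
    simp only [LinearMap.comp_apply, Finsupp.lmapDomain_apply, Finsupp.mapDomain_single,
      contrib_single]
    split_ifs <;> rfl
  rw [LinearMap.comp_apply, onMemory_single, key, contrib_single]
  rfl

theorem le_val_iff {M : Multiset (Bits m)} {x : Bits m} :
    x ::ₘ M ≤ T.val ↔ M ≤ T.val ∧ x ∈ T ∧ x ∉ M := by
  constructor
  · intro h
    refine ⟨(Multiset.le_cons_self M x).trans h,
      Multiset.mem_of_le h (Multiset.mem_cons_self x M), ?_⟩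
    exact (Multiset.nodup_cons.1 (Multiset.nodup_of_le h T.nodup)).1
  · rintro ⟨h1, h2, h3⟩
    rw [Multiset.le_iff_subset (Multiset.nodup_cons.2 ⟨h3, Multiset.nodup_of_le h1 T.nodup⟩)]
    intro u hu
    rcases Multiset.mem_cons.1 hu with rfl | hu
    · exact h2
    · exact Multiset.mem_of_le h1 hu

variable {T} {H G H' : Bits m → Bits n}

/-- In a record `M ≤ T.val` all multiplicities are at most one. -/
theorem reproFn_of_le {M : Multiset (Bits m)} (hM : M ≤ T.val) (x : Bits m) :
    reproFn H G M x = if x ∈ M then G x else H x := by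
  have hnd := Multiset.nodup_of_le hM T.nodup
  unfold reproFn
  by_cases h : x ∈ M
  · simp [Multiset.count_eq_one_of_mem hnd h, h]
  · simp [h]

/-- A query to the reprogrammed oracle: either the answer is consistent with the record, or the
input is a point that is still missing in the record. In the latter case, the answer consistent with
the old record is replaced by the one consistent with the new record. -/
theorem contrib_query (hH' : ∀ x, H' x = if x ∈ T then G x else H x)
    (B : QState AReg →ₗ[ℂ] QState AReg) (c : ℕ) (Ψ : RState m) :
    contrib T (B ∘ₗ oracle H' AReg.qin AReg.qout) (c + 1) Ψ =
      contrib T B (c + 1) (Finsupp.mapDomain (queryPair H G) Ψ) +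
      (contrib T B c (Finsupp.mapDomain (queryPair H G) (Finsupp.mapDomain (insertPair .qin) Ψ)) -
      contrib T B c
        (Finsupp.mapDomain (insertPair .qin) (Finsupp.mapDomain (queryPair H G) Ψ))) := by
  suffices h : contrib T (B ∘ₗ oracle H' AReg.qin AReg.qout) (c + 1) =
      contrib T B (c + 1) ∘ₗ Finsupp.lmapDomain ℂ ℂ (queryPair H G) +
      (contrib T B c ∘ₗ Finsupp.lmapDomain ℂ ℂ (queryPair H G) ∘ₗ
        Finsupp.lmapDomain ℂ ℂ (insertPair .qin) -
      contrib T B c ∘ₗ Finsupp.lmapDomain ℂ ℂ (insertPair .qin) ∘ₗ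
        Finsupp.lmapDomain ℂ ℂ (queryPair H G)) from LinearMap.congr_fun h Ψ
  refine linearMap_ext_single fun a => ?_
  obtain ⟨M, s⟩ := a
  simp only [LinearMap.add_apply, LinearMap.sub_apply, LinearMap.comp_apply,
    Finsupp.lmapDomain_apply, Finsupp.mapDomain_single, contrib_single, queryPair, insertPair,
    oracle_eq_basisMap, basisMap_single, le_val_iff, Multiset.card_cons, readReg_oracleFn]
  set x := readReg m AReg.qin s with hx
  have hcard : ∀ N, N + 1 + c = T.card ↔ N + (c + 1) = T.card := fun N => by omega
  simp only [hcard]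
  by_cases hM : M ≤ T.val
  swap
  · simp [hM]
  by_cases hc : M.card + (c + 1) = T.card
  swap
  · simp [hc]
  simp only [hM, hc, and_self, true_and, and_true, if_true]
  by_cases hxT : x ∈ T ∧ x ∉ M
  · rw [if_pos hxT, if_pos hxT]
    have h1 : H' x = reproFn H G (x ::ₘ M) x := by
      rw [reproFn_of_le ((le_val_iff T).2 ⟨hM, hxT⟩), hH']
      simp [hxT.1]
    rw [oracleFn_congr h1]
    abel
  · rw [if_neg hxT, if_neg hxT, sub_zero, add_zero]
    have h1 : H' x = reproFn H G M x := by
      rw [reproFn_of_le hM, hH']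
      have : x ∈ M → x ∈ T := fun h => Multiset.mem_of_le hM h
      by_cases h : x ∈ M
      · simp [h, this h]
      · have : x ∉ T := fun h' => hxT ⟨h', h⟩
        simp [h, this]
    rw [oracleFn_congr h1]

/-- If the record is complete, it answers as the reprogrammed oracle does. -/
theorem contrib_query_zero (hH' : ∀ x, H' x = if x ∈ T then G x else H x)
    (B : QState AReg →ₗ[ℂ] QState AReg) (Ψ : RState m) :
    contrib T (B ∘ₗ oracle H' AReg.qin AReg.qout) 0 Ψ =
      contrib T B 0 (Finsupp.mapDomain (queryPair H G) Ψ) := by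
  suffices h : contrib T (B ∘ₗ oracle H' AReg.qin AReg.qout) 0 =
      contrib T B 0 ∘ₗ Finsupp.lmapDomain ℂ ℂ (queryPair H G) from LinearMap.congr_fun h Ψ
  refine linearMap_ext_single fun a => ?_
  obtain ⟨M, s⟩ := a
  simp only [LinearMap.comp_apply, Finsupp.lmapDomain_apply, Finsupp.mapDomain_single,
    contrib_single, queryPair, oracle_eq_basisMap, basisMap_single]
  split_ifs with hM
  · have hMT : M = T.val := Multiset.eq_of_le_of_card_le hM.1 (by simpa using hM.2.ge)
    have h1 : H' (readReg m AReg.qin s) = reproFn H G M (readReg m AReg.qin s) := by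
      rw [reproFn_of_le hM.1, hH', hMT]; simp
    rw [oracleFn_congr h1]
  · rfl

/-- The projection to the basis states with property `P`. -/
def proj (P : Basis AReg → Prop) : QState AReg →ₗ[ℂ] QState AReg := by
  classical
  exact Finsupp.linearCombination ℂ fun s => if P s then Finsupp.single s 1 else 0

/-- The contribution to the final state, restricted to `P`, when the output entries `i, i + 1, …`
may still be added to the record: the sum over the records `M ⊆ T` that lack `c` elements of `T`,
all of which are among these output entries. -/
def contribOut (T : Finset (Bits m)) (P : Basis AReg → Prop) (i c : ℕ) :
    RState m →ₗ[ℂ] QState AReg := by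
  classical
  exact Finsupp.linearCombination ℂ fun a =>
    if a.1 ≤ T.val ∧ a.1.card + c = T.card ∧ P a.2 ∧
      ∀ u ∈ T, u ∈ a.1 ∨ ∃ j, i ≤ j ∧ j < T.card ∧ readReg m (.out j) a.2 = u
    then Finsupp.single a.2 1 else 0

variable {P : Basis AReg → Prop}

open Classical in
theorem contribOut_single (i c : ℕ) (a : Multiset (Bits m) × Basis AReg) :
    contribOut T P i c (Finsupp.single a 1) =
      if a.1 ≤ T.val ∧ a.1.card + c = T.card ∧ P a.2 ∧
        ∀ u ∈ T, u ∈ a.1 ∨ ∃ j, i ≤ j ∧ j < T.card ∧ readReg m (.out j) a.2 = u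
      then Finsupp.single a.2 1 else 0 := by
  simp [contribOut]

/-- At the start of the output phase, the condition on the missing points holds on all of `P`. -/
theorem contrib_proj (c : ℕ)
    (hP : ∀ s, P s → ∀ u ∈ T, ∃ j < T.card, readReg m (.out j) s = u) :
    contrib T (proj P) c = contribOut T P 0 c := by
  classical
  refine linearMap_ext_single fun a => ?_
  rw [contrib_single, contribOut_single]
  by_cases hPa : P a.2
  · have : ∀ u ∈ T, u ∈ a.1 ∨ ∃ j, 0 ≤ j ∧ j < T.card ∧ readReg m (.out j) a.2 = u :=
      fun u hu => .inr (by simpa using hP a.2 hPa u hu)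
    simp only [eq_true this, hPa, and_true]
    simp [proj, hPa]
  · simp [proj, hPa]

/-- The missing points cannot outnumber the output entries that may still be recorded. -/
theorem contribOut_eq_zero {i c : ℕ} (hi : i ≤ T.card) (h : T.card < i + c) :
    contribOut T P i c = 0 := by
  classical
  refine linearMap_ext_single fun a => ?_
  rw [contribOut_single, if_neg, LinearMap.zero_apply]
  rintro ⟨h1, h2, -, h4⟩
  have hsub : T ⊆ a.1.toFinset ∪ (Finset.Ico i T.card).image fun j => readReg m (.out j) a.2 := by
    intro u hu
    rcases h4 u hu with h | ⟨j, hj, hj', rfl⟩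
    · simp [h]
    · exact Finset.mem_union_right _ (Finset.mem_image_of_mem _ (by simp [hj, hj']))
  have h5 := Finset.card_le_card hsub
  have h6 := Finset.card_union_le a.1.toFinset
    ((Finset.Ico i T.card).image fun j => readReg m (.out j) a.2)
  have h7 := Multiset.toFinset_card_le a.1
  have h8 := Finset.card_image_le (s := Finset.Ico i T.card)
    (f := fun j => readReg m (.out j) a.2)
  simp only [Nat.card_Ico] at h8
  omega

/-- The output entry `i` either belongs to the record already, or it is a missing point, which is
then recorded. -/
theorem contribOut_step {i : ℕ} (hi : i < T.card)
    (hP : ∀ s, P s → (∀ j < T.card, readReg m (.out j) s ∈ T) ∧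
      ∀ j < T.card, ∀ j' < T.card, readReg m (.out j) s = readReg m (.out j') s → j = j')
    (c : ℕ) (Ψ : RState m) : contribOut T P i (c + 1) Ψ =
      contribOut T P (i + 1) (c + 1) Ψ +
        contribOut T P (i + 1) c (Finsupp.mapDomain (insertPair (.out i)) Ψ) := by
  classical
  suffices h : contribOut T P i (c + 1) = contribOut T P (i + 1) (c + 1) +
      contribOut T P (i + 1) c ∘ₗ Finsupp.lmapDomain ℂ ℂ (insertPair (.out i)) from
    LinearMap.congr_fun h Ψ
  refine linearMap_ext_single fun a => ?_
  obtain ⟨M, s⟩ := a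
  simp only [LinearMap.add_apply, LinearMap.comp_apply, Finsupp.lmapDomain_apply,
    Finsupp.mapDomain_single, contribOut_single, insertPair, le_val_iff, Multiset.card_cons]
  set x := readReg m (.out i) s with hx
  have hcard : M.card + 1 + c = T.card ↔ M.card + (c + 1) = T.card := by omega
  simp only [hcard]
  by_cases hM : M ≤ T.val ∧ M.card + (c + 1) = T.card ∧ P s
  swap
  · rw [if_neg, if_neg, if_neg, add_zero]
    · exact fun h => hM ⟨h.1.1, h.2.1, h.2.2.1⟩
    · exact fun h => hM ⟨h.1, h.2.1, h.2.2.1⟩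
    · exact fun h => hM ⟨h.1, h.2.1, h.2.2.1⟩
  obtain ⟨hM, hc, hPs⟩ := hM
  obtain ⟨hT, hinj⟩ := hP s hPs
  have hxT : x ∈ T := hT i hi
  simp only [hM, hc, hPs, hxT, true_and]
  have hsplit : ∀ u, (∃ j, i ≤ j ∧ j < T.card ∧ readReg m (.out j) s = u) ↔
      u = x ∨ ∃ j, i + 1 ≤ j ∧ j < T.card ∧ readReg m (.out j) s = u := by
    intro u
    constructor
    · rintro ⟨j, h1, h2, rfl⟩
      rcases h1.eq_or_lt with rfl | h1
      · exact .inl rfl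
      · exact .inr ⟨j, h1, h2, rfl⟩
    · rintro (rfl | ⟨j, h1, h2, rfl⟩)
      · exact ⟨i, le_rfl, hi, rfl⟩
      · exact ⟨j, by omega, h2, rfl⟩
  have hnot : ¬ ∃ j, i + 1 ≤ j ∧ j < T.card ∧ readReg m (.out j) s = x := by
    rintro ⟨j, h1, h2, h3⟩
    have := hinj j h2 i hi h3
    omega
  by_cases hxM : x ∈ M
  · have : ∀ u, (u ∈ M ∨ u = x ∨ ∃ j, i + 1 ≤ j ∧ j < T.card ∧ readReg m (.out j) s = u) ↔
        (u ∈ M ∨ ∃ j, i + 1 ≤ j ∧ j < T.card ∧ readReg m (.out j) s = u) := by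
      intro u
      constructor
      · rintro (h | rfl | h)
        · exact .inl h
        · exact .inl hxM
        · exact .inr h
      · rintro (h | h)
        · exact .inl h
        · exact .inr (.inr h)
    simp only [hsplit, this, hxM, not_true_eq_false, false_and, if_false, add_zero]
  · have h2 : ¬ ∀ u ∈ T, u ∈ M ∨ ∃ j, i + 1 ≤ j ∧ j < T.card ∧ readReg m (.out j) s = u := by
      intro h
      rcases h x hxT with h | h
      · exact hxM h
      · exact hnot h
    rw [if_neg h2, zero_add]
    simp only [hsplit, hxM, not_false_eq_true, true_and, Multiset.mem_cons]
    have : ∀ u, (u ∈ M ∨ u = x ∨ ∃ j, i + 1 ≤ j ∧ j < T.card ∧ readReg m (.out j) s = u) ↔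
        ((u = x ∨ u ∈ M) ∨ ∃ j, i + 1 ≤ j ∧ j < T.card ∧ readReg m (.out j) s = u) := by
      intro u; tauto
    simp only [this]

theorem contribOut_step_zero (i : ℕ) : contribOut T P i 0 = contribOut T P (i + 1) 0 := by
  classical
  refine linearMap_ext_single fun a => ?_
  obtain ⟨M, s⟩ := a
  simp only [contribOut_single]
  by_cases hM : M ≤ T.val ∧ M.card + 0 = T.card
  · have hMT : M = T.val := Multiset.eq_of_le_of_card_le hM.1 (by simpa using hM.2.ge)
    subst hMT
    have : ∀ i, ∀ u ∈ T, u ∈ T.val ∨ ∃ j, i ≤ j ∧ j < T.card ∧ readReg m (.out j) s = u :=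
      fun _ u hu => .inl hu
    simp only [eq_true (this _)]
  · rw [if_neg, if_neg] <;> exact fun h => hM ⟨h.1, h.2.1⟩

open Classical in
theorem contribOut_final_apply {i : ℕ} (Ψ : RState m) (s : Basis AReg) :
    contribOut T P i 0 Ψ s = if P s then Ψ (T.val, s) else 0 := by
  suffices h : Finsupp.lapply s ∘ₗ contribOut T P i 0 =
      if P s then Finsupp.lapply (R := ℂ) (M := ℂ) (T.val, s) else 0 by
    have := LinearMap.congr_fun h Ψ
    rw [LinearMap.comp_apply, Finsupp.lapply_apply] at this
    rw [this]
    split_ifs <;> rfl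
  refine linearMap_ext_single fun a => ?_
  obtain ⟨M, s'⟩ := a
  simp only [LinearMap.comp_apply, contribOut_single, Finsupp.lapply_apply]
  by_cases hs : s' = s
  · subst hs
    by_cases hP : P s'
    · by_cases hM : M = T.val
      · subst hM
        have : ∀ u ∈ T, u ∈ T.val ∨ ∃ j, i ≤ j ∧ j < T.card ∧ readReg m (.out j) s' = u :=
          fun u hu => .inl hu
        simp only [eq_true this, and_true]
        simp [hP]
      · rw [if_neg]
        · simp [hP, hM]
        · intro h
          exact hM (Multiset.eq_of_le_of_card_le h.1 (by simpa using h.2.1.ge))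
    · simp [hP]
  · have : (M, s') ≠ (T.val, s) := fun h => hs (congrArg Prod.snd h)
    split_ifs <;> simp [hs, this]

end

/-! ### Norms -/

/-- The squared norm of a state. -/
def normSq {ρ : Type} (ψ : QState ρ) : ℝ≥0∞ := ∑' s, ‖ψ s‖ₑ ^ 2

open Classical in
theorem measProb_eq_tsum {ρ : Type} (ψ : QState ρ) (P : Basis ρ → Prop) :
    measProb ψ P = ∑' s, if P s then ‖ψ s‖ₑ ^ 2 else 0 := by
  rw [tsum_eq_sum (s := ψ.support) fun s hs => by simp [Finsupp.notMem_support_iff.1 hs], measProb,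
    Finset.sum_filter]

theorem normSq_ne_top {ρ : Type} (ψ : QState ρ) : normSq ψ ≠ ∞ := by
  rw [normSq, tsum_eq_sum (s := ψ.support)]
  · exact (ENNReal.sum_lt_top.2 fun s _ => ENNReal.pow_lt_top enorm_lt_top).ne
  · intro s hs
    simp [Finsupp.notMem_support_iff.1 hs]

theorem proj_apply (P : Basis AReg → Prop) [DecidablePred P] (ψ : QState AReg) (s : Basis AReg) :
    proj P ψ s = if P s then ψ s else 0 := by
  classical
  suffices h : Finsupp.lapply s ∘ₗ proj P = if P s then Finsupp.lapply (R := ℂ) (M := ℂ) s else 0 by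
    have := LinearMap.congr_fun h ψ
    rw [LinearMap.comp_apply, Finsupp.lapply_apply] at this
    rw [this]
    split_ifs <;> rfl
  refine linearMap_ext_single fun s' => ?_
  by_cases hs : s' = s
  · subst hs
    by_cases hP : P s' <;> simp [proj, hP]
  · by_cases hP : P s' <;> by_cases hP' : P s <;> simp [proj, hP, hP', hs]

theorem measProb_eq_normSq_proj (ψ : QState AReg) (P : Basis AReg → Prop) :
    measProb ψ P = normSq (proj P ψ) := by
  classical
  rw [measProb_eq_tsum, normSq]
  refine tsum_congr fun s => ?_
  rw [proj_apply]
  split_ifs <;> simp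

/-- Cauchy–Schwarz inequality, with the weights `a` and `b` for the two terms. -/
theorem normSq_add_le {ρ : Type} (φ ψ : QState ρ) (a b : ℕ) :
    (a * b : ℕ) * normSq (φ + ψ) ≤
      ((a + b) * a : ℕ) * normSq φ + ((a + b) * b : ℕ) * normSq ψ := by
  simp only [normSq]
  rw [← ENNReal.tsum_mul_left, ← ENNReal.tsum_mul_left, ← ENNReal.tsum_mul_left,
    ← ENNReal.tsum_add]
  refine ENNReal.tsum_le_tsum fun s => ?_
  rw [Finsupp.add_apply]
  have h : ‖φ s + ψ s‖₊ ≤ ‖φ s‖₊ + ‖ψ s‖₊ := nnnorm_add_le _ _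
  simp only [enorm_eq_nnnorm]
  norm_cast
  set x := ‖φ s‖₊
  set y := ‖ψ s‖₊
  calc ((a * b : ℕ) : NNReal) * ‖φ s + ψ s‖₊ ^ 2 ≤ (a * b : ℕ) * (x + y) ^ 2 := by gcongr
    _ ≤ ((a + b) * a : ℕ) * x ^ 2 + ((a + b) * b : ℕ) * y ^ 2 := by
      rw [← NNReal.coe_le_coe]
      push_cast
      nlinarith [sq_nonneg ((a : ℝ) * x - b * y)]

theorem normSq_neg {ρ : Type} (φ : QState ρ) : normSq (-φ) = normSq φ := by
  simp [normSq]

theorem normSq_sub_le {ρ : Type} (φ ψ : QState ρ) :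
    normSq (φ - ψ) ≤ 2 * normSq φ + 2 * normSq ψ := by
  have := normSq_add_le φ (-ψ) 1 1
  simpa [normSq_neg, sub_eq_add_neg, one_add_one_eq_two] using this

end

noncomputable section

/-! ### The remaining run of the query algorithm -/

variable {m n : ℕ}

namespace QueryAlg

variable {q : ℕ}

/-- The rest of a run with oracle `f` when `j` queries remain, followed by the projection to `P`. -/
def rest (A : QueryAlg q) (f : Bits m → Bits n) (P : Basis AReg → Prop) :
    ℕ → QState AReg →ₗ[ℂ] QState AReg
  | 0 => proj P ∘ₗ gatesLin (A.circuit q)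
  | j + 1 => (A.rest f P j ∘ₗ oracle f .qin .qout) ∘ₗ gatesLin (A.circuit (q - (j + 1)))

/-- At every point of the run, the rest of it leads to the final state. -/
theorem rest_state (A : QueryAlg q) (f : Bits m → Bits n) (P : Basis AReg → Prop) {i : ℕ}
    (hi : i ≤ q) : A.rest f P (q - i) (A.state f i) = proj P (A.finalState f) := by
  obtain ⟨j, hj⟩ : ∃ j, j = q - i := ⟨_, rfl⟩
  rw [← hj]
  induction j generalizing i with
  | zero =>
    obtain rfl : i = q := by omega
    simp [rest, finalState, applyGates_eq]
  | succ j ih =>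
    rw [← ih (i := i + 1) (by omega) (by omega)]
    simp only [rest, state, LinearMap.comp_apply, applyGates_eq]
    rw [show q - (j + 1) = i by omega]

end QueryAlg

/-! ### Expectations -/

/-- The expectation of `F` with respect to `μ`. -/
def expect {α : Type*} (μ : PMF α) (F : α → ℝ≥0∞) : ℝ≥0∞ := ∑' a, μ a * F a

theorem expect_pure {α : Type*} (a : α) (F : α → ℝ≥0∞) : expect (PMF.pure a) F = F a := by
  classical
  rw [expect, tsum_eq_single a]
  · simp
  · intro b hb; simp [hb]

theorem expect_bind {α β : Type*} (μ : PMF α) (f : α → PMF β) (F : β → ℝ≥0∞) :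
    expect (μ.bind f) F = expect μ fun a => expect (f a) F := by
  simp only [expect, PMF.bind_apply, ← ENNReal.tsum_mul_right, ← ENNReal.tsum_mul_left]
  rw [ENNReal.tsum_comm]
  simp only [mul_assoc]

theorem le_expect {α : Type*} (μ : PMF α) {F : α → ℝ≥0∞} {c : ℝ≥0∞}
    (h : ∀ a ∈ μ.support, c ≤ F a) : c ≤ expect μ F := by
  calc c = ∑' a, μ a * c := by rw [ENNReal.tsum_mul_right, μ.tsum_coe, one_mul]
    _ ≤ ∑' a, μ a * F a := by
      refine ENNReal.tsum_le_tsum fun a => ?_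
      by_cases ha : μ a = 0
      · simp [ha]
      · exact mul_le_mul_right (h a ((μ.mem_support_iff a).2 ha)) _

theorem expect_mono {α : Type*} (μ : PMF α) {F F' : α → ℝ≥0∞} (h : ∀ a, F a ≤ F' a) :
    expect μ F ≤ expect μ F' :=
  ENNReal.tsum_le_tsum fun a => mul_le_mul_right (h a) _

/-- A loop invariant for lower bounds of expectations. -/
theorem le_expect_loopExec {body : Ctrl → PMF Ctrl} {v N : ℕ} (I : ℕ → Ctrl → ℝ≥0∞)
    (hstep : ∀ i < N, ∀ τ, I i τ ≤ expect (body ((τ.set v i).tick 1)) (I (i + 1))) (σ : Ctrl) :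
    I 0 σ ≤ expect (loopExec body v N σ) (I N) := by
  induction N with
  | zero => simp [loopExec, expect_pure]
  | succ N ih =>
    rw [loopExec, expect_bind]
    exact (ih fun i hi => hstep i (by omega)).trans (expect_mono _ fun τ => hstep N (by omega) τ)

/-- Splitting of a uniformly random number at `c`. -/
theorem le_expect_rand {v e c : ℕ} {e' : Expr} {σ : Ctrl} {F : Ctrl → ℝ≥0∞} {v₀ v₁ : ℝ≥0∞}
    (he : e'.eval σ.env = e) (hc : c ≤ e + 1)
    (h1 : ∀ a < c, v₁ ≤ F ((σ.set v a).tick (1 + Nat.size e)))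
    (h0 : ∀ a, c ≤ a → a ≤ e → v₀ ≤ F ((σ.set v a).tick (1 + Nat.size e))) :
    (c * v₁ + (e + 1 - c : ℕ) * v₀) / (e + 1 : ℕ) ≤ expect ((Prog.rand v e').exec σ) F := by
  subst he
  rw [Prog.exec, expect_bind]
  simp only [expect_pure]
  rw [expect, tsum_fintype]
  simp only [PMF.uniformOfFintype_apply, Fintype.card_fin]
  rw [← Finset.mul_sum, mul_comm (_⁻¹), ← div_eq_mul_inv]
  refine ENNReal.div_le_div_right ?_ _
  rw [Fin.sum_univ_eq_sum_range
    (fun a => F ((σ.set v a).tick (1 + Nat.size (e'.eval σ.env)))) (e'.eval σ.env + 1),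
    ← Finset.sum_range_add_sum_Ico _ hc]
  refine add_le_add ?_ ?_
  · have := Finset.card_nsmul_le_sum (Finset.range c)
      (fun a => F ((σ.set v a).tick (1 + Nat.size (e'.eval σ.env)))) v₁
      fun a ha => h1 a (Finset.mem_range.1 ha)
    simpa using this
  · have := Finset.card_nsmul_le_sum (Finset.Ico c (e'.eval σ.env + 1))
      (fun a => F ((σ.set v a).tick (1 + Nat.size (e'.eval σ.env)))) v₀
      fun a ha => by
        rw [Finset.mem_Ico] at ha
        exact h0 a ha.1 (by omega)
    simpa using this

/-! ### The weight of a random choice -/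

/-- The number of ways of choosing `c` of `t` remaining positions, with one bit for each. -/
def numChoices (t c : ℕ) : ℕ := 2 ^ c * t.choose c

theorem numChoices_pos {t c : ℕ} (h : c ≤ t) : 0 < numChoices t c :=
  Nat.mul_pos (by positivity) (Nat.choose_pos h)

theorem numChoices_succ (t c : ℕ) :
    (c + 1) * numChoices (t + 1) (c + 1) = 2 * (t + 1) * numChoices t c := by
  have := Nat.add_one_mul_choose_eq t c
  unfold numChoices
  calc (c + 1) * (2 ^ (c + 1) * (t + 1).choose (c + 1))
      = 2 * 2 ^ c * ((t + 1).choose (c + 1) * (c + 1)) := by ring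
    _ = 2 * (t + 1) * (2 ^ c * t.choose c) := by rw [← this]; ring

theorem numChoices_not (a c : ℕ) :
    a * numChoices (a + c) c = (a + c) * numChoices (a + c - 1) c := by
  cases a with
  | zero =>
    cases c with
    | zero => simp
    | succ c => simp [numChoices]
  | succ a =>
    have := Nat.choose_mul_succ_eq (a + c) c
    unfold numChoices
    rw [show a + 1 + c - 1 = a + c by omega, show a + 1 + c = a + c + 1 by omega]
    rw [show a + c + 1 - c = a + 1 by omega] at this
    calc (a + 1) * (2 ^ c * (a + c + 1).choose c)
        = 2 ^ c * ((a + c + 1).choose c * (a + 1)) := by ring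
      _ = (a + c + 1) * (2 ^ c * (a + c).choose c) := by rw [← this]; ring

/-- One position of the uniformly random choice, when `a + c + 1` positions remain for `c + 1`
points. The squared norm `X` is that of a sum of two parts, of squared norm `X₁` and `X₀`, for the
choices with and without the current position; it is bounded by the Cauchy–Schwarz inequality. The
weights `a` and `c + 1` are in inverse proportion to the numbers of these choices, so that a bound
of the form `norm / (number of choices) ^ 2` for what remains yields one of the same form for the
whole. -/
theorem weight_split {X X₀ X₁ v₀ v₁ : ℝ≥0∞} {a c : ℕ} (ha : 0 < a)
    (hX₀ : X₀ ≠ ∞) (hX₁ : X₁ ≠ ∞)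
    (hX : (a * (c + 1) : ℕ) * X ≤ ((a + (c + 1)) * a : ℕ) * X₁ + ((a + (c + 1)) * (c + 1) : ℕ) * X₀)
    (h₀ : X₀ / (numChoices (a + c) (c + 1) : ℝ≥0∞) ^ 2 ≤ v₀)
    (h₁ : X₁ / (2 * numChoices (a + c) c : ℝ≥0∞) ^ 2 ≤ v₁) :
    X / (numChoices (a + c + 1) (c + 1) : ℝ≥0∞) ^ 2 ≤
      ((c + 1 : ℕ) * v₁ + (a : ℕ) * v₀) / (a + c + 1 : ℕ) := by
  have hXt : X ≠ ∞ := by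
    rintro rfl
    rw [ENNReal.mul_top (by positivity)] at hX
    exact (ENNReal.add_lt_top.2 ⟨ENNReal.mul_lt_top (ENNReal.natCast_lt_top _) hX₁.lt_top,
      ENNReal.mul_lt_top (ENNReal.natCast_lt_top _) hX₀.lt_top⟩).not_ge hX
  lift X to NNReal using hXt
  lift X₀ to NNReal using hX₀
  lift X₁ to NNReal using hX₁
  have p0 : (0 : ℝ) < numChoices (a + c) (c + 1) := by exact_mod_cast numChoices_pos (by omega)
  have p1 : (0 : ℝ) < numChoices (a + c) c := by exact_mod_cast numChoices_pos (by omega)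
  have p2 : (0 : ℝ) < numChoices (a + c + 1) (c + 1) := by
    exact_mod_cast numChoices_pos (by omega)
  have e1 : ((c : ℝ) + 1) * numChoices (a + c + 1) (c + 1) =
      2 * (a + c + 1) * numChoices (a + c) c := by
    exact_mod_cast numChoices_succ (a + c) c
  have e0 : (a : ℝ) * numChoices (a + c + 1) (c + 1) =
      (a + c + 1) * numChoices (a + c) (c + 1) := by
    have := numChoices_not a (c + 1)
    rw [show a + (c + 1) - 1 = a + c by omega, show a + (c + 1) = a + c + 1 by omega] at this
    exact_mod_cast this
  refine le_trans ?_ (ENNReal.div_le_div_right (add_le_add (mul_le_mul_right h₁ _)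
    (mul_le_mul_right h₀ _)) _)
  have hXr : ((a : ℝ) * (c + 1)) * X ≤
      ((a + (c + 1)) * a) * X₁ + ((a + (c + 1)) * (c + 1)) * X₀ := by
    exact_mod_cast hX
  have q0 : (numChoices (a + c) (c + 1) : NNReal) ≠ 0 := by exact_mod_cast p0.ne'
  have q1 : (numChoices (a + c) c : NNReal) ≠ 0 := by exact_mod_cast p1.ne'
  have q2 : (numChoices (a + c + 1) (c + 1) : NNReal) ≠ 0 := by exact_mod_cast p2.ne'
  have key : X / (numChoices (a + c + 1) (c + 1) : NNReal) ^ 2 ≤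
      (((c + 1 : ℕ) : NNReal) * (X₁ / (2 * (numChoices (a + c) c : NNReal)) ^ 2) +
        (a : NNReal) * (X₀ / (numChoices (a + c) (c + 1) : NNReal) ^ 2)) /
        ((a + c + 1 : ℕ) : NNReal) := by
    rw [← NNReal.coe_le_coe]
    push_cast
    set N := (numChoices (a + c + 1) (c + 1) : ℝ)
    have ha' : (0 : ℝ) < a := by exact_mod_cast ha
    have f1 : 2 * (numChoices (a + c) c : ℝ) = (c + 1) * N / (a + c + 1) := by
      rw [eq_div_iff (by positivity), e1]; ring
    have f0 : (numChoices (a + c) (c + 1) : ℝ) = a * N / (a + c + 1) := by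
      rw [eq_div_iff (by positivity), e0]; ring
    rw [f1, f0]
    have : (X : ℝ) ≤ (a + c + 1) / (c + 1) * X₁ + (a + c + 1) / a * X₀ := by
      rw [← mul_le_mul_iff_of_pos_left (show (0 : ℝ) < a * (c + 1) by positivity)]
      refine hXr.trans_eq ?_
      field_simp
      ring
    calc (X : ℝ) / N ^ 2 ≤ ((a + c + 1) / (c + 1) * X₁ + (a + c + 1) / a * X₀) / N ^ 2 := by
          gcongr
      _ = _ := by field_simp
  have key' := ENNReal.coe_le_coe.2 key
  rw [ENNReal.coe_div (by positivity), ENNReal.coe_div (by positivity), ENNReal.coe_add,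
    ENNReal.coe_mul, ENNReal.coe_mul, ENNReal.coe_div (by positivity),
    ENNReal.coe_div (by positivity)] at key'
  simpa using key'

end

noncomputable section

/-! ### The number of queries to `G` -/

theorem mem_support_assign {v : ℕ} {e : Expr} {σ τ : Ctrl}
    (h : τ ∈ ((Prog.assign v e).exec σ).support) : τ = (σ.set v (e.eval σ.env)).tick 1 := by
  simpa [Prog.exec] using h

theorem mem_support_seq {p p' : Prog} {σ τ : Ctrl} (h : τ ∈ ((Prog.seq p p').exec σ).support) :
    ∃ τ₁ ∈ (p.exec σ).support, τ ∈ (p'.exec τ₁).support := by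
  simpa only [Prog.exec, PMF.mem_support_bind_iff] using h

theorem mem_support_ite {a b : Expr} {p p' : Prog} {σ τ : Ctrl}
    (h : τ ∈ ((Prog.ite a b p p').exec σ).support) :
    a.eval σ.env ≤ b.eval σ.env ∧ τ ∈ (p.exec (σ.tick 1)).support ∨
      ¬ a.eval σ.env ≤ b.eval σ.env ∧ τ ∈ (p'.exec (σ.tick 1)).support := by
  rw [Prog.exec] at h
  split_ifs at h with hif
  · exact .inl ⟨hif, h⟩
  · exact .inr ⟨hif, h⟩

theorem Ctrl.set_tick_env_self {v a c : ℕ} {σ : Ctrl} : ((σ.set v a).tick c).env v = a := by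
  simp [Ctrl.set, Ctrl.tick]

theorem Ctrl.set_tick_env_of_ne {u v a c : ℕ} {σ : Ctrl} (h : u ≠ v) :
    ((σ.set v a).tick c).env u = σ.env u := by
  simp [Ctrl.set, Ctrl.tick, h]

theorem reprogQuery_noG (a b : RegExpr) : (reprogQuery a b).NoG := by
  simp [reprogQuery, equalReg, compareReg, compareDigit, ctrlCopyReg, Prog.NoG, Op.isQueryG]

theorem reprogQuery_frame (a b : RegExpr) : (reprogQuery a b).Frame 8 := by
  simp [reprogQuery, equalReg, compareReg, compareDigit, ctrlCopyReg, Prog.Frame]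

theorem insertPoint_frame (r : RegExpr) : (insertPoint r).Frame 8 := by
  simp [insertPoint, bubbleSort, bubbleStep, ctrlSwapReg, copyReg, compareReg, compareDigit,
    ctrlCopyReg, Prog.Frame]

theorem numQueriesG_insertPoint {r : RegExpr} {σ τ : Ctrl}
    (h : τ ∈ ((insertPoint r).exec σ).support) : τ.numQueriesG = σ.numQueriesG + 1 := by
  obtain ⟨τ₁, h1, h⟩ := mem_support_seq h
  obtain ⟨τ₂, h2, h⟩ := mem_support_seq h
  rw [Prog.NoG.numQueriesG_eq (by simp [bubbleSort, bubbleStep, ctrlSwapReg, copyReg, compareReg,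
      compareDigit, ctrlCopyReg, Prog.NoG, Op.isQueryG]) h]
  rw [← Prog.NoG.numQueriesG_eq (by simp [copyReg, Prog.NoG, Op.isQueryG]) h1]
  simp only [Prog.exec, PMF.support_pure, Set.mem_singleton_iff] at h2
  simp [h2, Ctrl.numQueriesG, Op.map, Op.isQueryG]

/-- With `t` positions remaining, the record has one point for each query to `G`, at most `k`
points, and enough positions remain for the others. -/
structure Counts (k q t : ℕ) (σ : Ctrl) : Prop where
  env_k : σ.env 2 = k
  env_q : σ.env 3 = q
  count : σ.numQueriesG = σ.env 6
  le : σ.env 6 ≤ k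
  ge : k ≤ σ.env 6 + t

theorem Counts.congr {k q t : ℕ} {σ τ : Ctrl} (h : Counts k q t σ)
    (henv : ∀ v < 8, v ≠ 4 → v ≠ 5 → v ≠ 7 → τ.env v = σ.env v)
    (hG : τ.numQueriesG = σ.numQueriesG) : Counts k q t τ where
  env_k := by rw [henv 2 (by omega) (by omega) (by omega) (by omega), h.env_k]
  env_q := by rw [henv 3 (by omega) (by omega) (by omega) (by omega), h.env_q]
  count := by rw [henv 6 (by omega) (by omega) (by omega) (by omega), hG, h.count]
  le := by rw [henv 6 (by omega) (by omega) (by omega) (by omega)]; exact h.le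
  ge := by rw [henv 6 (by omega) (by omega) (by omega) (by omega)]; exact h.ge

theorem Counts.set {k q t v a c : ℕ} {σ : Ctrl} (h : Counts k q t σ) (hv : v = 4 ∨ v = 5 ∨ v = 7) :
    Counts k q t ((σ.set v a).tick c) :=
  h.congr (fun u _ _ _ _ => Ctrl.set_tick_env_of_ne (by omega)) rfl

theorem Counts.tick {k q t : ℕ} {σ : Ctrl} (h : Counts k q t σ) (c : ℕ) :
    Counts k q t (σ.tick c) :=
  h.congr (fun _ _ _ _ _ => rfl) rfl

theorem Counts.reprogQuery {k q t : ℕ} {a b : RegExpr} {σ τ : Ctrl} (h : Counts k q t σ)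
    (hτ : τ ∈ ((reprogQuery a b).exec σ).support) : Counts k q t τ :=
  h.congr (fun v hv _ _ _ => (reprogQuery_frame a b).env_eq hτ v hv)
    ((reprogQuery_noG a b).numQueriesG_eq hτ)

theorem Counts.insertPoint {k q t : ℕ} {r : RegExpr} {σ τ₁ τ : Ctrl} (h : Counts k q (t + 1) σ)
    (hlt : σ.env 6 < k) (hτ₁ : τ₁ ∈ ((insertPoint r).exec σ).support)
    (hτ : τ ∈ (countPoint.exec τ₁).support) : Counts k q t τ := by
  have henv := (insertPoint_frame r).env_eq hτ₁
  have h6 : τ.env 6 = σ.env 6 + 1 := by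
    rw [mem_support_assign hτ, ← henv 6 (by omega)]
    exact Ctrl.set_tick_env_self
  have hne : ∀ v < 8, v ≠ 6 → τ.env v = σ.env v := fun v hv h' => by
    rw [mem_support_assign hτ, ← henv v hv]
    exact Ctrl.set_tick_env_of_ne h'
  have hG : τ.numQueriesG = σ.numQueriesG + 1 := by
    rw [mem_support_assign hτ, ← numQueriesG_insertPoint hτ₁]; rfl
  have hge := h.ge
  exact ⟨by rw [hne 2 (by omega) (by omega), h.env_k], by rw [hne 3 (by omega) (by omega), h.env_q],
    by rw [hG, h6, h.count], by omega, by omega⟩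

theorem Counts.pass {k q t : ℕ} {σ : Ctrl} (h : Counts k q (t + 1) σ) (hlt : k - σ.env 6 ≤ t) :
    Counts k q t σ :=
  ⟨h.env_k, h.env_q, h.count, h.le, by omega⟩

theorem counts_simQuery {k q t i : ℕ} {σ τ : Ctrl} (h : Counts k q (t + 1) σ) (h4 : σ.env 4 = i)
    (ht : q + k - i = t + 1) (hτ : τ ∈ (simQuery.exec σ).support) : Counts k q t τ := by
  obtain ⟨τ₁, h1, hτ⟩ := mem_support_seq hτ
  obtain ⟨τ₂, h2, hτ⟩ := mem_support_seq hτ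
  have e1 : τ₁.env = σ.env ∧ τ₁.numQueriesG = σ.numQueriesG := by
    simp only [Prog.exec, PMF.support_pure, Set.mem_singleton_iff] at h1
    simp [h1, Ctrl.numQueriesG, Op.map, Op.isQueryG]
  have c1 : Counts k q (t + 1) τ₁ := h.congr (fun v _ _ _ _ => by rw [e1.1]) e1.2
  obtain ⟨a, ha, rfl⟩ := mem_support_rand h2
  have ha' : a ≤ t := by
    simp only [Expr.eval, c1.env_k, c1.env_q, e1.1, h4] at ha
    omega
  set τ₂ := (τ₁.set 5 a).tick (1 + Nat.size (Expr.eval τ₁.env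
    (((Expr.var 3).add (Expr.var 2)).sub (Expr.const 1) |>.sub (Expr.var 4)))) with hτ₂
  have c2 : Counts k q (t + 1) τ₂ := c1.set (.inr (.inl rfl))
  have a2 : τ₂.env 5 = a := Ctrl.set_tick_env_self
  have c3 : Counts k q (t + 1) (τ₂.tick 1) := c2.tick 1
  clear_value τ₂
  rcases mem_support_ite hτ with ⟨hif, hτ⟩ | ⟨hif, hτ⟩ <;>
    simp only [Expr.eval, a2, c2.env_k] at hif
  · obtain ⟨τ₄, h4, hτ⟩ := mem_support_seq hτ
    obtain ⟨b, -, rfl⟩ := mem_support_rand h4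
    have c5 := (c3.set (a := b) (c := 1 + Nat.size (Expr.eval (τ₂.tick 1).env (.const 1)))
      (.inr (.inr (Eq.refl 7)))).tick 1
    have hlt : τ₂.env 6 < k := by omega
    rcases mem_support_ite hτ with ⟨-, hτ⟩ | ⟨-, hτ⟩
    · obtain ⟨τ₅, h5, hτ⟩ := mem_support_seq hτ
      obtain ⟨τ₆, h6, hτ⟩ := mem_support_seq hτ
      refine (c5.insertPoint ?_ h5 h6).reprogQuery hτ
      exact (Ctrl.set_tick_env_of_ne (a := b)
        (c := 1 + Nat.size (Expr.eval (τ₂.tick 1).env (.const 1))) (show 6 ≠ 7 by omega)).trans_lt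
        hlt
    · obtain ⟨τ₅, h5, hτ⟩ := mem_support_seq hτ
      obtain ⟨τ₆, h6, hτ⟩ := mem_support_seq hτ
      refine (c5.reprogQuery h5).insertPoint ?_ h6 hτ
      rw [(reprogQuery_frame _ _).env_eq h5 6 (by omega)]
      exact (Ctrl.set_tick_env_of_ne (a := b)
        (c := 1 + Nat.size (Expr.eval (τ₂.tick 1).env (.const 1))) (show 6 ≠ 7 by omega)).trans_lt
        hlt
  · exact (c3.pass (show k - τ₂.env 6 ≤ t by omega)).reprogQuery hτ

theorem counts_simOutput {k q t i : ℕ} {σ τ : Ctrl} (h : Counts k q (t + 1) σ) (h4 : σ.env 4 = i)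
    (ht : k - i = t + 1) (hτ : τ ∈ (simOutput.exec σ).support) : Counts k q t τ := by
  obtain ⟨τ₂, h2, hτ⟩ := mem_support_seq hτ
  obtain ⟨a, ha, rfl⟩ := mem_support_rand h2
  have ha' : a ≤ t := by
    simp only [Expr.eval, h.env_k, h4] at ha
    omega
  set τ₂ := (σ.set 5 a).tick (1 + Nat.size (Expr.eval σ.env
    (((Expr.var 2).sub (Expr.const 1)).sub (Expr.var 4)))) with hτ₂
  have c2 : Counts k q (t + 1) τ₂ := h.set (.inr (.inl rfl))
  have a2 : τ₂.env 5 = a := Ctrl.set_tick_env_self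
  have c3 : Counts k q (t + 1) (τ₂.tick 1) := c2.tick 1
  clear_value τ₂
  rcases mem_support_ite hτ with ⟨hif, hτ⟩ | ⟨hif, hτ⟩ <;>
    simp only [Expr.eval, a2, c2.env_k] at hif
  · obtain ⟨τ₄, h4, hτ⟩ := mem_support_seq hτ
    exact c3.insertPoint (show τ₂.env 6 < k by omega) h4 hτ
  · simp only [Prog.exec, PMF.support_pure, Set.mem_singleton_iff] at hτ
    rw [hτ]
    exact c3.pass (show k - τ₂.env 6 ≤ t by omega)

/-- The random choice always comes to `k` positions: once as many points are missing as positions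
remain, every position is chosen, and once no point is missing, none is. -/
theorem simulator_numQueriesG {n m k q : ℕ} {σ : Ctrl}
    (hσ : σ ∈ (simulator.run n m k q).support) : σ.numQueriesG = k := by
  obtain ⟨τ₁, h1, hσ⟩ := mem_support_seq hσ
  obtain ⟨τ₂, h2, hσ⟩ := mem_support_seq hσ
  obtain ⟨τ₃, h3, hσ⟩ := mem_support_seq hσ
  have c1 : Counts k q k τ₁ := by
    simp only [Prog.exec] at h1
    have := loopExec_induction (σ := Ctrl.tick 1 _) (fun i τ => Counts k q (q + k - i) τ)
      ⟨rfl, rfl, rfl, Nat.zero_le _, by simp only [Ctrl.tick]; omega⟩ ?_ τ₁ h1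
    · simpa [Expr.eval] using this
    · intro i hi τ hτ τ' hτ'
      have hi' : i < q := hi
      obtain ⟨t, ht⟩ : ∃ t, q + k - i = t + 1 := ⟨q + k - i - 1, by omega⟩
      rw [ht] at hτ
      rw [show q + k - (i + 1) = t by omega]
      exact counts_simQuery (hτ.set (.inl rfl)) (Ctrl.set_tick_env_self) ht hτ'
  have c2 : Counts k q k τ₂ := by
    simp only [Prog.exec, PMF.support_pure, Set.mem_singleton_iff] at h2
    refine c1.congr (fun v _ _ _ _ => by rw [h2]) ?_
    simp [h2, Ctrl.numQueriesG, Op.map, Op.isQueryG]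
  have c3 : Counts k q 0 τ₃ := by
    simp only [Prog.exec] at h3
    have := loopExec_induction (σ := Ctrl.tick 1 _) (fun i τ => Counts k q (k - i) τ)
      (c2.tick 1) ?_ τ₃ h3
    · simpa [Expr.eval, c2.env_k] using this
    · intro i hi τ hτ τ' hτ'
      have hi' : i < k := by simpa [Expr.eval, c2.env_k] using hi
      obtain ⟨t, ht⟩ : ∃ t, k - i = t + 1 := ⟨k - i - 1, by omega⟩
      rw [ht] at hτ
      rw [show k - (i + 1) = t by omega]
      exact counts_simOutput (hτ.set (.inl rfl)) (Ctrl.set_tick_env_self) ht hτ'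
  have hnoG : (Prog.loop 4 (.var 2)
      (reprogQuery (.out (.var 4)) (.own (.const 0) (.var 4)))).NoG := reprogQuery_noG _ _
  rw [hnoG.numQueriesG_eq hσ, c3.count]
  have h1 := c3.le
  have h2 := c3.ge
  omega

end

noncomputable section

/-! ### Runs of the simulator -/

variable {m n q : ℕ}

/-- The status of a run in which `c` points are still to be recorded, and the memory is in the
superposition `Ψ` of records. -/
structure Represents (H G : Bits m → Bits n) (A : QueryAlg q) (k c : ℕ) (Ψ : RState m) (σ : Ctrl) :
    Prop where
  env_n : σ.env 0 = n
  env_m : σ.env 1 = m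
  env_k : σ.env 2 = k
  env_q : σ.env 3 = q
  count : σ.env 6 + c = k
  card : HasCard (σ.env 6) Ψ
  state : σ.finalState H G A = Finsupp.mapDomain (enc H G) Ψ

theorem oracleFn_enc {H G : Bits m → Bits n} (f : Bits m → Bits n)
    (a : Multiset (Bits m) × Basis AReg) :
    oracleFn f (SReg.ofA .qin) (SReg.ofA .qout) (enc H G a) =
      enc H G (a.1, oracleFn f AReg.qin AReg.qout a.2) := by
  funext ⟨r, j⟩
  match r with
  | .ofA r => simp [oracleFn, enc, recConf, conf]; rfl
  | .own 0 _ => simp [oracleFn, enc, recConf, conf]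
  | .own 1 _ => simp [oracleFn, enc, recConf, conf]
  | .own 2 _ => simp [oracleFn, enc, recConf, conf]
  | .own (_ + 3) _ => simp [oracleFn, enc, recConf, conf]

namespace Represents

variable {H G : Bits m → Bits n} {A : QueryAlg q} {k c : ℕ} {Ψ : RState m} {σ τ : Ctrl}

theorem congr (h : Represents H G A k c Ψ σ)
    (henv : ∀ v < 8, v ≠ 4 → v ≠ 5 → v ≠ 7 → τ.env v = σ.env v)
    {Ψ' : RState m} (hcard : HasCard (σ.env 6) Ψ')
    (hstate : τ.finalState H G A = Finsupp.mapDomain (enc H G) Ψ') : Represents H G A k c Ψ' τ where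
  env_n := by rw [henv 0 (by omega) (by omega) (by omega) (by omega), h.env_n]
  env_m := by rw [henv 1 (by omega) (by omega) (by omega) (by omega), h.env_m]
  env_k := by rw [henv 2 (by omega) (by omega) (by omega) (by omega), h.env_k]
  env_q := by rw [henv 3 (by omega) (by omega) (by omega) (by omega), h.env_q]
  count := by rw [henv 6 (by omega) (by omega) (by omega) (by omega), h.count]
  card := by rw [henv 6 (by omega) (by omega) (by omega) (by omega)]; exact hcard
  state := hstate

theorem set (h : Represents H G A k c Ψ σ) {v : ℕ} (hv : v = 4 ∨ v = 5 ∨ v = 7) (a d : ℕ) :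
    Represents H G A k c Ψ ((σ.set v a).tick d) :=
  h.congr (fun _ _ _ _ _ => Ctrl.set_tick_env_of_ne (by omega)) h.card h.state

theorem tick (h : Represents H G A k c Ψ σ) (d : ℕ) : Represents H G A k c Ψ (σ.tick d) :=
  h.congr (τ := σ.tick d) (fun _ _ _ _ _ => rfl) h.card h.state

theorem call (h : Represents H G A k c Ψ σ) {e : Expr} {i : ℕ} (he : e.eval σ.env = i)
    (hτ : τ ∈ ((Prog.issue (.callA e)).exec σ).support) :
    Represents H G A k c (onMemory (gatesLin (A.circuit i)) Ψ) τ := by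
  simp only [Prog.exec, PMF.support_pure, Set.mem_singleton_iff] at hτ
  refine h.congr (fun v _ _ _ _ => by rw [hτ]) (h.card.onMemory _) ?_
  rw [← gates_lift_enc, ← h.state, hτ, Ctrl.finalState, List.foldl_append]
  simp only [List.foldl_cons, List.foldl_nil, Op.map, Op.apply, he]
  rfl

theorem query (h : Represents H G A k c Ψ σ)
    (hτ : τ ∈ ((QOracle.reprogQuery .qin .qout).exec σ).support) :
    Represents H G A k c (Finsupp.mapDomain (queryPair H G) Ψ) τ := by
  refine h.congr (fun v hv _ _ _ => (reprogQuery_frame _ _).env_eq hτ v hv)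
    (h.card.mapDomain fun a ha => ha) ?_
  rw [← Finsupp.mapDomain_comp]
  refine finalState_of_maps H G (b := 8) (S := {a | a.1.card = σ.env 6})
    ⟨(Multiset.replicate (σ.env 6) fun _ => false, fun _ => false), by simp⟩ h.card
    (fun a ha => ?_) hτ h.state
  have ha' : a.1.card = σ.env 6 := ha
  have hc := h.count
  have := maps_reprogQuery (H := H) (G := G) (env := σ.env) (u := enc H G a) (M := a.1)
    (rin := .qin) (rout := .qout) (R := .ofA .qin) (C := .ofA .qout) (k := k)
    (fun _ _ => rfl) (fun _ _ => rfl) h.env_n h.env_m h.env_k (by omega) (by simp) (by simp)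
    (by simp) (fun _ _ => rfl) (fun _ _ => rfl) (fun _ => rfl) rfl
  rwa [oracleFn_enc] at this

theorem insert (h : Represents H G A k (c + 1) Ψ σ) {r : RegExpr} {R : AReg}
    (hr : ∀ env' : Env, (∀ v < 8, env' v = σ.env v) → r.eval env' = .ofA R) {τ₁ : Ctrl}
    (hτ₁ : τ₁ ∈ ((insertPoint r).exec σ).support) (hτ : τ ∈ (countPoint.exec τ₁).support) :
    Represents H G A k c (Finsupp.mapDomain (insertPair R) Ψ) τ := by
  have henv := (insertPoint_frame r).env_eq hτ₁
  have h6 : τ.env 6 = σ.env 6 + 1 := by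
    rw [mem_support_assign hτ, ← henv 6 (by omega)]
    exact Ctrl.set_tick_env_self
  have hne : ∀ v < 8, v ≠ 6 → τ.env v = σ.env v := fun v hv h' => by
    rw [mem_support_assign hτ, ← henv v hv]
    exact Ctrl.set_tick_env_of_ne h'
  have hc := h.count
  refine ⟨by rw [hne 0 (by omega) (by omega), h.env_n],
    by rw [hne 1 (by omega) (by omega), h.env_m],
    by rw [hne 2 (by omega) (by omega), h.env_k], by rw [hne 3 (by omega) (by omega), h.env_q],
    by omega, ?_, ?_⟩
  · rw [h6]
    exact h.card.mapDomain fun a ha => by simp [insertPair, ha]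
  · have hs : τ.finalState H G A = τ₁.finalState H G A := by rw [mem_support_assign hτ]; rfl
    rw [hs, ← Finsupp.mapDomain_comp]
    refine finalState_of_maps H G (b := 8) (S := {a | a.1.card = σ.env 6})
      ⟨(Multiset.replicate (σ.env 6) fun _ => false, fun _ => false), by simp⟩ h.card
      (fun a ha => ?_) hτ₁ h.state
    have ha' : a.1.card = σ.env 6 := ha
    exact maps_insertPoint hr h.env_n h.env_m h.env_k ha'.symm (by omega)

end Represents

/-! ### The rounds of the simulator -/

theorem expect_seq (p p' : Prog) (σ : Ctrl) (F : Ctrl → ℝ≥0∞) :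
    expect ((Prog.seq p p').exec σ) F = expect (p.exec σ) fun τ => expect (p'.exec τ) F :=
  expect_bind _ _ _

theorem expect_ite (a b : Expr) (p p' : Prog) (σ : Ctrl) (F : Ctrl → ℝ≥0∞) :
    expect ((Prog.ite a b p p').exec σ) F =
      if a.eval σ.env ≤ b.eval σ.env then expect (p.exec (σ.tick 1)) F
      else expect (p'.exec (σ.tick 1)) F := by
  rw [Prog.exec]
  split_ifs <;> rfl

/-- The bound for a recorded position, which averages over the bit that decides between recording
before and after the query. -/
theorem div_sq_le_half_add {X a b N : ℝ≥0∞} (h : X ≤ 2 * a + 2 * b) :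
    X / (2 * N) ^ 2 ≤ (a / N ^ 2 + b / N ^ 2) / 2 := by
  rw [← ENNReal.add_div, mul_pow]
  have h4 : (2 : ℝ≥0∞) ^ 2 = 2 * 2 := by norm_num
  calc X / (2 ^ 2 * N ^ 2) ≤ (2 * (a + b)) / (2 * (2 * N ^ 2)) := by
        rw [mul_add, h4, mul_assoc]
        exact ENNReal.div_le_div_right h _
    _ = (a + b) / (2 * N ^ 2) := ENNReal.mul_div_mul_left _ _ (by simp) (by simp)
    _ = (a + b) / N ^ 2 / 2 := by
        rw [div_eq_mul_inv, ENNReal.mul_inv (by simp) (by simp), div_eq_mul_inv, div_eq_mul_inv]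
        ring

/-- The lower bound for the success probability that results from the status `τ` when `t` positions
remain and the linear map `L c` gives the contribution of a superposition of records that lack `c`
points. The number `c` and the superposition `Ψ` are determined by `τ`; the supremum avoids choosing
them. -/
def lowerBound (H G : Bits m → Bits n) (A : QueryAlg q) (k : ℕ) (L : ℕ → RState m →ₗ[ℂ] QState AReg)
    (t : ℕ) (τ : Ctrl) : ℝ≥0∞ :=
  ⨆ (c : ℕ) (Ψ : RState m) (_ : Represents H G A k c Ψ τ),
    normSq (L c Ψ) / (numChoices t c : ℝ≥0∞) ^ 2

section

variable {H G H' : Bits m → Bits n} {A : QueryAlg q} {k c t i : ℕ} {Ψ : RState m} {σ τ : Ctrl}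
  {T : Finset (Bits m)}

theorem le_lowerBound {L : ℕ → RState m →ₗ[ℂ] QState AReg} (h : Represents H G A k c Ψ τ) :
    normSq (L c Ψ) / (numChoices t c : ℝ≥0∞) ^ 2 ≤ lowerBound H G A k L t τ :=
  le_iSup_of_le c (le_iSup_of_le Ψ (le_iSup_of_le h le_rfl))

theorem lowerBound_le {L : ℕ → RState m →ₗ[ℂ] QState AReg} {v : ℝ≥0∞}
    (h : ∀ c Ψ, Represents H G A k c Ψ τ → normSq (L c Ψ) / (numChoices t c : ℝ≥0∞) ^ 2 ≤ v) :
    lowerBound H G A k L t τ ≤ v :=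
  iSup_le fun c => iSup_le fun Ψ => iSup_le fun hΨ => h c Ψ hΨ

/-- By `contrib_query`, the contribution before a query is the sum of one term for the choices
without this position and of a difference of two terms, one for each value of the bit, for those
with it. -/
theorem lowerBound_simQuery (hH' : ∀ x, H' x = if x ∈ T then G x else H x)
    (B : QState AReg →ₗ[ℂ] QState AReg) (ht : q + k - i = t + 1) (hi : i < q) (σ : Ctrl) :
    lowerBound H G A k
        (contrib T ((B ∘ₗ oracle H' .qin .qout) ∘ₗ gatesLin (A.circuit i))) (t + 1) σ ≤
      expect (simQuery.exec ((σ.set 4 i).tick 1)) (lowerBound H G A k (contrib T B) t) := by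
  refine lowerBound_le fun c Ψ h => ?_
  rw [contrib_comp]
  have hk : t ≥ c := by have := h.count; omega
  have g0 := h.set (.inl (Eq.refl 4)) i 1
  have e0 : ((σ.set 4 i).tick 1).env 4 = i := Ctrl.set_tick_env_self
  set σ := (σ.set 4 i).tick 1
  clear_value σ
  rw [simQuery, expect_seq]
  refine le_expect _ fun τ hτ => ?_
  have e1 : τ.env 4 = i := by
    simp only [Prog.exec, PMF.support_pure, Set.mem_singleton_iff] at hτ
    rw [hτ]; exact e0
  replace h := g0.call (e := .var 4) e0 hτ
  set Ψ := onMemory (gatesLin (A.circuit i)) Ψ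
  clear_value Ψ
  clear hτ g0 e0
  have hrand : (Expr.sub (.sub (.add (.var 3) (.var 2)) (.const 1)) (.var 4)).eval τ.env = t := by
    simp only [Expr.eval, h.env_q, h.env_k, e1]
    omega
  have hcount := h.count
  cases c with
  | zero =>
    rw [contrib_query_zero hH', expect_seq]
    refine le_expect _ fun τ₁ h1 => ?_
    obtain ⟨a, -, rfl⟩ := mem_support_rand h1
    have g1 := h.set (.inr (.inl (Eq.refl 5))) a (1 + Nat.size (Expr.eval τ.env
      (.sub (.sub (.add (.var 3) (.var 2)) (.const 1)) (.var 4))))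
    set τ₁ := (τ.set 5 a).tick (1 + Nat.size (Expr.eval τ.env
      (.sub (.sub (.add (.var 3) (.var 2)) (.const 1)) (.var 4))))
    clear_value τ₁
    have hc1 := g1.count
    rw [expect_ite, if_neg (by simp only [Expr.eval, g1.env_k]; omega)]
    refine le_expect _ fun τ₂ h2 => ?_
    simpa [numChoices] using le_lowerBound (t := t) (L := contrib T B) ((g1.tick 1).query h2)
  | succ c =>
    obtain ⟨a, rfl⟩ : ∃ a, t = a + c := ⟨t - c, by omega⟩
    rw [contrib_query hH' B c Ψ, expect_seq, add_comm]
    set X₀ := contrib T B (c + 1) (Finsupp.mapDomain (queryPair H G) Ψ) with hX₀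
    set A₁ := contrib T B c (Finsupp.mapDomain (queryPair H G)
      (Finsupp.mapDomain (insertPair .qin) Ψ)) with hA₁
    set A₂ := contrib T B c (Finsupp.mapDomain (insertPair .qin)
      (Finsupp.mapDomain (queryPair H G) Ψ)) with hA₂
    have key := weight_split (a := a) (c := c) (by omega) (normSq_ne_top X₀)
      (normSq_ne_top (A₁ - A₂)) (normSq_add_le (A₁ - A₂) X₀ a (c + 1)) le_rfl
      (div_sq_le_half_add (normSq_sub_le A₁ A₂))
    have hrand' := fun v₁ v₀ => le_expect_rand (v := 5) (c := c + 1) (v₁ := v₁) (v₀ := v₀)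
      (F := fun τ => expect
      ((Prog.ite (.add (.var 5) (.const 1)) (.sub (.var 2) (.var 6))
        (.seq (.rand 7 (.const 1)) <|
          .ite (.const 1) (.var 7)
            (.seq (insertPoint .qin) (.seq countPoint (reprogQuery .qin .qout)))
            (.seq (reprogQuery .qin .qout) (.seq (insertPoint .qin) countPoint)))
        (reprogQuery .qin .qout)).exec τ) (lowerBound H G A k (contrib T B) (a + c)))
      hrand (by omega)
    rw [show a + c + 1 - (c + 1) = a by omega] at hrand'
    refine key.trans (hrand' _ _ ?_ ?_)
    · intro b hb
      have e5 : ((τ.set 5 b).tick (1 + Nat.size (a + c))).env 5 = b := Ctrl.set_tick_env_self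
      have g1 := h.set (.inr (.inl (Eq.refl 5))) b (1 + Nat.size (a + c))
      set τ₁ := (τ.set 5 b).tick (1 + Nat.size (a + c))
      clear_value τ₁
      have hc1 := g1.count
      rw [expect_ite, if_pos (by simp only [Expr.eval, g1.env_k, e5]; omega), expect_seq]
      refine le_trans (le_of_eq ?_) (le_expect_rand (e := 1) (c := 1) rfl (by omega)
        (v₁ := normSq A₂ / (numChoices (a + c) c : ℝ≥0∞) ^ 2)
        (v₀ := normSq A₁ / (numChoices (a + c) c : ℝ≥0∞) ^ 2) ?_ ?_)
      · norm_num [add_comm]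
      · intro d hd
        have e7 : (((τ₁.tick 1).set 7 d).tick (1 + Nat.size 1)).env 7 = d := Ctrl.set_tick_env_self
        have g2 := (g1.tick 1).set (.inr (.inr (Eq.refl 7))) d (1 + Nat.size 1)
        set τ₂ := ((τ₁.tick 1).set 7 d).tick (1 + Nat.size 1)
        clear_value τ₂
        rw [expect_ite, if_neg (by simp only [Expr.eval, e7]; omega)]
        refine le_expect _ fun τ₃ h3 => ?_
        obtain ⟨τ₄, h4, h3⟩ := mem_support_seq h3
        obtain ⟨τ₅, h5, h3⟩ := mem_support_seq h3
        exact le_lowerBound (((g2.tick 1).query h4).insert (fun _ _ => rfl) h5 h3)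
      · intro d hd _
        have e7 : (((τ₁.tick 1).set 7 d).tick (1 + Nat.size 1)).env 7 = d := Ctrl.set_tick_env_self
        have g2 := (g1.tick 1).set (.inr (.inr (Eq.refl 7))) d (1 + Nat.size 1)
        set τ₂ := ((τ₁.tick 1).set 7 d).tick (1 + Nat.size 1)
        clear_value τ₂
        rw [expect_ite, if_pos (by simp only [Expr.eval, e7]; omega)]
        refine le_expect _ fun τ₃ h3 => ?_
        obtain ⟨τ₄, h4, h3⟩ := mem_support_seq h3
        obtain ⟨τ₅, h5, h3⟩ := mem_support_seq h3
        exact le_lowerBound (((g2.tick 1).insert (fun _ _ => rfl) h4 h5).query h3)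
    · intro b hb _
      have e5 : ((τ.set 5 b).tick (1 + Nat.size (a + c))).env 5 = b := Ctrl.set_tick_env_self
      have g1 := h.set (.inr (.inl (Eq.refl 5))) b (1 + Nat.size (a + c))
      set τ₁ := (τ.set 5 b).tick (1 + Nat.size (a + c))
      clear_value τ₁
      have hc1 := g1.count
      rw [expect_ite, if_neg (by simp only [Expr.eval, g1.env_k, e5]; omega)]
      exact le_expect _ fun τ₃ h3 => le_lowerBound ((g1.tick 1).query h3)

/-- The same for an output entry, by `contribOut_step`. -/
theorem lowerBound_simOutput {P : Basis AReg → Prop} (hT : T.card = k)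
    (hP : ∀ s, P s → (∀ j < T.card, readReg m (.out j) s ∈ T) ∧
      ∀ j < T.card, ∀ j' < T.card, readReg m (.out j) s = readReg m (.out j') s → j = j')
    (ht : k - i = t + 1) (σ : Ctrl) :
    lowerBound H G A k (contribOut T P i) (t + 1) σ ≤
      expect (simOutput.exec ((σ.set 4 i).tick 1))
        (lowerBound H G A k (contribOut T P (i + 1)) t) := by
  refine lowerBound_le fun c Ψ h => ?_
  replace h := h.set (.inl (Eq.refl 4)) i 1
  have e4 : ((σ.set 4 i).tick 1).env 4 = i := Ctrl.set_tick_env_self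
  set σ := (σ.set 4 i).tick 1
  clear_value σ
  have hrand : (Expr.sub (.sub (.var 2) (.const 1)) (.var 4)).eval σ.env = t := by
    simp only [Expr.eval, h.env_k, e4]
    omega
  have hcount := h.count
  -- more missing points than positions: no contribution
  rcases lt_or_ge (t + 1) c with hc | hc
  · rw [contribOut_eq_zero (by omega) (by omega)]
    simp [normSq]
  rw [simOutput, expect_seq]
  cases c with
  | zero =>
    rw [contribOut_step_zero]
    refine le_expect _ fun τ₁ h1 => ?_
    obtain ⟨a, -, rfl⟩ := mem_support_rand h1
    rw [hrand] at h1 ⊢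
    have g1 := h.set (.inr (.inl (Eq.refl 5))) a (1 + Nat.size t)
    set τ₁ := (σ.set 5 a).tick (1 + Nat.size t)
    clear_value τ₁
    have hc1 := g1.count
    rw [expect_ite, if_neg (by simp only [Expr.eval, g1.env_k]; omega)]
    refine le_expect _ fun τ₂ h2 => ?_
    simp only [Prog.exec, PMF.support_pure, Set.mem_singleton_iff] at h2
    rw [h2]
    simpa [numChoices] using le_lowerBound (t := t) (L := contribOut T P (i + 1)) (g1.tick 1)
  | succ c =>
    set X₁ := contribOut T P (i + 1) c (Finsupp.mapDomain (insertPair (.out i)) Ψ) with hX₁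
    have hrec : ∀ b < c + 1, normSq X₁ / (2 * numChoices t c : ℝ≥0∞) ^ 2 ≤
        expect ((Prog.ite (.add (.var 5) (.const 1)) (.sub (.var 2) (.var 6))
          (.seq (insertPoint (.out (.var 4))) countPoint) .skip).exec
            ((σ.set 5 b).tick (1 + Nat.size t)))
          (lowerBound H G A k (contribOut T P (i + 1)) t) := by
      intro b hb
      have e5 : ((σ.set 5 b).tick (1 + Nat.size t)).env 5 = b := Ctrl.set_tick_env_self
      have e4' : ((σ.set 5 b).tick (1 + Nat.size t)).env 4 = i :=
        (Ctrl.set_tick_env_of_ne (by omega)).trans e4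
      have g1 := h.set (.inr (.inl (Eq.refl 5))) b (1 + Nat.size t)
      set τ₁ := (σ.set 5 b).tick (1 + Nat.size t)
      clear_value τ₁
      have hc1 := g1.count
      rw [expect_ite, if_pos (by simp only [Expr.eval, g1.env_k, e5]; omega)]
      refine le_expect _ fun τ₂ h2 => ?_
      obtain ⟨τ₃, h3, h2⟩ := mem_support_seq h2
      refine le_trans ?_
        (le_lowerBound ((g1.tick 1).insert (R := .out i) (fun env' h' => ?_) h3 h2))
      · refine ENNReal.div_le_div_left (pow_le_pow_left₀ zero_le ?_ 2) _
        rw [two_mul]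
        exact le_add_self
      · have : (τ₁.tick 1).env 4 = i := e4'
        simp [RegExpr.eval, Expr.eval, h' 4 (by omega), this]
    rw [contribOut_step (by omega) hP, ← hX₁]
    rcases hc.eq_or_lt with hc | hc
    -- as many missing points as positions: the current one is chosen with certainty
    · obtain rfl : c = t := by omega
      rw [contribOut_eq_zero (by omega) (by omega), LinearMap.zero_apply, zero_add]
      refine le_expect _ fun τ₁ h1 => ?_
      obtain ⟨b, hb, rfl⟩ := mem_support_rand h1
      rw [hrand] at hb ⊢
      refine le_trans (le_of_eq ?_) (hrec b (by omega))
      simp [numChoices, pow_succ']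
    · obtain ⟨a, rfl⟩ : ∃ a, t = a + c := ⟨t - c, by omega⟩
      rw [add_comm]
      set X₀ := contribOut T P (i + 1) (c + 1) Ψ with hX₀
      have key := weight_split (a := a) (c := c) (by omega) (normSq_ne_top X₀)
        (normSq_ne_top X₁) (normSq_add_le X₁ X₀ a (c + 1)) le_rfl le_rfl
      have hrand' := fun v₁ v₀ => le_expect_rand (v := 5) (c := c + 1) (v₁ := v₁) (v₀ := v₀)
        (F := fun τ => expect
          ((Prog.ite (.add (.var 5) (.const 1)) (.sub (.var 2) (.var 6))
            (.seq (insertPoint (.out (.var 4))) countPoint) .skip).exec τ)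
          (lowerBound H G A k (contribOut T P (i + 1)) (a + c)))
        hrand (by omega)
      rw [show a + c + 1 - (c + 1) = a by omega] at hrand'
      refine key.trans (hrand' _ _ hrec ?_)
      intro b hb _
      have e5 : ((σ.set 5 b).tick (1 + Nat.size (a + c))).env 5 = b := Ctrl.set_tick_env_self
      have g1 := h.set (.inr (.inl (Eq.refl 5))) b (1 + Nat.size (a + c))
      set τ₁ := (σ.set 5 b).tick (1 + Nat.size (a + c))
      clear_value τ₁
      have hc1 := g1.count
      rw [expect_ite, if_neg (by simp only [Expr.eval, g1.env_k, e5]; omega)]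
      refine le_expect _ fun τ₂ h2 => ?_
      simp only [Prog.exec, PMF.support_pure, Set.mem_singleton_iff] at h2
      rw [h2]
      exact le_lowerBound (g1.tick 1)

end

end

noncomputable section

/-! ### The output of the simulator -/

variable {m n q : ℕ}

/-- The memory of the simulator when the first `N` entries of the output list `y` are written. -/
def encOut (H G : Bits m → Bits n) (N : ℕ) (a : Multiset (Bits m) × Basis AReg) : Basis SReg :=
  recConf H G
    (fun i j => if i < N then bitOf (some (reproFn H G a.1 (readReg m (.out i) a.2))) j else false)
    (entry a.1) a.2

section

variable {H G H' : Bits m → Bits n} {A : QueryAlg q} {k : ℕ}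

theorem bitOf_some_injective {N : ℕ} {x y : Bits N}
    (h : ∀ j, bitOf (some x) j = bitOf (some y) j) : x = y := by
  funext j
  simpa [bitOf] using h j

/-- The number of points has to be fixed, since an absent entry has the same contents as the
all-zero string. -/
theorem encOut_injOn (N r : ℕ) :
    Set.InjOn (encOut H G N) {a : Multiset (Bits m) × Basis AReg | a.1.card = r} := by
  rintro ⟨M, s⟩ hM ⟨M', s'⟩ hM' h
  simp only [Set.mem_ofPred_eq] at hM hM'
  have hs : s = s' := by
    funext p
    exact congrFun h (.ofA p.1, p.2)
  have hent : entry M = entry M' := by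
    funext i
    rcases lt_or_ge i r with hi | hi
    · obtain ⟨v, hv⟩ := exists_entry_eq_some (M := M) (i := i) (by omega)
      obtain ⟨v', hv'⟩ := exists_entry_eq_some (M := M') (i := i) (by omega)
      have : ∀ j, bitOf (entry M i) j = bitOf (entry M' i) j := fun j => congrFun h (.own 1 i, j)
      rw [hv, hv'] at this ⊢
      rw [bitOf_some_injective this]
    · rw [entry_eq_none (by omega), entry_eq_none (by omega)]
  have hsort : M.sort ptLe = M'.sort ptLe := List.ext_getElem? fun i => congrFun hent i
  rw [← Multiset.sort_eq M ptLe, ← Multiset.sort_eq M' ptLe, hsort, hs]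

theorem maps_output {a : Multiset (Bits m) × Basis AReg} {env : Env} (hn : env 0 = n)
    (hm : env 1 = m) (hk : env 2 = k) (hM : a.1.card ≤ k) :
    (Prog.loop 4 (.var 2) (reprogQuery (.out (.var 4)) (.own (.const 0) (.var 4)))).Maps H G 4 env
      (enc H G a) (encOut H G k a) := by
  refine Prog.Maps.loop le_rfl (fun N => encOut H G N a) (by simpa [Expr.eval] using hk) ?_ rfl ?_
  · simp [encOut, enc]
  · intro i _ env' he hi
    refine Prog.Maps.mono (c := 8) ?_ (by omega)
    have key := maps_reprogQuery (H := H) (G := G) (env := env') (u := encOut H G i a) (M := a.1)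
      (rin := .out (.var 4)) (rout := .own (.const 0) (.var 4)) (R := .ofA (.out i))
      (C := .own 0 i) (k := k)
      (fun env'' h => by simp [RegExpr.eval, Expr.eval, h 4 (by omega), hi])
      (fun env'' h => by simp [RegExpr.eval, Expr.eval, h 4 (by omega), hi])
      ((he 0 (by omega)).trans hn) ((he 1 (by omega)).trans hm) ((he 2 (by omega)).trans hk) hM
      (by simp) (by simp) (by simp) (fun _ _ => rfl) (fun _ _ => rfl) (fun _ => rfl) rfl
    convert key using 1
    rw [oracleFn_eq_xorReg _ (by simp)]
    have hread : readReg m (SReg.ofA (.out i)) (encOut H G i a) = readReg m (.out i) a.2 := rfl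
    rw [hread]
    funext ⟨r, j⟩
    match r with
    | .ofA _ => simp [xorReg, encOut, recConf, conf]
    | .own 0 i' =>
      rcases lt_trichotomy i' i with h | rfl | h
      · simp [xorReg, encOut, recConf, conf, h, h.ne, h.trans (Nat.lt_succ_self i)]
      · by_cases hj : j < n
        · simp [xorReg, encOut, recConf, conf, hj]
        · simp [xorReg, encOut, recConf, conf, hj, bitOf]
      · simp [xorReg, encOut, recConf, conf, h.ne', h.not_gt, (Nat.succ_le_of_lt h).not_gt]
    | .own 1 _ => simp [xorReg, encOut, recConf, conf]
    | .own 2 _ => simp [xorReg, encOut, recConf, conf]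
    | .own (_ + 3) _ => simp [xorReg, encOut, recConf, conf]

/-- At the end, the contribution is the part of the superposition with the record `T`, which appears
unchanged in the memory of the simulator. -/
theorem normSq_contribOut_le_measProb {T : Finset (Bits m)} {P : Basis AReg → Prop}
    {Q : Basis SReg → Prop} {i N : ℕ} {Ψ : RState m} (hΨ : HasCard T.card Ψ)
    (hPQ : ∀ s, P s → Q (encOut H G N (T.val, s))) :
    normSq (contribOut T P i 0 Ψ) ≤ measProb (Finsupp.mapDomain (encOut H G N) Ψ) Q := by
  classical
  rw [measProb_eq_tsum]
  have hinj : Function.Injective fun s : Basis AReg => encOut H G N (T.val, s) := fun s s' h =>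
    congrArg Prod.snd (encOut_injOn N T.card
      (show (T.val, s) ∈ {a : Multiset (Bits m) × Basis AReg | a.1.card = T.card} from rfl)
      (show (T.val, s') ∈ {a : Multiset (Bits m) × Basis AReg | a.1.card = T.card} from rfl) h)
  refine le_trans ?_ (ENNReal.tsum_comp_le_tsum_of_injective hinj _)
  refine ENNReal.tsum_le_tsum fun s => ?_
  rw [contribOut_final_apply]
  by_cases hs : P s
  · rw [if_pos hs, if_pos (hPQ s hs), Finsupp.mapDomain_apply'
      {a : Multiset (Bits m) × Basis AReg | a.1.card = T.card} _ (fun a ha => hΨ a ha)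
      (encOut_injOn N T.card) (show (T.val, s).1.card = T.card from rfl)]
  · simp [hs]

/-- The last loop only computes the values `y`; no position remains, so `c = 0` is the only case
with a contribution. -/
theorem lowerBound_output {T : Finset (Bits m)} {P : Basis AReg → Prop} {Q : Basis SReg → Prop}
    (hT : T.card = k) (hPQ : ∀ s, P s → Q (encOut H G k (T.val, s))) (σ : Ctrl) :
    lowerBound H G A k (contribOut T P k) 0 σ ≤
      expect ((Prog.loop 4 (.var 2)
        (reprogQuery (.out (.var 4)) (.own (.const 0) (.var 4)))).exec σ)
        fun τ => measProb (τ.finalState H G A) Q := by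
  refine lowerBound_le fun c Ψ h => ?_
  have hc := h.count
  rcases Nat.eq_zero_or_pos c with rfl | hpos
  swap
  · rw [contribOut_eq_zero (by omega) (by omega)]
    simp [normSq]
  refine le_expect _ fun τ hτ => ?_
  have hcard : σ.env 6 = T.card := by omega
  rw [finalState_of_maps H G (b := 4) (S := {a | a.1.card = T.card}) (enc' := encOut H G k)
    ⟨(T.val, fun _ => false), rfl⟩ (hcard ▸ h.card)
    (fun a ha => maps_output h.env_n h.env_m h.env_k (by
      have : a.1.card = T.card := ha
      omega)) hτ h.state]
  simpa [numChoices] using normSq_contribOut_le_measProb (hcard ▸ h.card) hPQ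

/-- The success probability of the simulator, for an arbitrary property `P` of the final memory of
the query algorithm that forces its output list to enumerate `T`. -/
theorem simulator_lowerBound {T : Finset (Bits m)} {P : Basis AReg → Prop} {Q : Basis SReg → Prop}
    (hT : T.card = k) (hH' : ∀ x, H' x = if x ∈ T then G x else H x)
    (hP : ∀ s, P s → (∀ j < T.card, readReg m (.out j) s ∈ T) ∧
      ∀ j < T.card, ∀ j' < T.card, readReg m (.out j) s = readReg m (.out j') s → j = j')
    (hPQ : ∀ s, P s → Q (encOut H G k (T.val, s))) :
    measProb (A.finalState H') P / (numChoices (q + k) k : ℝ≥0∞) ^ 2 ≤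
      expect (simulator.run n m k q) fun τ => measProb (τ.finalState H G A) Q := by
  have hsurj : ∀ s, P s → ∀ u ∈ T, ∃ j < T.card, readReg m (.out j) s = u := by
    intro s hs u hu
    obtain ⟨h1, h2⟩ := hP s hs
    obtain ⟨j, hj, hju⟩ := Finset.surj_on_of_inj_on_of_card_le (s := Finset.range T.card) (t := T)
      (fun j _ => readReg m (.out j) s) (fun j hj => h1 j (Finset.mem_range.1 hj))
      (fun j j' hj hj' h => h2 j (Finset.mem_range.1 hj) j' (Finset.mem_range.1 hj') h)
      (by simp) u hu
    exact ⟨j, Finset.mem_range.1 hj, hju.symm⟩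
  set σ₀ : Ctrl := ⟨inputEnv n m k q, [], 0⟩ with hσ₀
  have hrun : simulator.run n m k q = simulator.exec σ₀ := rfl
  have start₀ : Represents H G A k k (Finsupp.single (0, fun _ => false) 1) (σ₀.tick 1) := by
    refine ⟨rfl, rfl, rfl, rfl, Nat.zero_add _, ?_, ?_⟩
    · intro a ha
      have := Finsupp.support_single_subset ha
      simp only [Finset.mem_singleton] at this
      rw [this]; rfl
    · rw [Finsupp.mapDomain_single]
      change initState SReg = _
      rw [initState]
      congr 1
      funext ⟨r, j⟩
      have hent : ∀ i, entry (0 : Multiset (Bits m)) i = none := fun i => entry_eq_none (by simp)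
      match r with
      | .ofA _ => rfl
      | .own 0 _ => rfl
      | .own 1 _ => simp [enc, recConf, conf, hent, bitOf]
      | .own 2 _ => simp [enc, recConf, conf, hent, bitOf]
      | .own (_ + 3) _ => rfl
  have start : measProb (A.finalState H') P / (numChoices (q + k) k : ℝ≥0∞) ^ 2 ≤
      lowerBound H G A k (contrib T (A.rest H' P q)) (q + k) (σ₀.tick 1) := by
    refine le_trans (le_of_eq ?_) (le_lowerBound start₀)
    rw [contrib_single, if_pos ⟨Multiset.zero_le _, by simp [hT]⟩, measProb_eq_normSq_proj]
    have := A.rest_state H' P (Nat.zero_le q)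
    rw [Nat.sub_zero] at this
    rw [← this]
    rfl
  refine start.trans ?_
  rw [hrun, simulator, expect_seq]
  refine (le_expect_loopExec (body := simQuery.exec) (v := 4) (N := q)
    (fun i => lowerBound H G A k (contrib T (A.rest H' P (q - i))) (q + k - i))
    (fun i hi τ => ?_) _).trans (expect_mono _ fun τ => ?_)
  · obtain ⟨j, hj⟩ : ∃ j, q - i = j + 1 := ⟨q - i - 1, by omega⟩
    rw [hj, show q - (i + 1) = j by omega, show q + k - i = j + k + 1 by omega,
      show q + k - (i + 1) = j + k by omega, QueryAlg.rest, show q - (j + 1) = i by omega]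
    exact lowerBound_simQuery hH' _ (by omega) hi τ
  rw [expect_seq]
  refine le_trans (b := expect ((Prog.issue (.callA (.var 3))).exec τ)
    (lowerBound H G A k (contribOut T P 0) k)) ?_ (expect_mono _ fun τ' => ?_)
  · rw [Nat.sub_self, Nat.add_sub_cancel_left, QueryAlg.rest]
    refine lowerBound_le fun c Ψ h => le_expect _ fun τ' hτ' => ?_
    rw [contrib_comp, contrib_proj c hsurj]
    exact le_lowerBound (h.call (e := .var 3) h.env_q hτ')
  rw [expect_seq]
  refine lowerBound_le fun c Ψ h => ?_
  have hloop : (Prog.loop 4 (.var 2) simOutput).exec τ' =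
      loopExec simOutput.exec 4 k (τ'.tick 1) := by
    rw [Prog.exec, Expr.eval, h.env_k]
  rw [hloop]
  refine (le_lowerBound (h.tick 1)).trans ((le_expect_loopExec (body := simOutput.exec) (v := 4)
    (N := k) (fun i => lowerBound H G A k (contribOut T P i) (k - i))
    (fun i hi τ => ?_) _).trans (expect_mono _ fun τ => ?_))
  · obtain ⟨j, hj⟩ : ∃ j, k - i = j + 1 := ⟨k - i - 1, by omega⟩
    rw [hj, show k - (i + 1) = j by omega]
    exact lowerBound_simOutput hT hP hj τ
  · rw [Nat.sub_self]
    exact lowerBound_output hT hPQ τ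

end

end

end QOracle

theorem theorem3p1 :
    ∃ (Sim : Prog) (p : MvPolynomial (Fin 4) ℕ),
      ∀ (m n k : ℕ), 0 < k → ∀ (q : ℕ) (A : QueryAlg q),
        (∀ σ ∈ (Sim.run n m k q).support,
          σ.numQueriesG = k ∧ σ.time A ≤ MvPolynomial.eval ![n, m, k, A.time] p) ∧
        ∀ (H G : Bits m → Bits n) (l : ℕ)
          (R : (Fin k → Bits m) → (Fin k → Bits n) → Bits l → Prop)
          (xo : Fin k → Bits m), Function.Injective xo →
          ∀ (yo : Fin k → Bits n), (∀ i, yo i = G (xo i)) →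
            1 / (2 ^ (2 * k) * ((q + k).choose k : ENNReal) ^ 2) *
                A.outputProb (reprogram H xo yo) k l (fun x z =>
                  EquivPerm x xo ∧
                    Accepts R (reprogram H xo yo) x (fun i => reprogram H xo yo (x i)) z) ≤
              Sim.outputProb H G A k l (fun x y z =>
                EquivPerm x xo ∧ Accepts R (reprogram H xo yo) x y z) := by
  classical
  refine ⟨simulator,
    simulator.cost.eval₂ MvPolynomial.C (.X 0 + .X 1 + .X 2 + .X 3 + 1) * (1 + .X 3), ?_⟩
  intro m n k _ q A
  refine ⟨fun σ hσ => ⟨simulator_numQueriesG hσ, (simulator_time_le A hσ).trans_eq ?_⟩, ?_⟩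
  · rw [map_mul, Polynomial.hom_eval₂]
    rw [show (MvPolynomial.eval ![n, m, k, A.time]).comp MvPolynomial.C = RingHom.id ℕ from
      Subsingleton.elim _ _, ← Polynomial.eval]
    simp
  intro H G l R xo hxo yo hyo
  set H' := reprogram H xo yo with hH'
  set T := Finset.univ.image xo with hT
  have hcard : T.card = k := by
    rw [hT, Finset.card_image_of_injective _ hxo, Finset.card_univ, Fintype.card_fin]
  have hrep : ∀ x, H' x = if x ∈ T then G x else H x := by
    intro x
    rw [hH', reprogram]
    by_cases hx : ∃ i, xo i = x
    · rw [dif_pos hx, hyo, hx.choose_spec, if_pos (by simpa [hT] using hx)]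
    · rw [dif_neg hx, if_neg (by simpa [hT] using hx)]
  refine le_trans (le_of_eq ?_) (simulator_lowerBound (H := H) (G := G) (H' := H') (A := A)
    (P := fun s => EquivPerm (fun i : Fin k => readReg m (AReg.out i) s) xo ∧
      Accepts R H' (fun i : Fin k => readReg m (AReg.out i) s)
        (fun i => H' (readReg m (AReg.out i) s)) (readReg l AReg.aux s)) hcard hrep ?_ ?_)
  · rw [mul_comm, ← div_eq_mul_one_div]
    congr 1
    rw [numChoices]
    push_cast
    ring
  · rintro s ⟨⟨π, hπ⟩, -⟩
    rw [hcard]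
    have hx : ∀ (j : ℕ) (hj : j < k), readReg m (AReg.out j) s = xo (π ⟨j, hj⟩) :=
      fun j hj => congrFun hπ ⟨j, hj⟩
    refine ⟨fun j hj => ?_, fun j hj j' hj' h => ?_⟩
    · rw [hx j hj]
      exact Finset.mem_image_of_mem _ (Finset.mem_univ _)
    · rw [hx j hj, hx j' hj'] at h
      simpa using π.injective (hxo h)
  · rintro s ⟨h1, h2⟩
    have hy : (fun i : Fin k => readReg n (SReg.own 0 i) (encOut H G k (T.val, s))) =
        fun i : Fin k => H' (readReg m (AReg.out i) s) := by
      funext i j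
      have : reproFn H G T.val (readReg m (AReg.out i) s) = H' (readReg m (AReg.out i) s) := by
        rw [reproFn_of_le le_rfl, hrep]; rfl
      simp [readReg, encOut, recConf, conf, bitOf, ← this]
    refine ⟨h1, ?_⟩
    rw [hy]
    exact h2
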